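/- All vector spaces are over $\mathbb C$. Let $(V,\omega,h)$ be a charged conformal vertex algebra: a vertex algebra with a conformal vector $\omega$, $Y(\omega,z)=\sum_n L_n z^{-n-2}$, such that $L_0$ is diagonalizable on $V$ with integer eigenvalues bounded below, together with a current $h\in V_1$ satisfying $h_nh=0$ for $n\ge 2$, $h_1h=2\kappa|0\rangle$ for some $\kappa\in\mathbb C$, and $L_1h=0$, whose zero mode $h_0=h_{(0)}$ is diagonalizable on $V$ with integer eigenvalues (charges). Write $V_\Delta$ and $V^{(c)}$ for the eigenspaces of $L_0$ and $h_0$, and for $a\in V_\Delta$ put $\Delta_a=\Delta$ and $a_0=a_{(\Delta-1)}$ (extended linearly to all $a\in V$). Assume that $V$ is finitely strongly generated: there is a finite set $U\subset V$ such that $V$ is spanned by the vectors $u^{(1)}_{(-n_1)}\cdots u^{(r)}_{(-n_r)}|0\rangle$ with $r\ge 0$, $u^{(i)}\in U$ and $n_i\ge 1$. Let $A(V)=V/J$ be the Zhu algebra, where $J$ is spanned by the vectors $\operatorname{Res}_w w^{-2}(1+w)^{\Delta_a}Y(a,w)b\,dw$ and the product is induced by $a*b=\operatorname{Res}_w w^{-1}(1+w)^{\Delta_a}Y(a,w)b\,dw$.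 It is graded by charge, $A(V)=\bigoplus_{c\in\mathbb Z}A(V)^{(c)}$; put $A(V)^{(>0)}=\bigoplus_{c>0}A(V)^{(c)}$. The stable Zhu algebra is $$A^{\mathrm{stab}}(V)=A(V)^{(0)}\big/\bigl(A(V)A(V)^{(>0)}\bigr)^{(0)} .$$ A $V$-module $M$ is called stable if it is the direct sum of the joint eigenspaces $M_\Delta^{(k)}$ of $L_0$ (eigenvalue $\Delta\in\mathbb C$) and $h_0$ (eigenvalue $k\in\mathbb C$), every $M_\Delta^{(k)}$ is finite dimensional, there is a real $B$ with $M_\Delta^{(k)}=0$ whenever $\operatorname{Re}\Delta<B$, and for every $\Delta$ there is a real $K$ with $M_\Delta^{(k)}=0$ whenever $\operatorname{Re}k>K$. If $\Delta_0$ is the least $\Delta$ with $M_\Delta=\bigoplus_k M_\Delta^{(k)}\ne 0$ and $k_0$ is the greatest $k$ with $M_{\Delta_0}^{(k)}\ne 0$ (where $z\le w$ for complex numbers means $w-z\in\mathbb R_{\ge 0}$), then $M_{\mathrm{peak}}=M_{\Delta_0}^{(k_0)}$. It is a left $A^{\mathrm{stab}}(V)$-module on which the class of $a\in V^{(0)}$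 acts by $a_0$. **Theorem.** For every finite-dimensional irreducible left $A^{\mathrm{stab}}(V)$-module $P$ there exists an irreducible stable $V$-module $M$ which has a peak space (that is, $\Delta_0$ and $k_0$ as above exist) and for which $M_{\mathrm{peak}}\cong P$ as $A^{\mathrm{stab}}(V)$-modules. -/

import Mathlib

universe u v

noncomputable section

open scoped VertexOperator

/-- The binomial coefficient `m (m - 1) ⋯ (m - j + 1) / j!` of an integer `m`. -/
abbrev intBinom (m : ℤ) (j : ℕ) : ℤ := Ring.choose m j

/-- A vertex algebra over `ℂ`. The state-field map sends `a` to the field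
`Y(a, z) = ∑ a_(n) z^(-n-1)`; that `Y(a, z) b` is a Laurent series is part of the type
`VertexOperator ℂ V`. -/
class VertexAlgebra (V : Type*) [AddCommGroup V] [Module ℂ V] where
  /-- the vacuum vector -/
  vac : V
  /-- the state-field map -/
  Y : V →ₗ[ℂ] VertexOperator ℂ V
  vac_mode : ∀ (n : ℤ) (b : V), ((Y vac)[[n]]) b = if n = -1 then b else 0
  mode_vac_nonneg : ∀ (a : V) (n : ℤ), 0 ≤ n → ((Y a)[[n]]) vac = 0
  mode_vac_neg_one : ∀ a : V, ((Y a)[[-1]]) vac = a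
  borcherds : ∀ (a b c : V) (k m n : ℤ),
    (∑ᶠ j : ℕ, intBinom m j • ((Y (((Y a)[[n + j]]) b))[[m + k - j]]) c) =
      (∑ᶠ j : ℕ, ((-1 : ℂ) ^ j * intBinom n j) •
        ((Y a)[[m + n - j]]) (((Y b)[[k + j]]) c)) -
      ∑ᶠ j : ℕ, ((-1 : ℂ) ^ ((j : ℤ) + n) * intBinom n j) •
        ((Y b)[[n + k - j]]) (((Y a)[[m + j]]) c)

/-- A module over a vertex algebra: a space `M` with fields `Y^M(a, z) = ∑ a_(n) z^(-n-1)`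
on `M`, for `a ∈ V`, such that `Y^M(|0⟩, z) = Id` and the Borcherds identity holds on `M`. -/
class VertexModule (V : Type*) (M : Type*) [AddCommGroup V] [Module ℂ V] [VertexAlgebra V]
    [AddCommGroup M] [Module ℂ M] where
  /-- the fields on the module -/
  YM : V →ₗ[ℂ] VertexOperator ℂ M
  vac_mode : ∀ (n : ℤ) (x : M),
    ((YM VertexAlgebra.vac)[[n]]) x = if n = -1 then x else 0
  borcherds : ∀ (a b : V) (x : M) (k m n : ℤ),
    (∑ᶠ j : ℕ, intBinom m j •
        ((YM (((VertexAlgebra.Y a)[[n + j]]) b))[[m + k - j]]) x) =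
      (∑ᶠ j : ℕ, ((-1 : ℂ) ^ j * intBinom n j) •
        ((YM a)[[m + n - j]]) (((YM b)[[k + j]]) x)) -
      ∑ᶠ j : ℕ, ((-1 : ℂ) ^ ((j : ℤ) + n) * intBinom n j) •
        ((YM b)[[n + k - j]]) (((YM a)[[m + j]]) x)

/-- The adjoint module. -/
instance VertexAlgebra.adjoint (V : Type*) [AddCommGroup V] [Module ℂ V] [VertexAlgebra V] :
    VertexModule V V where
  YM := VertexAlgebra.Y
  vac_mode := VertexAlgebra.vac_mode
  borcherds := VertexAlgebra.borcherds

section Modes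

variable {V : Type*} {M : Type*} [AddCommGroup V] [Module ℂ V] [VertexAlgebra V]
    [AddCommGroup M] [Module ℂ M] [VertexModule V M]

variable (V) in
/-- The vacuum vector. -/
abbrev vacuum : V := VertexAlgebra.vac

variable (M) in
/-- The mode `a_(n)` acting on a `V`-module `M` (for instance on `M = V`). -/
def mode (a : V) (n : ℤ) : M →ₗ[ℂ] M := (VertexModule.YM a)[[n]]

theorem mode_add (a b : V) (n : ℤ) : mode M (a + b) n = mode M a n + mode M b n := by
  simp [mode]

theorem mode_smul (r : ℂ) (a : V) (n : ℤ) : mode M (r • a) n = r • mode M a n := by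
  simp [mode]

theorem mode_vacuum (n : ℤ) (x : M) : mode M (vacuum V) n x = if n = -1 then x else 0 :=
  VertexModule.vac_mode n x

theorem mode_apply_vacuum_nonneg (a : V) (n : ℤ) (hn : 0 ≤ n) : mode V a n (vacuum V) = 0 :=
  VertexAlgebra.mode_vac_nonneg a n hn

theorem mode_apply_vacuum (a : V) : mode V a (-1) (vacuum V) = a :=
  VertexAlgebra.mode_vac_neg_one a

theorem mode_truncated (a : V) (x : M) : ∃ N : ℤ, ∀ n, N ≤ n → mode M a n x = 0 := by
  refine ⟨-(HahnSeries.order ((HahnModule.of ℂ).symm (VertexModule.YM a x))), fun n hn => ?_⟩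
  exact VertexOperator.ncoeff_eq_zero_of_lt_order _ _ _ (by lia)

theorem mode_borcherds (a b : V) (x : M) (k m n : ℤ) :
    (∑ᶠ j : ℕ, intBinom m j • mode M (mode V a (n + j) b) (m + k - j) x) =
      (∑ᶠ j : ℕ, ((-1 : ℂ) ^ j * intBinom n j) • mode M a (m + n - j) (mode M b (k + j) x)) -
      ∑ᶠ j : ℕ, ((-1 : ℂ) ^ ((j : ℤ) + n) * intBinom n j) •
        mode M b (n + k - j) (mode M a (m + j) x) :=
  VertexModule.borcherds a b x k m n

end Modes

theorem finsum_eq_sum_range {E : Type*} [AddCommMonoid E] (f : ℕ → E) (N : ℕ)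
    (h : ∀ j, N ≤ j → f j = 0) : ∑ᶠ j, f j = ∑ j ∈ Finset.range N, f j := by
  apply finsum_eq_sum_of_support_subset
  intro j hj
  by_contra hc
  simp at hc
  exact hj (h j hc)

/-- `∑ j, binom(α, j) u(s + j)`, a finite sum when `u` vanishes far to the right. -/
def binomSum {E : Type*} [AddCommGroup E] (α : ℤ) (u : ℤ → E) (s : ℤ) : E :=
  ∑ᶠ j : ℕ, intBinom α j • u (s + j)

section BinomSum

variable {E : Type*} [AddCommGroup E]

theorem binomSum_eq (α : ℤ) (u : ℤ → E) (s : ℤ) (N : ℕ) (h : ∀ i, s + N ≤ i → u i = 0) :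
    binomSum α u s = ∑ j ∈ Finset.range N, intBinom α j • u (s + j) :=
  finsum_eq_sum_range _ _ fun j hj => by rw [h _ (by lia), smul_zero]

theorem sum_binomSum (α β : ℤ) (u : ℤ → E) (s : ℤ) (N K : ℕ)
    (h : ∀ i, s + N ≤ i → u i = 0) (hK : N ≤ K) :
    ∑ i ∈ Finset.range K, ∑ l ∈ Finset.range K,
      (intBinom α i * intBinom β l) • u (s + i + l) = binomSum (α + β) u s := by
  rw [binomSum_eq _ u s N h, ← Finset.sum_product', ]
  have key : ∀ t ∈ Finset.range N, intBinom (α + β) t • u (s + t) =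
      ∑ p ∈ Finset.HasAntidiagonal.antidiagonal t, (intBinom α p.1 * intBinom β p.2) • u (s + p.1 + p.2) := by
    intro t _
    rw [intBinom, Ring.add_choose_eq t (Commute.all α β), Finset.sum_smul]
    refine Finset.sum_congr rfl fun p hp => ?_
    have := Finset.HasAntidiagonal.mem_antidiagonal.1 hp
    rw [show s + (p.1 : ℤ) + p.2 = s + t by lia]
  rw [Finset.sum_congr rfl key, Finset.sum_sigma']
  symm
  refine Finset.sum_of_injOn (fun x => x.2) ?_ ?_ ?_ ?_
  · rintro ⟨t, p⟩ h1 ⟨t', p'⟩ h2 h3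
    simp at h1 h2 h3
    subst h3
    have : t = t' := by lia
    subst this; rfl
  · rintro ⟨t, p⟩ h1
    simp at h1 ⊢
    lia
  · rintro ⟨i, l⟩ h1 h2
    rw [h _ _, smul_zero]
    by_contra hc
    refine h2 ⟨⟨i + l, (i, l)⟩, ?_, rfl⟩
    simp
    lia
  · rintro ⟨t, p⟩ h1
    rfl

theorem binomSum_zero (u : ℤ → E) (s : ℤ) : binomSum 0 u s = u s := by
  rw [binomSum, finsum_eq_sum_range _ 1]
  · simp
  · intro j hj
    rw [intBinom, Ring.choose_zero_pos ℤ (by lia), zero_smul]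

end BinomSum

section Iterate

variable {V : Type*} {M : Type*} [AddCommGroup V] [Module ℂ V] [VertexAlgebra V]
    [AddCommGroup M] [Module ℂ M] [VertexModule V M]

variable (M) in
/-- `modeSum M α s a x = ∑ j, binom(α, j) a_(s + j) x`, that is, the residue of
`w ^ s (1 + w) ^ α Y(a, w) x`. -/
def modeSum (α s : ℤ) : V →ₗ[ℂ] M →ₗ[ℂ] M :=
  LinearMap.mk₂ ℂ (fun a x => binomSum α (fun i => mode M a i x) s)
    (by
      intro a b x
      obtain ⟨N₁, h₁⟩ := mode_truncated a x
      obtain ⟨N₂, h₂⟩ := mode_truncated b x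
      have h3 : ∀ i, s + (max (N₁ - s) (N₂ - s)).toNat ≤ i → mode M (a + b) i x = 0 := by
        intro i hi
        rw [mode_add, LinearMap.add_apply, h₁ i (by lia), h₂ i (by lia), add_zero]
      rw [binomSum_eq _ _ s _ h3, binomSum_eq _ _ s (max (N₁ - s) (N₂ - s)).toNat (fun i hi => h₁ i (by lia)),
        binomSum_eq _ _ s (max (N₁ - s) (N₂ - s)).toNat (fun i hi => h₂ i (by lia)),
        ← Finset.sum_add_distrib]
      simp [mode_add])
    (by
      intro r a x
      obtain ⟨N₁, h₁⟩ := mode_truncated a x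
      have h3 : ∀ i, s + (N₁ - s).toNat ≤ i → mode M (r • a) i x = 0 := by
        intro i hi
        rw [mode_smul, LinearMap.smul_apply, h₁ i (by lia), smul_zero]
      rw [binomSum_eq _ _ s _ h3, binomSum_eq _ _ s (N₁ - s).toNat (fun i hi => h₁ i (by lia)),
        Finset.smul_sum]
      refine Finset.sum_congr rfl fun i _ => ?_
      rw [mode_smul, LinearMap.smul_apply, smul_comm])
    (by
      intro a x y
      obtain ⟨N₁, h₁⟩ := mode_truncated a x
      obtain ⟨N₂, h₂⟩ := mode_truncated a y
      have h3 : ∀ i, s + (max (N₁ - s) (N₂ - s)).toNat ≤ i → mode M a i (x + y) = 0 := by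
        intro i hi
        rw [map_add, h₁ i (by lia), h₂ i (by lia), add_zero]
      rw [binomSum_eq _ _ s _ h3, binomSum_eq _ _ s (max (N₁ - s) (N₂ - s)).toNat (fun i hi => h₁ i (by lia)),
        binomSum_eq _ _ s (max (N₁ - s) (N₂ - s)).toNat (fun i hi => h₂ i (by lia)),
        ← Finset.sum_add_distrib]
      simp)
    (by
      intro r a x
      obtain ⟨N₁, h₁⟩ := mode_truncated a x
      have h3 : ∀ i, s + (N₁ - s).toNat ≤ i → mode M a i (r • x) = 0 := by
        intro i hi
        rw [map_smul, h₁ i (by lia), smul_zero]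
      rw [binomSum_eq _ _ s _ h3, binomSum_eq _ _ s (N₁ - s).toNat (fun i hi => h₁ i (by lia)),
        Finset.smul_sum]
      refine Finset.sum_congr rfl fun i _ => ?_
      rw [map_smul, smul_comm])

theorem modeSum_apply (α s : ℤ) (a : V) (x : M) :
    modeSum M α s a x = binomSum α (fun i => mode M a i x) s := rfl

theorem modeSum_eq (α s : ℤ) (a : V) (x : M) (N : ℕ)
    (h : ∀ i, s + N ≤ i → mode M a i x = 0) :
    modeSum M α s a x = ∑ j ∈ Finset.range N, intBinom α j • mode M a (s + j) x :=
  binomSum_eq _ _ s N h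

/-- For finitely many truncated families there is a common bound. -/
theorem exists_bound {E : Type*} [Zero E] (J : ℕ) (u : ℕ → ℤ → E)
    (h : ∀ j, ∃ N : ℤ, ∀ n, N ≤ n → u j n = 0) (s : ℤ) :
    ∃ K : ℕ, ∀ j < J, ∀ n, s + K ≤ n → u j n = 0 := by
  induction J with
  | zero => exact ⟨0, fun j hj => by lia⟩
  | succ J ih =>
    obtain ⟨K, hK⟩ := ih
    obtain ⟨N, hN⟩ := h J
    refine ⟨max K (N - s).toNat, fun j hj n hn => ?_⟩
    rcases Nat.lt_succ_iff_lt_or_eq.1 hj with h1 | rfl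
    · exact hK j h1 n (by push_cast at hn; lia)
    · exact hN n (by push_cast at hn; lia)

/-- The Borcherds identity with `(1 + x) ^ α (1 + w) ^ β` inserted. -/
theorem modeSum_borcherds (a b : V) (x : M) (α β n k : ℤ) :
    (∑ᶠ j : ℕ, intBinom α j • modeSum M (α + β - j) k (mode V a (n + j) b) x) =
      (∑ᶠ j : ℕ, ((-1 : ℂ) ^ j * intBinom n j) •
        modeSum M α (n - j) a (modeSum M β (k + j) b x)) -
      ∑ᶠ j : ℕ, ((-1 : ℂ) ^ ((j : ℤ) + n) * intBinom n j) •
        modeSum M β (n + k - j) b (modeSum M α j a x) := by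
  obtain ⟨N₁, h₁⟩ := mode_truncated (M := V) a b
  obtain ⟨N₂, h₂⟩ := mode_truncated a x
  obtain ⟨N₃, h₃⟩ := mode_truncated b x
  obtain ⟨N, hN1, hN2, hN3⟩ : ∃ N : ℕ, N₁ ≤ n + N ∧ N₂ ≤ N ∧ N₃ ≤ k + N :=
    ⟨(max (N₁ - n) (max N₂ (N₃ - k))).toNat, by lia, by lia, by lia⟩
  obtain ⟨K₁, hK₁⟩ := exists_bound N (fun j i => mode M (mode V a (n + j) b) i x)
    (fun j => mode_truncated _ _) k
  obtain ⟨K₂, hK₂⟩ := exists_bound (2 * N) (fun j i => mode M a i (mode M b (k + j) x))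
    (fun j => mode_truncated _ _) n
  obtain ⟨K₃, hK₃⟩ := exists_bound (2 * N) (fun j i => mode M b i (mode M a j x))
    (fun j => mode_truncated _ _) (n + k)
  let K := N + K₁ + K₂ + K₃
  have hK : K = N + K₁ + K₂ + K₃ := rfl
  -- the sum of the Borcherds identities over the box
  have B : ∀ p q : ℕ,
      (∑ j ∈ Finset.range N, intBinom p j •
          mode M (mode V a (n + j) b) (p + (k + q) - j) x) =
        (∑ j ∈ Finset.range N, ((-1 : ℂ) ^ j * intBinom n j) •
          mode M a (p + n - j) (mode M b (k + q + j) x)) -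
        ∑ j ∈ Finset.range N, ((-1 : ℂ) ^ ((j : ℤ) + n) * intBinom n j) •
          mode M b (n + (k + q) - j) (mode M a (p + j) x) := by
    intro p q
    have := mode_borcherds a b x (k + q) p n
    rw [finsum_eq_sum_range _ N, finsum_eq_sum_range _ N, finsum_eq_sum_range _ N] at this
    · exact this
    · intro j hj
      rw [h₂ _ (by lia), map_zero, smul_zero]
    · intro j hj
      rw [h₃ _ (by lia), map_zero, smul_zero]
    · intro j hj
      rw [h₁ _ (by lia)]
      have : mode M (0 : V) (p + (k + q) - j) = 0 := by simp [mode]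
      rw [this, LinearMap.zero_apply, smul_zero]
  have S : ∑ p ∈ Finset.range K, ∑ q ∈ Finset.range K, (intBinom α p * intBinom β q) •
        (∑ j ∈ Finset.range N, intBinom p j •
          mode M (mode V a (n + j) b) (p + (k + q) - j) x) =
      ∑ p ∈ Finset.range K, ∑ q ∈ Finset.range K, (intBinom α p * intBinom β q) •
        ((∑ j ∈ Finset.range N, ((-1 : ℂ) ^ j * intBinom n j) •
          mode M a (p + n - j) (mode M b (k + q + j) x)) -
        ∑ j ∈ Finset.range N, ((-1 : ℂ) ^ ((j : ℤ) + n) * intBinom n j) •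
          mode M b (n + (k + q) - j) (mode M a (p + j) x)) :=
    Finset.sum_congr rfl fun p _ => Finset.sum_congr rfl fun q _ => by rw [B p q]
  have e1 : (∑ᶠ j : ℕ, intBinom α j • modeSum M (α + β - j) k (mode V a (n + j) b) x) =
      ∑ j ∈ Finset.range N, ∑ p ∈ Finset.range K, ∑ q ∈ Finset.range K,
        (intBinom α p * intBinom β q * intBinom p j) •
          mode M (mode V a (n + j) b) (p + (k + q) - j) x := by
    rw [finsum_eq_sum_range _ N]
    · refine Finset.sum_congr rfl fun j hj => ?_
      have hj' := Finset.mem_range.1 hj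
      rw [modeSum_apply, show α + β - (j : ℤ) = (α - j) + β by ring,
        ← sum_binomSum (α - j) β _ k K₁ (K - j) (fun i hi => hK₁ j hj' i hi) (by lia)]
      rw [← Finset.sum_range_add_sum_Ico _ (show j ≤ K by lia)]
      rw [Finset.sum_eq_zero (s := Finset.range j), zero_add, Finset.sum_Ico_eq_sum_range,
        Finset.smul_sum]
      · refine Finset.sum_congr rfl fun p hp => ?_
        rw [← Finset.sum_range_add_sum_Ico _ (show K - j ≤ K by lia)]
        rw [Finset.sum_eq_zero (s := Finset.Ico (K - j) K), add_zero, Finset.smul_sum]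
        · refine Finset.sum_congr rfl fun q hq => ?_
          rw [smul_smul]
          have e : ((j + p : ℕ) : ℤ) + (k + q) - j = k + p + q := by push_cast; ring
          rw [e]
          congr 1
          have h1 := Ring.choose_smul_choose α (n := j + p) (k := j) (by lia)
          have h2 : intBinom ((j + p : ℕ) : ℤ) j = ((j + p).choose j : ℤ) :=
            Ring.choose_natCast _ _
          rw [h2]
          simp only [nsmul_eq_mul, Nat.add_sub_cancel_left] at h1
          simp only [intBinom] at *
          rw [mul_right_comm, mul_comm (Ring.choose α (j + p)), h1]
          ring
        · intro q hq
          have := Finset.mem_Ico.1 hq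
          rw [hK₁ j hj' _ (by push_cast; lia), smul_zero]
      · intro p hp
        have := Finset.mem_range.1 hp
        refine Finset.sum_eq_zero fun q _ => ?_
        have h2 : intBinom (p : ℤ) j = (p.choose j : ℤ) := Ring.choose_natCast _ _
        rw [h2, Nat.choose_eq_zero_of_lt this]
        simp
    · intro j hj
      rw [h₁ _ (by lia), map_zero, LinearMap.zero_apply, smul_zero]
  have e2 : (∑ᶠ j : ℕ, ((-1 : ℂ) ^ j * intBinom n j) •
        modeSum M α (n - j) a (modeSum M β (k + j) b x)) =
      ∑ j ∈ Finset.range N, ∑ p ∈ Finset.range K, ∑ q ∈ Finset.range K,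
        (intBinom α p * intBinom β q) • ((-1 : ℂ) ^ j * intBinom n j) •
          mode M a (p + n - j) (mode M b (k + q + j) x) := by
    rw [finsum_eq_sum_range _ N]
    · refine Finset.sum_congr rfl fun j hj => ?_
      have hj' := Finset.mem_range.1 hj
      rw [Finset.sum_comm,
        modeSum_eq β (k + j) b x K (fun i hi => h₃ i (by lia)), map_sum, Finset.smul_sum]
      refine Finset.sum_congr rfl fun q hq => ?_
      have hz : ∀ i, n - j + (K : ℤ) ≤ i → mode M a i (mode M b (k + j + q) x) = 0 := by
        intro i hi
        by_cases hqN : q < N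
        · have := hK₂ (j + q) (by lia) i (by lia)
          rw [← this]
          congr 3
          push_cast; ring
        · rw [h₃ _ (by lia), map_zero]
      rw [map_zsmul, modeSum_eq α (n - j) a _ K hz, Finset.smul_sum, Finset.smul_sum]
      refine Finset.sum_congr rfl fun p hp => ?_
      rw [show (n - j + p : ℤ) = p + n - j by ring, show (k + j + q : ℤ) = k + q + j by ring]
      module
    · intro j hj
      have : modeSum M β (k + j) b x = 0 := by
        rw [modeSum_eq β (k + j) b x 0 (fun i hi => h₃ i (by push_cast at hi; lia))]; simp
      rw [this, map_zero, smul_zero]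
  have e3 : (∑ᶠ j : ℕ, ((-1 : ℂ) ^ ((j : ℤ) + n) * intBinom n j) •
        modeSum M β (n + k - j) b (modeSum M α j a x)) =
      ∑ j ∈ Finset.range N, ∑ p ∈ Finset.range K, ∑ q ∈ Finset.range K,
        (intBinom α p * intBinom β q) • ((-1 : ℂ) ^ ((j : ℤ) + n) * intBinom n j) •
          mode M b (n + (k + q) - j) (mode M a (p + j) x) := by
    rw [finsum_eq_sum_range _ N]
    · refine Finset.sum_congr rfl fun j hj => ?_
      have hj' := Finset.mem_range.1 hj
      rw [modeSum_eq α j a x K (fun i hi => h₂ i (by lia)), map_sum, Finset.smul_sum]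
      refine Finset.sum_congr rfl fun p hp => ?_
      have hz : ∀ i, n + k - j + (K : ℤ) ≤ i → mode M b i (mode M a (j + p) x) = 0 := by
        intro i hi
        by_cases hpN : p < N
        · have := hK₃ (j + p) (by lia) i (by lia)
          rw [← this]
          congr 3
        · rw [h₂ _ (by lia), map_zero]
      rw [map_zsmul, modeSum_eq β (n + k - j) b _ K hz, Finset.smul_sum, Finset.smul_sum]
      refine Finset.sum_congr rfl fun q hq => ?_
      rw [show (n + k - j + q : ℤ) = n + (k + q) - j by ring, show (j + p : ℤ) = p + j by ring]
      module
    · intro j hj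
      have : modeSum M α j a x = 0 := by
        rw [modeSum_eq α j a x 0 (fun i hi => h₂ i (by push_cast at hi; lia))]; simp
      rw [this, map_zero, smul_zero]
  rw [e1, e2, e3]
  have comm3 : ∀ f : ℕ → ℕ → ℕ → M,
      ∑ j ∈ Finset.range N, ∑ p ∈ Finset.range K, ∑ q ∈ Finset.range K, f j p q =
      ∑ p ∈ Finset.range K, ∑ q ∈ Finset.range K, ∑ j ∈ Finset.range N, f j p q := by
    intro f
    rw [Finset.sum_comm]
    exact Finset.sum_congr rfl fun p _ => Finset.sum_comm
  rw [comm3, comm3, comm3]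
  simp only [Finset.smul_sum, smul_sub, Finset.sum_sub_distrib, smul_smul] at S ⊢
  exact S

end Iterate

/-- A conformal vertex algebra: a vertex algebra with a conformal vector `ω`, where
`L_n = ω_(n+1)`, such that `L_(-1) = T`, the `L_n` satisfy the Virasoro relations, and `L_0` is
diagonalizable with integer eigenvalues that are bounded below. -/
class ConformalVertexAlgebra (V : Type*) [AddCommGroup V] [Module ℂ V] extends
    VertexAlgebra V where
  /-- the conformal vector `ω` -/
  conformalVector : V
  /-- the central charge -/
  centralCharge : ℂ
  translation : ∀ a : V, mode V conformalVector 0 a = mode V a (-2) (vacuum V)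
  virasoro : ∀ (n m : ℤ) (x : V),
    mode V conformalVector (n + 1) (mode V conformalVector (m + 1) x) -
        mode V conformalVector (m + 1) (mode V conformalVector (n + 1) x) =
      ((n : ℂ) - m) • mode V conformalVector (n + m + 1) x +
        if n = -m then (((n : ℂ) ^ 3 - n) / 12 * centralCharge) • x else 0
  weights_integral :
    ⨆ Δ : ℤ, Module.End.eigenspace (mode V conformalVector 1) (Δ : ℂ) = ⊤
  weights_bounded : ∃ B : ℤ, ∀ Δ : ℤ, Δ < B →
    Module.End.eigenspace (mode V conformalVector 1) (Δ : ℂ) = ⊥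

/-- A charged conformal vertex algebra: a conformal vertex algebra with a quasi-primary current
`h` of conformal weight one such that `h_(0)` is diagonalizable with integer eigenvalues. -/
class ChargedConformalVertexAlgebra (V : Type*) [AddCommGroup V] [Module ℂ V] extends
    ConformalVertexAlgebra V where
  /-- the current `h` -/
  current : V
  /-- the index `κ` -/
  index : ℂ
  current_weight : mode V conformalVector 1 current = current
  current_mode : ∀ n : ℤ, 2 ≤ n → mode V current n current = 0
  current_mode_one : mode V current 1 current = (2 * index) • vacuum V
  current_quasiprimary : mode V conformalVector 2 current = 0
  charges_integral : ⨆ k : ℤ, Module.End.eigenspace (mode V current 0) (k : ℂ) = ⊤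

section Weights

variable (V : Type*) (M : Type*) [AddCommGroup V] [Module ℂ V]
    [AddCommGroup M] [Module ℂ M]

/-- The eigenspace `M_Δ` of `L_0` on a module. -/
def energySpace [ConformalVertexAlgebra V] [VertexModule V M] (Δ : ℂ) : Submodule ℂ M :=
  Module.End.eigenspace (mode M (ConformalVertexAlgebra.conformalVector : V) 1) Δ

/-- The eigenspace `M^(k)` of `h_0` on a module. -/
def chargeSpace [ChargedConformalVertexAlgebra V] [VertexModule V M] (k : ℂ) : Submodule ℂ M :=
  Module.End.eigenspace (mode M (ChargedConformalVertexAlgebra.current : V) 0) k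

/-- The joint eigenspace `M_Δ^(k)`. -/
def weightSpace [ChargedConformalVertexAlgebra V] [VertexModule V M] (Δ k : ℂ) :
    Submodule ℂ M :=
  energySpace V M Δ ⊓ chargeSpace V M k

end Weights

section Commutators

variable {V : Type*} {M : Type*} [AddCommGroup V] [Module ℂ V] [VertexAlgebra V]
    [AddCommGroup M] [Module ℂ M] [VertexModule V M]

variable (M) in
/-- The mode `a_(n)` as a linear function of `a`. -/
def modeHom (n : ℤ) : V →ₗ[ℂ] Module.End ℂ M where
  toFun a := mode M a n
  map_add' a b := mode_add a b n
  map_smul' r a := mode_smul r a n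

theorem mode_zero (n : ℤ) : mode M (0 : V) n = 0 := (modeHom M n).map_zero

theorem mode_commutator (a b : V) (m k : ℤ) (x : M) :
    mode M a m (mode M b k x) - mode M b k (mode M a m x) =
      ∑ᶠ j : ℕ, intBinom m j • mode M (mode V a j b) (m + k - j) x := by
  have := mode_borcherds a b x k m 0
  rw [finsum_eq_sum_range (fun j : ℕ => ((-1 : ℂ) ^ j * intBinom 0 j) • _) 1,
    finsum_eq_sum_range (fun j : ℕ => ((-1 : ℂ) ^ ((j : ℤ) + 0) * intBinom 0 j) • _) 1] at this
  · simpa using this.symm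
  · intro j hj
    rw [intBinom, Ring.choose_zero_pos ℤ (by lia)]
    simp
  · intro j hj
    rw [intBinom, Ring.choose_zero_pos ℤ (by lia)]
    simp

theorem sign_binom_neg_one (j : ℕ) : (-1 : ℂ) ^ j * intBinom (-1) j = 1 := by
  rw [intBinom, Ring.choose_neg]
  rcases Nat.even_or_odd j with hj | hj <;>
    simp [Int.negOnePow_def, Units.smul_def, hj.neg_one_pow, Ring.choose_natCast]

theorem sign_binom_neg_two (j : ℕ) : (-1 : ℂ) ^ j * intBinom (-2) j = j + 1 := by
  rw [intBinom, Ring.choose_neg]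
  have : Ring.choose (2 + (j : ℤ) - 1) j = j + 1 := by
    rw [show (2 + (j : ℤ) - 1) = ((j + 1 : ℕ) : ℤ) by push_cast; ring, Ring.choose_natCast]
    simp
  rw [this]
  rcases Nat.even_or_odd j with hj | hj <;>
    simp [Int.negOnePow_def, Units.smul_def, hj.neg_one_pow, add_comm]

theorem sign_neg_one (j : ℕ) : (-1 : ℂ) ^ ((j : ℤ) + -1) = - (-1) ^ j := by
  rw [zpow_add₀ (by norm_num)]; simp

theorem sign_neg_two (j : ℕ) : (-1 : ℂ) ^ ((j : ℤ) + -2) = (-1) ^ j := by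
  rw [zpow_add₀ (by norm_num)]; simp

/-- `(T a)_(n) = - n a_(n-1)`. -/
theorem mode_translation (a : V) (n : ℤ) (x : M) :
    mode M (mode V a (-2) (vacuum V)) n x = -(n : ℂ) • mode M a (n - 1) x := by
  have := mode_borcherds a (vacuum V) x n 0 (-2)
  rw [finsum_eq_sum_range _ 1] at this
  swap
  · intro j hj
    rw [intBinom, Ring.choose_zero_pos ℤ (by lia)]
    simp
  simp only [sign_neg_two, sign_binom_neg_two, mode_vacuum] at this
  simp only [Finset.range_one, Finset.sum_singleton, intBinom, Ring.choose_zero_right, one_smul,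
    Nat.cast_zero, add_zero, sub_zero, zero_add] at this
  rw [this]
  rcases lt_or_ge n 0 with hn | hn
  · rw [finsum_eq_single _ (-1 - n).toNat, finsum_eq_zero_of_forall_eq_zero]
    · rw [if_pos (by lia), sub_zero]
      have e : (((-1 - n).toNat : ℕ) : ℤ) = -1 - n := by lia
      have e' : (((-1 - n).toNat : ℕ) : ℂ) = -1 - n := by exact_mod_cast congrArg (Int.cast : ℤ → ℂ) e
      rw [e, e']
      congr 1
      · ring
      · congr 2; ring
    · intro j
      rw [if_neg (by lia), smul_zero]
    · intro j hj
      rw [if_neg (by lia), map_zero, smul_zero]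
  · rw [finsum_eq_zero_of_forall_eq_zero, zero_sub]
    · rcases hn.eq_or_lt with rfl | hn
      · rw [finsum_eq_zero_of_forall_eq_zero]
        · simp
        · intro j
          rw [if_neg (by lia), smul_zero]
      · rw [finsum_eq_single _ (n - 1).toNat]
        · rw [if_pos (by lia)]
          have e : (((n - 1).toNat : ℕ) : ℤ) = n - 1 := by lia
          have e' : (((n - 1).toNat : ℕ) : ℂ) = n - 1 := by
            exact_mod_cast congrArg (Int.cast : ℤ → ℂ) e
          rw [e, e', neg_smul]
          congr 2
          ring
        · intro j hj
          rw [if_neg (by lia), smul_zero]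
    · intro j
      rw [if_neg (by lia), map_zero, smul_zero]

theorem binomSum_succ {E : Type*} [AddCommGroup E] (α : ℤ) (u : ℤ → E) (s : ℤ)
    (h : ∃ N : ℤ, ∀ n, N ≤ n → u n = 0) :
    binomSum (α + 1) u s = binomSum α u s + binomSum α u (s + 1) := by
  obtain ⟨N, hN⟩ := h
  obtain ⟨K, hK⟩ : ∃ K : ℕ, N ≤ s + K := ⟨(N - s).toNat, by lia⟩
  rw [binomSum_eq _ u s (K + 1) (fun i hi => hN i (by push_cast at hi; lia)),
    binomSum_eq _ u s (K + 1) (fun i hi => hN i (by push_cast at hi; lia)),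
    binomSum_eq _ u (s + 1) K (fun i hi => hN i (by lia)),
    Finset.sum_range_succ', Finset.sum_range_succ' (fun j => intBinom α j • u (s + j))]
  simp only [intBinom, Ring.choose_succ_succ, add_smul, Finset.sum_add_distrib,
    Ring.choose_zero_right]
  have : ∀ i : ℕ, u (s + 1 + i) = u (s + (i + 1 : ℕ)) := fun i => by congr 1; push_cast; ring
  simp only [this]
  abel

theorem modeSum_succ (α s : ℤ) (a : V) (x : M) :
    modeSum M (α + 1) s a x = modeSum M α s a x + modeSum M α (s + 1) a x :=
  binomSum_succ _ _ _ (mode_truncated a x)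

theorem modeSum_truncated (α : ℤ) (a : V) (x : M) :
    ∃ N : ℤ, ∀ s, N ≤ s → modeSum M α s a x = 0 := by
  obtain ⟨N, hN⟩ := mode_truncated a x
  refine ⟨N, fun s hs => ?_⟩
  rw [modeSum_eq α s a x 0 (fun i hi => hN i (by push_cast at hi; lia))]
  simp

theorem modeSum_vacuum (s : ℤ) (x : M) :
    modeSum M 0 s (vacuum V) x = if s = -1 then x else 0 := by
  rw [modeSum_apply, binomSum_zero, mode_vacuum]

/-- A derivation of all modes is a derivation of the products `modeSum`. -/
theorem modeSum_derivation (h : V) (α s : ℤ) (a : V) (x : M) :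
    mode M h 0 (modeSum M α s a x) =
      modeSum M α s (mode V h 0 a) x + modeSum M α s a (mode M h 0 x) := by
  obtain ⟨N₁, h₁⟩ := mode_truncated a x
  obtain ⟨N₂, h₂⟩ := mode_truncated (mode V h 0 a) x
  obtain ⟨N₃, h₃⟩ := mode_truncated a (mode M h 0 x)
  obtain ⟨K, k1, k2, k3⟩ : ∃ K : ℕ, N₁ ≤ s + K ∧ N₂ ≤ s + K ∧ N₃ ≤ s + K :=
    ⟨(max (N₁ - s) (max (N₂ - s) (N₃ - s))).toNat, by lia, by lia, by lia⟩
  rw [modeSum_eq α s a x K (fun i hi => h₁ i (by lia)),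
    modeSum_eq α s _ x K (fun i hi => h₂ i (by lia)),
    modeSum_eq α s a _ K (fun i hi => h₃ i (by lia)), map_sum, ← Finset.sum_add_distrib]
  refine Finset.sum_congr rfl fun j _ => ?_
  have := mode_commutator h a 0 (s + j) x
  rw [finsum_eq_sum_range _ 1] at this
  · simp at this
    rw [map_zsmul, ← smul_add, ← this]
    abel_nf
  · intro j hj
    rw [intBinom, Ring.choose_zero_pos ℤ (by lia), zero_smul]

theorem mode_derivation (h : V) (a : V) (n : ℤ) (x : M) :
    mode M h 0 (mode M a n x) = mode M (mode V h 0 a) n x + mode M a n (mode M h 0 x) := by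
  have := modeSum_derivation h 0 n a x
  simpa only [modeSum_apply, binomSum_zero] using this

end Commutators

section Homogeneous

variable {V : Type*} {M : Type*} [AddCommGroup V] [Module ℂ V]
    [AddCommGroup M] [Module ℂ M]

section

variable [ConformalVertexAlgebra V] [VertexModule V M]

variable (V) in
/-- The conformal vector `ω`. -/
abbrev omega : V := ConformalVertexAlgebra.conformalVector

theorem mem_energySpace {Δ : ℂ} {x : M} :
    x ∈ energySpace V M Δ ↔ mode M (omega V) 1 x = Δ • x :=
  Module.End.mem_eigenspace_iff

variable (V) in
theorem energySpace_isInternal :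
    DirectSum.IsInternal (fun Δ : ℤ => energySpace V V (Δ : ℂ)) := by
  apply DirectSum.isInternal_submodule_of_iSupIndep_of_iSup_eq_top
  · exact (Module.End.eigenspaces_iSupIndep (mode V (omega V) 1)).comp
      (f := fun Δ : ℤ => (Δ : ℂ)) Int.cast_injective
  · exact ConformalVertexAlgebra.weights_integral

variable (V) in
theorem energySpace_bijective :
    Function.Bijective (DirectSum.coeLinearMap fun Δ : ℤ => energySpace V V (Δ : ℂ)) :=
  energySpace_isInternal V

/-- `L_0` acts on `a_(n) x` with eigenvalue `Δ + λ - n - 1`. -/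
theorem mode_mem_energySpace {Δ Λ Θ : ℂ} {a : V} {x : M} (n : ℤ)
    (ha : a ∈ energySpace V V Δ) (hx : x ∈ energySpace V M Λ) (hΘ : Θ = Δ + Λ - n - 1) :
    mode M a n x ∈ energySpace V M Θ := by
  rw [mem_energySpace] at *
  have h := mode_commutator (omega V) a 1 n x
  rw [finsum_eq_sum_range _ 2] at h
  · simp only [Finset.sum_range_succ, Finset.sum_range_zero, zero_add, intBinom,
      Ring.choose_zero_right, Ring.choose_one_right, Nat.cast_zero, Nat.cast_one, one_smul] at h
    rw [hx, ha, ConformalVertexAlgebra.translation, mode_translation, mode_smul, map_smul,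
      LinearMap.smul_apply] at h
    have e1 : (1 + n - 0 - 1 : ℤ) = n := by ring
    have e2 : (1 + n - 1 : ℤ) = n := by ring
    rw [e1, e2] at h
    rw [sub_eq_iff_eq_add] at h
    rw [h, hΘ]
    push_cast
    module
  · intro j hj
    have : intBinom 1 j = 0 := by
      have := Ring.choose_natCast (R := ℤ) 1 j
      rw [Nat.choose_eq_zero_of_lt hj] at this
      simpa using this
    rw [this, zero_smul]

theorem vacuum_mem : vacuum V ∈ energySpace V V 0 := by
  rw [mem_energySpace, mode_apply_vacuum_nonneg _ _ (by norm_num), zero_smul]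

theorem energy_induction {p : V → Prop}
    (h : ∀ (Δ : ℤ) (a : V), a ∈ energySpace V V (Δ : ℂ) → p a)
    (hadd : ∀ a b, p a → p b → p (a + b)) (a : V) : p a := by
  have ha : a ∈ ⨆ Δ : ℤ, energySpace V V (Δ : ℂ) := by
    have : ⨆ Δ : ℤ, energySpace V V (Δ : ℂ) = ⊤ := ConformalVertexAlgebra.weights_integral
    rw [this]; trivial
  exact Submodule.iSup_induction _ (motive := p) ha h (h 0 0 (zero_mem _)) hadd

/-- The linear map on `V = ⨁ V_Δ` that agrees with `f Δ` on `V_Δ`. -/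
def byWeight {E : Type*} [AddCommGroup E] [Module ℂ E] (f : ℤ → V →ₗ[ℂ] E) : V →ₗ[ℂ] E :=
  (DirectSum.toModule ℂ ℤ E fun Δ => (f Δ).comp (energySpace V V (Δ : ℂ)).subtype).comp
    (LinearEquiv.ofBijective (DirectSum.coeLinearMap fun Δ : ℤ => energySpace V V (Δ : ℂ))
      (energySpace_bijective V)).symm.toLinearMap

theorem byWeight_apply {E : Type*} [AddCommGroup E] [Module ℂ E] (f : ℤ → V →ₗ[ℂ] E)
    {Δ : ℤ} {a : V} (ha : a ∈ energySpace V V (Δ : ℂ)) : byWeight f a = f Δ a := by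
  have : (LinearEquiv.ofBijective (DirectSum.coeLinearMap
      fun Δ : ℤ => energySpace V V (Δ : ℂ)) (energySpace_bijective V)).symm a =
      DirectSum.lof ℂ ℤ (fun Δ : ℤ => energySpace V V (Δ : ℂ)) Δ ⟨a, ha⟩ := by
    rw [LinearEquiv.symm_apply_eq]
    simp
  simp [byWeight, this]

/-- The bilinear product with `zhuProd s a b = ∑ j, binom(Δ, j) a_(s + j) b`, the residue of
`w ^ s (1 + w) ^ Δ Y(a, w) b`, for `a ∈ V_Δ`. -/
def zhuProd (s : ℤ) : V →ₗ[ℂ] V →ₗ[ℂ] V := byWeight fun Δ => modeSum V Δ s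

theorem zhuProd_apply (s : ℤ) {Δ : ℤ} {a : V} (ha : a ∈ energySpace V V (Δ : ℂ)) (b : V) :
    zhuProd s a b = modeSum V Δ s a b := by
  rw [zhuProd, byWeight_apply _ ha]

variable (M) in
/-- The zero mode `a_0 = a_(Δ - 1)` for `a ∈ V_Δ`, extended linearly to all `a ∈ V`. -/
def zeroMode : V →ₗ[ℂ] Module.End ℂ M := byWeight fun Δ => modeHom M (Δ - 1)

theorem zeroMode_apply {Δ : ℤ} {a : V} (ha : a ∈ energySpace V V (Δ : ℂ)) :
    zeroMode M a = mode M a (Δ - 1) := by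
  rw [zeroMode, byWeight_apply _ ha]; rfl

variable (V) in
/-- The subspace `J`, spanned by the residues of `w ^ (-2) (1 + w) ^ Δ_a Y(a, w) b`. -/
def zhuIdeal : Submodule ℂ V :=
  Submodule.span ℂ {x | ∃ a b : V, zhuProd (-2) a b = x}

theorem zhuProd_mem (a b : V) (i : ℕ) : zhuProd (-2 - i) a b ∈ zhuIdeal V := by
  induction i generalizing a with
  | zero => exact Submodule.subset_span ⟨a, b, by simp⟩
  | succ i ih =>
    refine energy_induction (p := fun a => zhuProd (-2 - (i + 1 : ℕ)) a b ∈ zhuIdeal V)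
      (fun Δ a ha => ?_) (fun a a' h h' => ?_) a
    · -- compare with the product of `T a`
      have hT : mode V a (-2) (vacuum V) ∈ energySpace V V ((Δ + 1 : ℤ) : ℂ) :=
        mode_mem_energySpace (-2) ha vacuum_mem (by push_cast; ring)
      have h1 := ih (mode V a (-2) (vacuum V))
      have h2 := ih a
      rw [zhuProd_apply _ hT] at h1
      rw [zhuProd_apply _ ha] at h2 ⊢
      have B := modeSum_borcherds a (vacuum V) b (Δ + 1) 0 (-2) (-2 - i)
      simp only [sign_neg_two, sign_binom_neg_two, modeSum_vacuum] at B
      rw [finsum_eq_sum_range _ 2, finsum_eq_single _ (i + 1),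
        finsum_eq_zero_of_forall_eq_zero, sub_zero, if_pos (by push_cast; ring)] at B
      · simp only [Finset.sum_range_succ, Finset.sum_range_zero, zero_add, intBinom,
          Ring.choose_zero_right, Ring.choose_one_right, Nat.cast_zero, Nat.cast_one, one_smul,
          add_zero, sub_zero] at B
        rw [show (-2 + 1 : ℤ) = -1 by norm_num, mode_apply_vacuum,
          show (Δ + 1 - 1 : ℤ) = Δ by ring, modeSum_succ Δ (-2 - ((i + 1 : ℕ) : ℤ)) a b,
          show (-2 - ((i + 1 : ℕ) : ℤ) + 1) = -2 - i by push_cast; ring] at B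
        have hne : ((i + 1 : ℕ) : ℂ) + 1 ≠ 0 := by exact_mod_cast Nat.succ_ne_zero (i + 1)
        rw [← (zhuIdeal V).smul_mem_iff hne]
        have e : ((((i + 1 : ℕ) : ℂ) + 1) • modeSum V Δ (-2 - ((i + 1 : ℕ) : ℤ)) a b) =
            modeSum V (Δ + 1) (-2 - i) (mode V a (-2) (vacuum V)) b +
              ((Δ : ℂ) + 1 - (((i + 1 : ℕ) : ℂ) + 1)) • modeSum V Δ (-2 - i) a b := by
          rw [sub_smul, ← add_sub_assoc, eq_sub_iff_add_eq, ← smul_add, ← B]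
          have : ((Δ : ℂ) + 1) = ((Δ + 1 : ℤ) : ℂ) := by push_cast; ring
          rw [this, Int.cast_smul_eq_zsmul]
        rw [e]
        exact add_mem h1 (Submodule.smul_mem _ _ h2)
      · intro j
        rw [if_neg (by lia), smul_zero]
      · intro j hj
        rw [if_neg (by lia), map_zero, smul_zero]
      · intro j hj
        rw [mode_apply_vacuum_nonneg _ _ (by lia), map_zero, LinearMap.zero_apply, smul_zero]
    · simpa using add_mem h h'

theorem zhuProd_mem' (s : ℤ) (hs : s ≤ -2) (a b : V) : zhuProd s a b ∈ zhuIdeal V := by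
  have := zhuProd_mem a b (-2 - s).toNat
  rwa [show -2 - ((-2 - s).toNat : ℤ) = s by lia] at this

theorem zhuProd_truncated (a b : V) : ∃ N : ℤ, ∀ s, N ≤ s → zhuProd s a b = 0 := by
  refine energy_induction (p := fun a => ∃ N : ℤ, ∀ s, N ≤ s → zhuProd s a b = 0)
    (fun Δ a ha => ?_) (fun a a' h h' => ?_) a
  · obtain ⟨N, hN⟩ := modeSum_truncated (M := V) Δ a b
    exact ⟨N, fun s hs => by rw [zhuProd_apply _ ha, hN s hs]⟩
  · obtain ⟨N, hN⟩ := h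
    obtain ⟨N', hN'⟩ := h'
    refine ⟨max N N', fun s hs => ?_⟩
    rw [map_add, LinearMap.add_apply, hN s (by lia), hN' s (by lia), add_zero]


theorem finsum_mem_of_succ {E : Type*} [AddCommGroup E] [Module ℂ E] (W : Submodule ℂ E)
    (f : ℕ → E) (N : ℕ) (hN : ∀ j, N ≤ j → f j = 0) (h : ∀ j, f (j + 1) ∈ W) :
    ∑ᶠ j, f j - f 0 ∈ W := by
  rw [finsum_eq_sum_range f (N + 1) (fun j hj => hN j (by lia)), Finset.sum_range_succ',
    add_sub_cancel_right]
  exact sum_mem fun j _ => h j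

theorem finsum_mem_of_forall {E : Type*} [AddCommGroup E] [Module ℂ E] (W : Submodule ℂ E)
    (f : ℕ → E) (h : ∀ j, f j ∈ W) : ∑ᶠ j, f j ∈ W :=
  finsum_induction (· ∈ W) (zero_mem W) (fun _ _ => add_mem) h

theorem zhuProd_finsum {f : ℕ → V} {N : ℕ} (hN : ∀ j, N ≤ j → f j = 0) (Θ : ℤ)
    (hf : ∀ j : ℕ, f j ∈ energySpace V V ((Θ - j : ℤ) : ℂ)) (α s : ℤ) (c : V) :
    zhuProd s (∑ᶠ j : ℕ, intBinom α j • f j) c =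
      ∑ᶠ j : ℕ, intBinom α j • modeSum V (Θ - j) s (f j) c := by
  rw [finsum_eq_sum_range _ N (fun j hj => by rw [hN j hj, smul_zero]),
    finsum_eq_sum_range _ N (fun j hj => by
      rw [hN j hj, map_zero, LinearMap.zero_apply, smul_zero]), map_sum, LinearMap.sum_apply]
  refine Finset.sum_congr rfl fun j _ => ?_
  rw [map_zsmul, LinearMap.smul_apply, zhuProd_apply _ (hf j)]

theorem mode_nat_truncated (a b : V) (s : ℤ) :
    ∃ N : ℕ, ∀ j : ℕ, N ≤ j → mode V a (s + j) b = 0 := by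
  obtain ⟨N, hN⟩ := mode_truncated (M := V) a b
  exact ⟨(N - s).toNat, fun j hj => hN _ (by lia)⟩

theorem zhuProd_assoc_mem (s : ℤ) (hs : s ≤ -1) (a b c : V) :
    zhuProd s (zhuProd (-1) a b) c - zhuProd (-1) a (zhuProd s b c) ∈ zhuIdeal V := by
  refine energy_induction (p := fun a => zhuProd s (zhuProd (-1) a b) c -
    zhuProd (-1) a (zhuProd s b c) ∈ zhuIdeal V) (fun Δ a ha => ?_) (fun a a' h h' => ?_) a
  swap
  · convert add_mem h h' using 1
    simp only [map_add, LinearMap.add_apply]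
    abel
  refine energy_induction (p := fun b => zhuProd s (zhuProd (-1) a b) c -
    zhuProd (-1) a (zhuProd s b c) ∈ zhuIdeal V) (fun Θ b hb => ?_) (fun b b' h h' => ?_) b
  swap
  · convert add_mem h h' using 1
    simp only [map_add, LinearMap.add_apply]
    abel
  obtain ⟨N, hN⟩ := mode_nat_truncated a b (-1)
  rw [zhuProd_apply (-1) ha b, modeSum_apply, binomSum,
    zhuProd_finsum hN (Δ + Θ) (fun j => mode_mem_energySpace _ ha hb (by push_cast; ring)),
    modeSum_borcherds a b c Δ Θ (-1) s]
  simp only [sign_neg_one, sign_binom_neg_one, neg_mul, one_smul, neg_smul]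
  simp only [← zhuProd_apply _ ha, ← zhuProd_apply _ hb]
  obtain ⟨N', hN'⟩ := zhuProd_truncated b c
  have h1 := finsum_mem_of_succ (zhuIdeal V)
    (fun j : ℕ => zhuProd (-1 - j) a (zhuProd (s + j) b c)) (N' - s).toNat
    (fun j hj => by rw [hN' _ (by lia), map_zero])
    (fun j => zhuProd_mem' _ (by push_cast; lia) _ _)
  have h2 := finsum_mem_of_forall (zhuIdeal V)
    (fun j : ℕ => -zhuProd (-1 + s - j) b (zhuProd j a c))
    (fun j => neg_mem (zhuProd_mem' _ (by lia) _ _))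
  have := sub_mem h1 h2
  simp only [Nat.cast_zero, sub_zero, add_zero] at this
  convert this using 1
  abel

theorem zhuProd_right_mem (x c : V) (hx : x ∈ zhuIdeal V) : zhuProd (-1) x c ∈ zhuIdeal V := by
  induction hx using Submodule.span_induction with
  | zero => simp
  | add x y _ _ hx hy => simpa using add_mem hx hy
  | smul r x _ hx => simpa using Submodule.smul_mem _ r hx
  | mem x hx =>
    obtain ⟨a, b, rfl⟩ := hx
    refine energy_induction (p := fun a => zhuProd (-1) (zhuProd (-2) a b) c ∈ zhuIdeal V)
      (fun Δ a ha => ?_) (fun a a' h h' => by simpa using add_mem h h') a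
    refine energy_induction (p := fun b => zhuProd (-1) (zhuProd (-2) a b) c ∈ zhuIdeal V)
      (fun Θ b hb => ?_) (fun b b' h h' => by simpa using add_mem h h') b
    obtain ⟨N, hN⟩ := mode_nat_truncated a b (-2)
    rw [zhuProd_apply (-2) ha b, modeSum_apply, binomSum,
      zhuProd_finsum hN (Δ + (Θ + 1))
        (fun j => mode_mem_energySpace _ ha hb (by push_cast; ring)),
      modeSum_borcherds a b c Δ (Θ + 1) (-2) (-1)]
    refine sub_mem (finsum_mem_of_forall _ _ fun j => Submodule.smul_mem _ _ ?_)
      (finsum_mem_of_forall _ _ fun j => Submodule.smul_mem _ _ ?_)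
    · rw [← zhuProd_apply _ ha]
      exact zhuProd_mem' _ (by lia) _ _
    · rw [modeSum_succ, ← zhuProd_apply _ hb, ← zhuProd_apply _ hb]
      exact add_mem (zhuProd_mem' _ (by lia) _ _) (zhuProd_mem' _ (by lia) _ _)

theorem zhuProd_left_mem (c x : V) (hx : x ∈ zhuIdeal V) : zhuProd (-1) c x ∈ zhuIdeal V := by
  induction hx using Submodule.span_induction with
  | zero => simp
  | add x y _ _ hx hy => simpa using add_mem hx hy
  | smul r x _ hx => simpa using Submodule.smul_mem _ r hx
  | mem x hx =>
    obtain ⟨a, b, rfl⟩ := hx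
    have h1 := zhuProd_assoc_mem (-2) (by norm_num) c a b
    have h2 := zhuProd_mem' (-2) le_rfl (zhuProd (-1) c a) b
    simpa using sub_mem h2 h1

theorem zhuProd_vacuum_left (a : V) : zhuProd (-1) (vacuum V) a = a := by
  rw [zhuProd_apply (Δ := 0) (-1) (by simpa using vacuum_mem), modeSum_vacuum, if_pos rfl]

theorem zhuProd_vacuum_right (a : V) : zhuProd (-1) a (vacuum V) = a := by
  refine energy_induction (p := fun a => zhuProd (-1) a (vacuum V) = a)
    (fun Δ a ha => ?_) (fun a a' h h' => by simp [h, h']) a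
  rw [zhuProd_apply _ ha, modeSum_eq _ _ _ _ 1
    (fun i hi => mode_apply_vacuum_nonneg _ _ (by push_cast at hi; lia))]
  simp [mode_apply_vacuum]

end

end Homogeneous

section ZhuAlgebra

variable (V : Type*) [AddCommGroup V] [Module ℂ V]

/-- The Zhu algebra `A(V) = V / J`, with the product induced by
`a * b = ∑ j, binom(Δ_a, j) a_(j - 1) b` and unit the class of the vacuum. -/
def ZhuAlgebra [ConformalVertexAlgebra V] : Type _ := V ⧸ zhuIdeal V

variable [ConformalVertexAlgebra V]

instance : AddCommGroup (ZhuAlgebra V) := inferInstanceAs (AddCommGroup (V ⧸ zhuIdeal V))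

instance : Module ℂ (ZhuAlgebra V) := inferInstanceAs (Module ℂ (V ⧸ zhuIdeal V))

/-- The projection `V → A(V)`. -/
def zhuMk : V →ₗ[ℂ] ZhuAlgebra V := (zhuIdeal V).mkQ

theorem zhuMk_surjective : Function.Surjective (zhuMk V) := (zhuIdeal V).mkQ_surjective

variable {V} in
theorem zhuMk_eq_zero {x : V} : zhuMk V x = 0 ↔ x ∈ zhuIdeal V :=
  Submodule.Quotient.mk_eq_zero _

variable {V} in
/-- The product of `A(V)` with the class of `a` on the left. -/
def zhuMulLeft (a : V) : ZhuAlgebra V →ₗ[ℂ] ZhuAlgebra V :=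
  (zhuIdeal V).liftQ ((zhuMk V).comp (zhuProd (-1) a)) fun x hx =>
    LinearMap.mem_ker.2 (zhuMk_eq_zero.2 (zhuProd_left_mem a x hx))

variable {V} in
theorem zhuMulLeft_mk (a b : V) : zhuMulLeft a (zhuMk V b) = zhuMk V (zhuProd (-1) a b) := rfl

variable {V} in
theorem zhu_hom_ext {f g : ZhuAlgebra V →ₗ[ℂ] ZhuAlgebra V}
    (h : ∀ b, f (zhuMk V b) = g (zhuMk V b)) : f = g := by
  refine LinearMap.ext fun x => ?_
  obtain ⟨b, rfl⟩ := zhuMk_surjective V x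
  exact h b

/-- The product of `A(V)` as a bilinear map. -/
def zhuMul : ZhuAlgebra V →ₗ[ℂ] ZhuAlgebra V →ₗ[ℂ] ZhuAlgebra V :=
  (zhuIdeal V).liftQ
    { toFun := zhuMulLeft
      map_add' := fun a b => zhu_hom_ext fun c => by simp [zhuMulLeft_mk]
      map_smul' := fun r a => zhu_hom_ext fun c => by simp [zhuMulLeft_mk] }
    fun a ha => LinearMap.mem_ker.2 (zhu_hom_ext fun c => by
      change zhuMk V (zhuProd (-1) a c) = 0
      exact zhuMk_eq_zero.2 (zhuProd_right_mem a c ha))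

theorem zhuMul_mk (a b : V) :
    zhuMul V (zhuMk V a) (zhuMk V b) = zhuMk V (zhuProd (-1) a b) := rfl

instance : Mul (ZhuAlgebra V) := ⟨fun x y => zhuMul V x y⟩

instance : One (ZhuAlgebra V) := ⟨zhuMk V (vacuum V)⟩

variable {V} in
theorem zhuMk_mul (a b : V) : zhuMk V a * zhuMk V b = zhuMk V (zhuProd (-1) a b) := rfl

theorem zhuMk_vacuum : zhuMk V (vacuum V) = 1 := rfl

instance : Ring (ZhuAlgebra V) where
  __ := (inferInstance : AddCommGroup (ZhuAlgebra V))
  left_distrib x y z := (zhuMul V x).map_add y z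
  right_distrib x y z := LinearMap.map_add₂ (zhuMul V) x y z
  zero_mul x := LinearMap.map_zero₂ (zhuMul V) x
  mul_zero x := (zhuMul V x).map_zero
  mul_assoc x y z := by
    obtain ⟨a, rfl⟩ := zhuMk_surjective V x
    obtain ⟨b, rfl⟩ := zhuMk_surjective V y
    obtain ⟨c, rfl⟩ := zhuMk_surjective V z
    rw [zhuMk_mul, zhuMk_mul, zhuMk_mul, zhuMk_mul, ← sub_eq_zero, ← map_sub, zhuMk_eq_zero]
    exact zhuProd_assoc_mem (-1) le_rfl a b c
  one_mul x := by
    obtain ⟨a, rfl⟩ := zhuMk_surjective V x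
    rw [← zhuMk_vacuum, zhuMk_mul, zhuProd_vacuum_left]
  mul_one x := by
    obtain ⟨a, rfl⟩ := zhuMk_surjective V x
    rw [← zhuMk_vacuum, zhuMk_mul, zhuProd_vacuum_right]

instance : Algebra ℂ (ZhuAlgebra V) :=
  Algebra.ofModule (fun r x y => LinearMap.map_smul₂ (zhuMul V) r x y)
    (fun r x y => (zhuMul V x).map_smul r y)

end ZhuAlgebra

section Charge

variable {V : Type*} {M : Type*} [AddCommGroup V] [Module ℂ V] [ChargedConformalVertexAlgebra V]
    [AddCommGroup M] [Module ℂ M] [VertexModule V M]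

variable (V) in
/-- The current `h`. -/
abbrev chargeCurrent : V := ChargedConformalVertexAlgebra.current

theorem mem_chargeSpace {k : ℂ} {x : M} :
    x ∈ chargeSpace V M k ↔ mode M (chargeCurrent V) 0 x = k • x :=
  Module.End.mem_eigenspace_iff

theorem mem_weightSpace {Δ k : ℂ} {x : M} :
    x ∈ weightSpace V M Δ k ↔ x ∈ energySpace V M Δ ∧ x ∈ chargeSpace V M k := Iff.rfl

theorem current_mem : chargeCurrent V ∈ energySpace V V 1 := by
  rw [mem_energySpace, one_smul]
  exact ChargedConformalVertexAlgebra.current_weight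

theorem charge_mem_energySpace {Δ : ℂ} {x : M} (hx : x ∈ energySpace V M Δ) :
    mode M (chargeCurrent V) 0 x ∈ energySpace V M Δ :=
  mode_mem_energySpace 0 current_mem hx (by push_cast; ring)

theorem zhuProd_derivation (s : ℤ) (a b : V) :
    mode V (chargeCurrent V) 0 (zhuProd s a b) =
      zhuProd s (mode V (chargeCurrent V) 0 a) b + zhuProd s a (mode V (chargeCurrent V) 0 b) := by
  refine energy_induction (p := fun a => mode V (chargeCurrent V) 0 (zhuProd s a b) =
      zhuProd s (mode V (chargeCurrent V) 0 a) b + zhuProd s a (mode V (chargeCurrent V) 0 b))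
    (fun Δ a ha => ?_) (fun a a' h h' => ?_) a
  · rw [zhuProd_apply _ ha, zhuProd_apply _ ha, zhuProd_apply _ (charge_mem_energySpace ha),
      modeSum_derivation]
  · simp only [map_add, LinearMap.add_apply, h, h']
    abel

theorem zeroMode_derivation (a : V) (x : M) :
    mode M (chargeCurrent V) 0 (zeroMode M a x) =
      zeroMode M (mode V (chargeCurrent V) 0 a) x +
        zeroMode M a (mode M (chargeCurrent V) 0 x) := by
  refine energy_induction (p := fun a => mode M (chargeCurrent V) 0 (zeroMode M a x) =
      zeroMode M (mode V (chargeCurrent V) 0 a) x +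
        zeroMode M a (mode M (chargeCurrent V) 0 x))
    (fun Δ a ha => ?_) (fun a a' h h' => ?_) a
  · rw [zeroMode_apply ha, zeroMode_apply (charge_mem_energySpace ha), mode_derivation]
  · simp only [map_add, LinearMap.add_apply, h, h']
    abel

theorem zeroMode_mem_chargeSpace {c k Θ : ℂ} {a : V} {x : M} (ha : a ∈ chargeSpace V V c)
    (hx : x ∈ chargeSpace V M k) (hΘ : Θ = k + c) : zeroMode M a x ∈ chargeSpace V M Θ := by
  rw [mem_chargeSpace] at *
  rw [zeroMode_derivation, ha, hx, map_smul, map_smul, LinearMap.smul_apply, hΘ]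
  module

variable (V) in
/-- The subspace `A(V)^(k)` of classes of vectors of charge `k`. -/
def zhuCharge (k : ℤ) : Submodule ℂ (ZhuAlgebra V) := (chargeSpace V V (k : ℂ)).map (zhuMk V)

theorem zhuCharge_mul {c d : ℤ} {x y : ZhuAlgebra V} (hx : x ∈ zhuCharge V c)
    (hy : y ∈ zhuCharge V d) : x * y ∈ zhuCharge V (c + d) := by
  obtain ⟨a, ha, rfl⟩ := hx
  obtain ⟨b, hb, rfl⟩ := hy
  refine ⟨zhuProd (-1) a b, ?_, rfl⟩
  rw [SetLike.mem_coe, mem_chargeSpace] at *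
  rw [zhuProd_derivation, ha, hb, map_smul, map_smul, LinearMap.smul_apply]
  push_cast
  module

theorem zhuCharge_one : (1 : ZhuAlgebra V) ∈ zhuCharge V 0 := by
  refine ⟨vacuum V, ?_, rfl⟩
  rw [SetLike.mem_coe, mem_chargeSpace, mode_apply_vacuum_nonneg _ _ le_rfl]
  simp

variable (V) in
/-- The subalgebra `A(V)^(0)`. -/
def zhuZero : Subalgebra ℂ (ZhuAlgebra V) :=
  (zhuCharge V 0).toSubalgebra zhuCharge_one fun x y hx hy => by
    simpa using zhuCharge_mul hx hy

theorem mem_zhuZero {x : ZhuAlgebra V} : x ∈ zhuZero V ↔ x ∈ zhuCharge V 0 := Iff.rfl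

variable (V) in
/-- The left ideal `A(V) A(V)^(>0)`. -/
def zhuPositive : Ideal (ZhuAlgebra V) :=
  Ideal.span {x | ∃ c : ℤ, 0 < c ∧ x ∈ zhuCharge V c}

variable (V) in
/-- The charge zero part of `A(V) A(V)^(>0)`, as an ideal of `A(V)^(0)`. -/
def stableIdeal : Ideal (zhuZero V) := (zhuPositive V).comap (zhuZero V).val

instance : (stableIdeal V).IsTwoSided where
  mul_mem_of_left := by
    intro x y hx
    have hx' : (x : ZhuAlgebra V) ∈ zhuPositive V := hx
    change (x : ZhuAlgebra V) * (y : ZhuAlgebra V) ∈ zhuPositive V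
    have hy : (y : ZhuAlgebra V) ∈ zhuCharge V 0 := y.2
    generalize (x : ZhuAlgebra V) = x at hx'
    induction hx' using Submodule.span_induction with
    | zero => simp
    | add u v _ _ hu hv => rw [add_mul]; exact add_mem hu hv
    | smul r u _ hu => rw [smul_eq_mul, mul_assoc]; exact Ideal.mul_mem_left _ _ hu
    | mem u hu =>
      obtain ⟨c, hc, hu⟩ := hu
      exact Ideal.subset_span ⟨c, hc, by simpa using zhuCharge_mul hu hy⟩

variable (V) in
/-- The stable Zhu algebra `A(V)^(0) / (A(V) A(V)^(>0))^(0)`. -/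
abbrev StableZhuAlgebra : Type _ := zhuZero V ⧸ stableIdeal V

end Charge

section Representations

variable (V : Type*) (M : Type*) [AddCommGroup V] [Module ℂ V]
    [ChargedConformalVertexAlgebra V] [AddCommGroup M] [Module ℂ M] [VertexModule V M]

/-- A `V`-module is irreducible if it is nonzero and its only subspaces that are stable under all
modes are `0` and the whole module. -/
def IsIrreducibleVertexModule : Prop :=
  Nontrivial M ∧ ∀ W : Submodule ℂ M,
    (∀ (a : V) (n : ℤ), ∀ x ∈ W, mode M a n x ∈ W) → W = ⊥ ∨ W = ⊤

/-- Stable modules: `M` is the sum of the joint eigenspaces `M_Δ^(k)` of `L_0` and `h_0` (the sum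
is automatically direct), each of these is finite dimensional, the energies `Δ` are bounded below,
and for each `Δ` the charges `k` are bounded above, in terms of real parts. -/
structure IsStableVertexModule : Prop where
  weight : ⨆ p : ℂ × ℂ, weightSpace V M p.1 p.2 = ⊤
  finite : ∀ Δ k : ℂ, FiniteDimensional ℂ (weightSpace V M Δ k)
  energy_bounded : ∃ B : ℝ, ∀ Δ k : ℂ, Δ.re < B → weightSpace V M Δ k = ⊥
  charge_bounded : ∀ Δ : ℂ, ∃ K : ℝ, ∀ k : ℂ, K < k.re → weightSpace V M Δ k = ⊥

open scoped ComplexOrder in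
/-- `Δ` is the least energy of `M`, and `k` is the greatest charge in `M_top = M_Δ`; here `z ≤ w`
for complex numbers means that `w - z` is a nonnegative real number. -/
structure IsPeakWeight (Δ k : ℂ) : Prop where
  least_energy : IsLeast {Δ' : ℂ | energySpace V M Δ' ≠ ⊥} Δ
  greatest_charge : IsGreatest {k' : ℂ | weightSpace V M Δ k' ≠ ⊥} k

variable {V M}

theorem IsPeakWeight.eq_zero_of_lower {Δ k : ℂ} (hp : IsPeakWeight V M Δ k) {n : ℤ} (hn : 0 < n)
    {x : M} (hx : x ∈ energySpace V M (Δ - n)) : x = 0 := by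
  by_contra h0
  have h := hp.least_energy.2 (show Δ - n ∈ {Δ' : ℂ | energySpace V M Δ' ≠ ⊥} from
    fun hbot => h0 (by rw [hbot] at hx; exact hx))
  have := (Complex.le_def.1 h).1
  simp at this
  exact absurd (by exact_mod_cast this : n ≤ 0) (by lia)

theorem IsPeakWeight.eq_zero_of_higher {Δ k : ℂ} (hp : IsPeakWeight V M Δ k) {c : ℤ} (hc : 0 < c)
    {x : M} (hx : x ∈ weightSpace V M Δ (k + c)) : x = 0 := by
  by_contra h0
  have h := hp.greatest_charge.2 (show k + c ∈ {k' : ℂ | weightSpace V M Δ k' ≠ ⊥} from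
    fun hbot => h0 (by rw [hbot] at hx; exact hx))
  have := (Complex.le_def.1 h).1
  simp at this
  exact absurd (by exact_mod_cast this : c ≤ 0) (by lia)

theorem zeroMode_mem_energySpace {Δ : ℂ} (a : V) {x : M} (hx : x ∈ energySpace V M Δ) :
    zeroMode M a x ∈ energySpace V M Δ := by
  refine energy_induction (p := fun a => zeroMode M a x ∈ energySpace V M Δ)
    (fun Θ a ha => ?_) (fun a a' h h' => by simpa using add_mem h h') a
  rw [zeroMode_apply ha]
  exact mode_mem_energySpace _ ha hx (by push_cast; ring)

theorem IsPeakWeight.mode_eq_zero {Δ k : ℂ} (hp : IsPeakWeight V M Δ k) {Θ n : ℤ} {a : V} {x : M}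
    (ha : a ∈ energySpace V V (Θ : ℂ)) (hx : x ∈ energySpace V M Δ) (hn : Θ - 1 < n) :
    mode M a n x = 0 :=
  hp.eq_zero_of_lower (n := n - Θ + 1) (by lia)
    (mode_mem_energySpace n ha hx (by push_cast; ring))

theorem zeroMode_finsum {f : ℕ → V} {N : ℕ} (hN : ∀ j, N ≤ j → f j = 0) (Θ : ℤ)
    (hf : ∀ j : ℕ, f j ∈ energySpace V V ((Θ - j : ℤ) : ℂ)) (α : ℤ) (x : M) :
    zeroMode M (∑ᶠ j : ℕ, intBinom α j • f j) x =
      ∑ᶠ j : ℕ, intBinom α j • mode M (f j) (Θ - 1 - j) x := by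
  rw [finsum_eq_sum_range _ N (fun j hj => by rw [hN j hj, smul_zero]),
    finsum_eq_sum_range _ N (fun j hj => by
      rw [hN j hj, mode_zero, LinearMap.zero_apply, smul_zero]), map_sum, LinearMap.sum_apply]
  refine Finset.sum_congr rfl fun j _ => ?_
  rw [map_zsmul, LinearMap.smul_apply, zeroMode_apply (hf j), sub_right_comm]

theorem IsPeakWeight.zeroMode_mul {Δ k : ℂ} (hp : IsPeakWeight V M Δ k) (a b : V) {x : M}
    (hx : x ∈ energySpace V M Δ) :
    zeroMode M (zhuProd (-1) a b) x = zeroMode M a (zeroMode M b x) := by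
  refine energy_induction (p := fun a => zeroMode M (zhuProd (-1) a b) x =
    zeroMode M a (zeroMode M b x)) (fun Θ a ha => ?_) (fun a a' h h' => by simp [h, h']) a
  refine energy_induction (p := fun b => zeroMode M (zhuProd (-1) a b) x =
    zeroMode M a (zeroMode M b x)) (fun Ξ b hb => ?_) (fun b b' h h' => by simp [h, h']) b
  obtain ⟨N, hN⟩ := mode_nat_truncated a b (-1)
  have B := mode_borcherds a b x (Ξ - 1) Θ (-1)
  rw [finsum_eq_single (fun j : ℕ => ((-1 : ℂ) ^ j * intBinom (-1) j) • _) 0,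
    finsum_eq_zero_of_forall_eq_zero
      (f := fun j : ℕ => ((-1 : ℂ) ^ ((j : ℤ) + -1) * intBinom (-1) j) • _), sub_zero] at B
  · rw [zhuProd_apply (-1) ha b, modeSum_apply, binomSum,
      zeroMode_finsum hN (Θ + Ξ) (fun j => mode_mem_energySpace _ ha hb (by push_cast; ring)),
      zeroMode_apply ha, zeroMode_apply hb]
    simp only [sign_binom_neg_one, one_smul, Nat.cast_zero, add_zero, sub_zero] at B
    rw [← sub_eq_add_neg] at B
    rw [← B]
    refine finsum_congr fun j => ?_
    congr 3
    ring
  · intro j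
    rw [hp.mode_eq_zero ha hx (by lia), map_zero, smul_zero]
  · intro j hj
    rw [hp.mode_eq_zero hb hx (by lia), map_zero, smul_zero]

theorem IsPeakWeight.zeroMode_zhuIdeal {Δ k : ℂ} (hp : IsPeakWeight V M Δ k) (u : V)
    (hu : u ∈ zhuIdeal V) {x : M} (hx : x ∈ energySpace V M Δ) : zeroMode M u x = 0 := by
  induction hu using Submodule.span_induction with
  | zero => simp
  | add u v _ _ hu hv => simp [hu, hv]
  | smul r u _ hu => simp [hu]
  | mem u hu =>
    obtain ⟨a, b, rfl⟩ := hu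
    refine energy_induction (p := fun a => zeroMode M (zhuProd (-2) a b) x = 0)
      (fun Θ a ha => ?_) (fun a a' h h' => by simp [h, h']) a
    refine energy_induction (p := fun b => zeroMode M (zhuProd (-2) a b) x = 0)
      (fun Ξ b hb => ?_) (fun b b' h h' => by simp [h, h']) b
    obtain ⟨N, hN⟩ := mode_nat_truncated a b (-2)
    have B := mode_borcherds a b x Ξ Θ (-2)
    rw [finsum_eq_zero_of_forall_eq_zero (f := fun j : ℕ => ((-1 : ℂ) ^ j * intBinom (-2) j) • _),
      finsum_eq_zero_of_forall_eq_zero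
        (f := fun j : ℕ => ((-1 : ℂ) ^ ((j : ℤ) + -2) * intBinom (-2) j) • _), sub_zero] at B
    · rw [zhuProd_apply (-2) ha b, modeSum_apply, binomSum,
        zeroMode_finsum hN (Θ + Ξ + 1)
          (fun j => mode_mem_energySpace _ ha hb (by push_cast; ring)), ← B]
      refine finsum_congr fun j => ?_
      congr 3
      ring
    · intro j
      rw [hp.mode_eq_zero ha hx (by lia), map_zero, smul_zero]
    · intro j
      rw [hp.mode_eq_zero hb hx (by lia), map_zero, smul_zero]

/-- The action of `A(V)` on `M_top`, in which the class of `a` acts by the zero mode `a_0`. -/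
def IsPeakWeight.topRep {Δ k : ℂ} (hp : IsPeakWeight V M Δ k) :
    ZhuAlgebra V →ₐ[ℂ] Module.End ℂ (energySpace V M Δ) :=
  AlgHom.ofLinearMap
    ((zhuIdeal V).liftQ
      { toFun := fun a => (zeroMode M a).restrict fun x hx => zeroMode_mem_energySpace a hx
        map_add' := fun a b => by ext x; simp
        map_smul' := fun r a => by ext x; simp }
      fun u hu => LinearMap.mem_ker.2 (LinearMap.ext fun x =>
        Subtype.ext (hp.zeroMode_zhuIdeal u hu x.2)) : ZhuAlgebra V →ₗ[ℂ] _)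
    (LinearMap.ext fun x => Subtype.ext (by
      change zeroMode M (vacuum V) (x : M) = x
      rw [zeroMode_apply (Δ := 0) (by simpa using vacuum_mem), mode_vacuum, if_pos (by norm_num)]))
    (by
      intro y z
      obtain ⟨a, rfl⟩ := zhuMk_surjective V y
      obtain ⟨b, rfl⟩ := zhuMk_surjective V z
      exact LinearMap.ext fun x => Subtype.ext (hp.zeroMode_mul a b x.2))

theorem IsPeakWeight.topRep_mk {Δ k : ℂ} (hp : IsPeakWeight V M Δ k) (a : V)
    (x : energySpace V M Δ) : (hp.topRep (zhuMk V a) x : M) = zeroMode M a x := rfl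

theorem IsPeakWeight.topRep_mem {Δ k : ℂ} (hp : IsPeakWeight V M Δ k) {c : ℤ} {y : ZhuAlgebra V}
    (hy : y ∈ zhuCharge V c) (x : energySpace V M Δ) (hx : (x : M) ∈ chargeSpace V M k) :
    (hp.topRep y x : M) ∈ weightSpace V M Δ (k + c) := by
  obtain ⟨a, ha, rfl⟩ := hy
  exact ⟨(hp.topRep (zhuMk V a) x).2, zeroMode_mem_chargeSpace ha hx rfl⟩

theorem IsPeakWeight.topRep_zhuPositive {Δ k : ℂ} (hp : IsPeakWeight V M Δ k) {y : ZhuAlgebra V}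
    (hy : y ∈ zhuPositive V) (x : energySpace V M Δ) (hx : (x : M) ∈ chargeSpace V M k) :
    hp.topRep y x = 0 := by
  induction hy using Submodule.span_induction with
  | zero => simp
  | add u v _ _ hu hv => simp [hu, hv]
  | smul r u _ hu => simp [hu]
  | mem u hu =>
    obtain ⟨c, hc, hu⟩ := hu
    exact Subtype.ext (hp.eq_zero_of_higher hc (hp.topRep_mem hu x hx))

/-- The action of `A(V)^(0)` on `M_peak`. -/
def IsPeakWeight.zeroRep {Δ k : ℂ} (hp : IsPeakWeight V M Δ k) :
    zhuZero V →ₐ[ℂ] Module.End ℂ (weightSpace V M Δ k) where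
  toFun y :=
    { toFun := fun x => ⟨hp.topRep (y : ZhuAlgebra V) ⟨x, x.2.1⟩, by
        have := hp.topRep_mem (mem_zhuZero.1 y.2) ⟨x, x.2.1⟩ x.2.2
        simpa using this⟩
      map_add' := fun x x' => Subtype.ext (congrArg (energySpace V M Δ).subtype
        ((hp.topRep (y : ZhuAlgebra V)).map_add ⟨x, x.2.1⟩ ⟨x', x'.2.1⟩))
      map_smul' := fun r x => Subtype.ext (congrArg (energySpace V M Δ).subtype
        ((hp.topRep (y : ZhuAlgebra V)).map_smul r ⟨x, x.2.1⟩)) }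
  map_one' := by ext x; simp
  map_mul' y z := by ext x; simp
  map_zero' := by ext x; simp
  map_add' y z := by ext x; simp
  commutes' r := by ext x; simp [Algebra.algebraMap_eq_smul_one]

/-- The action of the stable Zhu algebra on `M_peak`: the class of a vector `a` of charge zero
acts by the zero mode `a_0`. -/
def IsPeakWeight.peakRep {Δ k : ℂ} (hp : IsPeakWeight V M Δ k) :
    StableZhuAlgebra V →ₐ[ℂ] Module.End ℂ (weightSpace V M Δ k) :=
  Ideal.Quotient.liftₐ (stableIdeal V) hp.zeroRep fun y hy =>
    LinearMap.ext fun x => Subtype.ext (congrArg (energySpace V M Δ).subtype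
      (hp.topRep_zhuPositive (y := (y : ZhuAlgebra V)) hy ⟨x, x.2.1⟩ x.2.2))

theorem IsPeakWeight.peakRep_mk {Δ k : ℂ} (hp : IsPeakWeight V M Δ k) (a : V)
    (ha : zhuMk V a ∈ zhuZero V) (x : weightSpace V M Δ k) :
    (hp.peakRep (Ideal.Quotient.mk (stableIdeal V) ⟨zhuMk V a, ha⟩) x : M) = zeroMode M a x :=
  rfl

/-- The peak space `M_peak = M_Δ^(k)`, for the peak weight `(Δ, k)`. -/
def PeakSpace {Δ k : ℂ} (_ : IsPeakWeight V M Δ k) : Type _ := weightSpace V M Δ k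

instance {Δ k : ℂ} (hp : IsPeakWeight V M Δ k) : AddCommGroup (PeakSpace hp) :=
  inferInstanceAs (AddCommGroup (weightSpace V M Δ k))

instance {Δ k : ℂ} (hp : IsPeakWeight V M Δ k) : Module ℂ (PeakSpace hp) :=
  inferInstanceAs (Module ℂ (weightSpace V M Δ k))

/-- `M_peak` is a module over the stable Zhu algebra through `peakRep`. -/
instance {Δ k : ℂ} (hp : IsPeakWeight V M Δ k) : Module (StableZhuAlgebra V) (PeakSpace hp) :=
  Module.compHom (weightSpace V M Δ k) hp.peakRep.toRingHom

theorem IsPeakWeight.smul_def {Δ k : ℂ} (hp : IsPeakWeight V M Δ k) (y : StableZhuAlgebra V)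
    (x : PeakSpace hp) : y • x = (hp.peakRep y x : weightSpace V M Δ k) := rfl

end Representations

/-- The vectors `u¹_(-n₁) ⋯ uʳ_(-n_r) |0⟩` with `uⁱ ∈ U` and `nᵢ ≥ 1`. -/
inductive StrongMonomial {V : Type*} [AddCommGroup V] [Module ℂ V] [VertexAlgebra V]
    (U : Set V) : V → Prop
  | vacuum : StrongMonomial U (vacuum V)
  | mode (u : V) (n : ℤ) (v : V) : u ∈ U → 1 ≤ n → StrongMonomial U v →
      StrongMonomial U (mode V u (-n) v)

/-- `V` is finitely strongly generated: for a finite set `U`, the monomials span `V`. -/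
def FinitelyStronglyGenerated (V : Type*) [AddCommGroup V] [Module ℂ V] [VertexAlgebra V] :
    Prop :=
  ∃ U : Set V, U.Finite ∧ Submodule.span ℂ {v | StrongMonomial U v} = ⊤

end

/-!
The module `M` is constructed inside a space of functionals on `V`. Suppose that `M` exists, and
let `ε : M → P` be the projection to its peak space. A vector `m` of `M` gives a functional
`φ(b) = ε (Y(b, 1) m)` on `V` with values in `P`, and `φ (Y(a, x - 1) b)` is then the expansion at
`x = 1` of the rational function `ε (Y(a, x) Y(b, 1) m)` of `x`, whose poles lie at `0`, `1` and
`∞`. Since the fields commute up to a pole at `x = 1`, its residues at `x = 0` are the functionals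
that belong to the vectors `a_(n) m`. A vector `p` of the peak space gives the functional
`b ↦ [b] p`, where `[b]` is the class of the component of `b` of charge zero in the stable Zhu
algebra.

Conversely, let the regular dual of `V` be the space of all functionals for which the functions
`φ (Y(a, x - 1) b)` are rational in this sense (`regularDual`). The residues at `x = 0` define
modes on it (`regMode`). They can be computed from residues at `x = 1`, that is, from the products
`a_(n) b` in `V`, whenever the residue at `∞` vanishes, and this can be achieved by inserting a
power of `x - 1`. The Borcherds identity for these modes (`regMode_borcherds`) follows from two
special cases, weak commutativity and one instance of associativity for each exponent. Thus the
regular dual is a `V`-module. A functional that vanishes on the ideal `J` which defines the Zhu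
algebra is regular, and as a vector of the regular dual it is annihilated by all modes that lower
energies (`isTopVector_of_zhuIdeal`); on such functionals, zero modes act by multiplication from
the right in `A(V)` (`IsTopVector.zeroMode_regularDual`). So the functionals `b ↦ [b] p` form a
copy of `P` in the regular dual on which zero modes of positive charge vanish. The classes of `ω`
and `h` are central in the stable Zhu algebra, so by Schur's lemma these functionals have the same
weight and charge (`exists_weight_peakFunctional`).

The module `M` is the submodule that they generate (`peakModule`). Evaluation at the vacuum
vanishes on all weight spaces but the peak space, where it is the inverse of `p ↦ (b ↦ [b] p)`,
and a nonzero functional has an image under some mode that does not vanish at the vacuum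
(`exists_mode_vacuum_ne_zero`). Hence each nonzero submodule of `M` meets the peak space, which is
irreducible, and `M` is irreducible (`IsPeakGenerated.isIrreducible`). Finally, if `V` is finitely
strongly generated, then each vector of `M` of positive energy (relative to the peak) is a sum of
images under the finitely many energy-raising modes of the generators of vectors of smaller
energy, and at the lowest energy only generators of negative charge are needed. This bounds the
dimensions and the charges (`IsPeakGenerated.isStable`).
-/

noncomputable section

open scoped VertexOperator

/-! ### Alternating binomial sums -/

theorem exists_forall_lt_le (J : ℕ) (f : ℕ → ℤ) : ∃ r : ℤ, ∀ i < J, f i ≤ r :=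
  ⟨∑ j ∈ Finset.range J, |f j|, fun _ hj => (le_abs_self _).trans
    (Finset.single_le_sum (f := fun j => |f j|) (fun _ _ => abs_nonneg _)
      (Finset.mem_range.2 hj))⟩

/-- A sequence that vanishes far to the right is determined by its differences. -/
theorem eq_of_sub_succ {E : Type*} [AddCommGroup E] {f g : ℤ → E} {N : ℤ}
    (hf : ∀ i, N ≤ i → f i = 0) (hg : ∀ i, N ≤ i → g i = 0)
    (h : ∀ n, f n - f (n + 1) = g n - g (n + 1)) (n : ℤ) :
    f n = g n := by
  have key : ∀ j : ℕ, f (N - j) = g (N - j) := by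
    intro j
    induction j with
    | zero => rw [hf _ (by simp), hg _ (by simp)]
    | succ j ih =>
      have := h (N - (j + 1 : ℕ))
      rw [show N - ((j + 1 : ℕ) : ℤ) + 1 = N - j by push_cast; ring, ih] at this
      exact sub_left_injective this
  rcases le_total N n with hn | hn
  · rw [hf n hn, hg n hn]
  · have := key (N - n).toNat
    rwa [show N - ((N - n).toNat : ℤ) = n by lia] at this

theorem eq_of_add_succ {E : Type*} [AddCommGroup E] {f g : ℤ → E} {N : ℤ}
    (hf : ∀ i, N ≤ i → f i = 0) (hg : ∀ i, N ≤ i → g i = 0)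
    (h : ∀ n, f n + f (n + 1) = g n + g (n + 1)) (n : ℤ) : f n = g n := by
  refine smul_left_cancel ((-1 : ℤˣ) ^ n)
    (eq_of_sub_succ (f := fun n => (-1 : ℤˣ) ^ n • f n) (g := fun n => (-1 : ℤˣ) ^ n • g n) (N := N)
      (fun i hi => by simp [hf i hi]) (fun i hi => by simp [hg i hi]) (fun n => ?_) n)
  simp only [zpow_add_one, mul_neg, mul_one, Units.neg_smul, sub_neg_eq_add]
  rw [← smul_add, ← smul_add, h]

section AltSum

variable {E : Type*} [AddCommGroup E] [Module ℂ E]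

/-- `∑ j, (-1)^j binom(σ, j) f(n + j)`: if `f(n)` is the coefficient of `x^(-n-1)`, this is the
effect of multiplication by `(1 - x)^σ`, expanded at `x = 0`. -/
def altSum (σ : ℤ) (f : ℤ → E) (n : ℤ) : E :=
  ∑ᶠ j : ℕ, ((-1 : ℂ) ^ j * intBinom σ j) • f (n + j)

theorem altSum_eq (σ : ℤ) (f : ℤ → E) (n : ℤ) (N : ℕ) (h : ∀ i, n + N ≤ i → f i = 0) :
    altSum σ f n = ∑ j ∈ Finset.range N, ((-1 : ℂ) ^ j * intBinom σ j) • f (n + j) :=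
  finsum_eq_sum_range _ _ fun j hj => by rw [h _ (by lia), smul_zero]

theorem altSum_zero (f : ℤ → E) (n : ℤ) : altSum 0 f n = f n := by
  rw [altSum, finsum_eq_sum_range _ 1]
  · simp
  · intro j hj
    rw [intBinom, Ring.choose_zero_pos ℤ (by lia)]
    simp

theorem altSum_congr {f g : ℤ → E} {n : ℤ} (h : ∀ i, n ≤ i → f i = g i) (σ : ℤ) :
    altSum σ f n = altSum σ g n :=
  finsum_congr fun j => by rw [h _ (by lia)]

theorem altSum_truncated {f : ℤ → E} {N : ℤ} (h : ∀ i, N ≤ i → f i = 0) (σ n : ℤ) (hn : N ≤ n) :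
    altSum σ f n = 0 := by
  rw [altSum_eq σ f n 0 fun i hi => h i (by push_cast at hi; lia)]
  simp

theorem altSum_sub {f g : ℤ → E} {N : ℤ} (hf : ∀ i, N ≤ i → f i = 0) (hg : ∀ i, N ≤ i → g i = 0)
    (σ n : ℤ) : altSum σ (fun i => f i - g i) n = altSum σ f n - altSum σ g n := by
  rw [altSum_eq σ _ n (N - n).toNat fun i hi => by rw [hf i (by lia), hg i (by lia), sub_zero],
    altSum_eq σ f n (N - n).toNat fun i hi => hf i (by lia),
    altSum_eq σ g n (N - n).toNat fun i hi => hg i (by lia), ← Finset.sum_sub_distrib]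
  simp only [smul_sub]

theorem altSum_shift (σ : ℤ) (f : ℤ → E) (e n : ℤ) :
    altSum σ (fun i => f (i + e)) n = altSum σ f (n + e) := by
  simp only [altSum]
  refine finsum_congr fun j => ?_
  rw [add_right_comm]

theorem altSum_succ {f : ℤ → E} {N : ℤ} (h : ∀ i, N ≤ i → f i = 0) (σ n : ℤ) :
    altSum (σ + 1) f n = altSum σ f n - altSum σ f (n + 1) := by
  obtain ⟨K, hK⟩ : ∃ K : ℕ, N ≤ n + K := ⟨(N - n).toNat, by lia⟩
  rw [altSum_eq _ f n (K + 1) (fun i hi => h i (by push_cast at hi; lia)),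
    altSum_eq _ f n (K + 1) (fun i hi => h i (by push_cast at hi; lia)),
    altSum_eq _ f (n + 1) K (fun i hi => h i (by lia)),
    Finset.sum_range_succ', Finset.sum_range_succ' (fun j => _ • f (n + j))]
  simp only [intBinom, Ring.choose_succ_succ, Ring.choose_zero_right]
  have : ∀ i : ℕ, f (n + 1 + i) = f (n + (i + 1 : ℕ)) := fun i => by congr 1; push_cast; ring
  simp only [this, add_sub_right_comm, ← Finset.sum_sub_distrib, ← sub_smul]
  congr 1
  refine Finset.sum_congr rfl fun i _ => ?_
  congr 1
  push_cast
  ring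

theorem altSum_altSum {f : ℤ → E} {N : ℤ} (h : ∀ i, N ≤ i → f i = 0) (σ τ n : ℤ) :
    altSum τ (altSum σ f) n = altSum (τ + σ) f n := by
  have h' := altSum_truncated h σ
  induction τ using Int.induction_on generalizing n with
  | zero => rw [altSum_zero, zero_add]
  | succ τ ih =>
    rw [altSum_succ h', ih, ih, add_right_comm, ← altSum_succ h]
  | pred τ ih =>
    refine eq_of_sub_succ (fun i hi => altSum_truncated h' _ _ hi)
      (fun i hi => altSum_truncated h _ _ hi) (fun n => ?_) n
    rw [← altSum_succ h', ← altSum_succ h, sub_add_cancel, ih]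
    congr 1
    ring

/-- Multiplication by a power of `1 - x` is injective. -/
theorem eq_zero_of_altSum_eq_zero {f : ℤ → E} {N n₀ : ℤ} (h : ∀ i, N ≤ i → f i = 0) (σ : ℤ)
    (h0 : ∀ i, n₀ ≤ i → altSum σ f i = 0) (n : ℤ) (hn : n₀ ≤ n) : f n = 0 := by
  have e := altSum_altSum h σ (-σ) n
  rw [neg_add_cancel, altSum_zero] at e
  rw [← e]
  exact altSum_truncated h0 _ _ hn

end AltSum

/-! ### Functionals with rational matrix coefficients -/

section Regular

variable {V : Type u} {P : Type v} [AddCommGroup V] [Module ℂ V] [VertexAlgebra V]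
    [AddCommGroup P] [Module ℂ P]

/-- All series `φ (Y(a, x - 1) b)` are expansions at `x = 1` of rational functions in `x` with poles
at most at `0`, `1` and `∞`, with a pole of order at most `N` at `0` and a zero of order at least
`C + 2` at `∞`. By the residue theorem this means that the residue at `x = 1` vanishes after
multiplication by `x^α (x - 1)^s`, whenever this makes the function regular at `0` and its residue
at `∞` zero; with `w = x - 1` that residue is `φ (modeSum V α s a b)`.

The functional `φ` should be thought of as `b ↦ ⟨ξ, Y(b, 1) m⟩`, for a vector `m` at the origin, so
that `φ (Y(a, x - 1) b)` stands for `⟨ξ, Y(a, x) Y(b, 1) m⟩`. -/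
def IsRegularAt (φ : V →ₗ[ℂ] P) (a : V) (N C : ℤ) : Prop :=
  ∀ α s : ℤ, N ≤ α → α + s ≤ C → ∀ b : V, φ (modeSum V α s a b) = 0

theorem IsRegularAt.mono {φ : V →ₗ[ℂ] P} {a : V} {N C N' C' : ℤ} (h : IsRegularAt φ a N C)
    (hN : N ≤ N') (hC : C' ≤ C) : IsRegularAt φ a N' C' :=
  fun α s h1 h2 b => h α s (hN.trans h1) (h2.trans hC) b

theorem IsRegularAt.add {φ : V →ₗ[ℂ] P} {a a' : V} {N C : ℤ} (h : IsRegularAt φ a N C)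
    (h' : IsRegularAt φ a' N C) : IsRegularAt φ (a + a') N C :=
  fun α s h1 h2 b => by simp [h α s h1 h2, h' α s h1 h2]

theorem IsRegularAt.smul {φ : V →ₗ[ℂ] P} {a : V} {N C : ℤ} (h : IsRegularAt φ a N C) (r : ℂ) :
    IsRegularAt φ (r • a) N C :=
  fun α s h1 h2 b => by simp [h α s h1 h2]

theorem IsRegularAt.zero (a : V) (N C : ℤ) : IsRegularAt (0 : V →ₗ[ℂ] P) a N C :=
  fun _ _ _ _ _ => rfl

theorem IsRegularAt.add_left {φ φ' : V →ₗ[ℂ] P} {a : V} {N C : ℤ} (h : IsRegularAt φ a N C)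
    (h' : IsRegularAt φ' a N C) : IsRegularAt (φ + φ') a N C :=
  fun α s h1 h2 b => by simp [h α s h1 h2, h' α s h1 h2]

theorem IsRegularAt.smul_left {φ : V →ₗ[ℂ] P} {a : V} {N C : ℤ} (h : IsRegularAt φ a N C)
    (r : ℂ) : IsRegularAt (r • φ) a N C :=
  fun α s h1 h2 b => by simp [h α s h1 h2]

/-- The residue at `x = 1`, with the opposite sign, of `x^n (x - 1)^(-τ) φ (Y(a, x - 1) b)`. -/
def oppRes (φ : V →ₗ[ℂ] P) (a b : V) (τ n : ℤ) : P :=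
  -((-1 : ℂ) ^ τ • φ (modeSum V n (-τ) a b))

theorem oppRes_succ (φ : V →ₗ[ℂ] P) (a b : V) (τ n : ℤ) :
    oppRes φ a b τ n = oppRes φ a b (τ + 1) n - oppRes φ a b (τ + 1) (n + 1) := by
  simp only [oppRes]
  rw [modeSum_succ n, show -(τ + 1) + 1 = -τ by ring, map_add, zpow_add₀ (by norm_num)]
  simp only [zpow_one]
  module

/-- The residue at `x = 0` of `x^n φ (Y(a, x - 1) b)`, as a functional in `b`. It is computed from
residues at `x = 1`, after insertion of `(x - 1)^σ (x - 1)^(-σ)`, where the first factor is expanded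
at `x = 0` and the second one makes the residue at `∞` vanish. -/
def resMode (N σ : ℤ) (φ : V →ₗ[ℂ] P) (a : V) (n : ℤ) : V →ₗ[ℂ] P :=
  ∑ i ∈ Finset.range (N - n).toNat, ((-1 : ℂ) ^ i * intBinom σ i) •
    -((-1 : ℂ) ^ σ • φ ∘ₗ modeSum V (n + i) (-σ) a)

theorem resMode_apply (N σ : ℤ) (φ : V →ₗ[ℂ] P) (a : V) (n : ℤ) (b : V) :
    resMode N σ φ a n b =
      altSum σ (fun m => if m < N then oppRes φ a b σ m else 0) n := by
  rw [altSum_eq _ _ n (N - n).toNat fun i hi => if_neg (by lia), resMode, LinearMap.sum_apply]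
  refine Finset.sum_congr rfl fun i hi => ?_
  have := Finset.mem_range.1 hi
  rw [if_pos (by lia)]
  rfl

theorem resMode_add (N σ : ℤ) (φ : V →ₗ[ℂ] P) (a a' : V) (n : ℤ) :
    resMode N σ φ (a + a') n = resMode N σ φ a n + resMode N σ φ a' n := by
  simp only [resMode, ← Finset.sum_add_distrib]
  refine Finset.sum_congr rfl fun i _ => ?_
  ext b
  simp only [map_add, LinearMap.comp_add, LinearMap.add_apply, LinearMap.smul_apply,
    LinearMap.neg_apply, LinearMap.comp_apply]
  module

theorem resMode_smul (N σ : ℤ) (φ : V →ₗ[ℂ] P) (r : ℂ) (a : V) (n : ℤ) :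
    resMode N σ φ (r • a) n = r • resMode N σ φ a n := by
  simp only [resMode, Finset.smul_sum]
  refine Finset.sum_congr rfl fun i _ => ?_
  ext b
  simp only [map_smul, LinearMap.smul_apply,
    LinearMap.neg_apply, LinearMap.comp_apply]
  module

theorem resMode_add_left (N σ : ℤ) (φ φ' : V →ₗ[ℂ] P) (a : V) (n : ℤ) :
    resMode N σ (φ + φ') a n = resMode N σ φ a n + resMode N σ φ' a n := by
  simp only [resMode, ← Finset.sum_add_distrib]
  refine Finset.sum_congr rfl fun i _ => ?_
  ext b
  simp only [LinearMap.add_apply, LinearMap.smul_apply,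
    LinearMap.neg_apply, LinearMap.comp_apply]
  module

theorem resMode_smul_left (N σ : ℤ) (φ : V →ₗ[ℂ] P) (r : ℂ) (a : V) (n : ℤ) :
    resMode N σ (r • φ) a n = r • resMode N σ φ a n := by
  simp only [resMode, Finset.smul_sum]
  refine Finset.sum_congr rfl fun i _ => ?_
  ext b
  simp only [LinearMap.smul_apply,
    LinearMap.neg_apply, LinearMap.comp_apply]
  module

theorem IsRegularAt.oppRes_eq_zero {φ : V →ₗ[ℂ] P} {a : V} {N C : ℤ} (h : IsRegularAt φ a N C)
    (b : V) {σ m : ℤ} (h1 : N ≤ m) (h2 : m - σ ≤ C) : oppRes φ a b σ m = 0 := by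
  rw [oppRes, h m (-σ) h1 (by lia), smul_zero, neg_zero]

theorem IsRegularAt.resMode_succ_left {φ : V →ₗ[ℂ] P} {a : V} {N C : ℤ} (h : IsRegularAt φ a N C)
    {N' σ : ℤ} (hN : N ≤ N') (hσ : N' - C ≤ σ) (n : ℤ) :
    resMode (N' + 1) σ φ a n = resMode N' σ φ a n := by
  ext b
  rw [resMode_apply, resMode_apply]
  congr 1
  funext m
  rcases lt_trichotomy m N' with hm | rfl | hm
  · rw [if_pos hm, if_pos (by lia)]
  · rw [if_pos (by lia), if_neg (by lia), h.oppRes_eq_zero b hN (by lia)]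
  · rw [if_neg (by lia), if_neg (by lia)]

theorem IsRegularAt.resMode_succ {φ : V →ₗ[ℂ] P} {a : V} {N C : ℤ} (h : IsRegularAt φ a N C)
    {σ : ℤ} (hσ : N - C ≤ σ) (n : ℤ) :
    resMode N (σ + 1) φ a n = resMode N σ φ a n := by
  ext b
  rw [resMode_apply, resMode_apply]
  have ht : ∀ i, N ≤ i → (fun m => if m < N then oppRes φ a b (σ + 1) m else 0) i = 0 :=
    fun i hi => if_neg (by lia)
  rw [altSum_succ ht, ← altSum_shift, ← altSum_sub ht fun i hi => if_neg (by lia)]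
  congr 1
  funext m
  rw [oppRes_succ φ a b σ]
  rcases lt_trichotomy (m + 1) N with hm | rfl | hm
  · rw [if_pos hm, if_pos (by lia), if_pos (by lia)]
  · rw [if_pos (by lia), if_neg (by lia), if_pos (by lia), h.oppRes_eq_zero b le_rfl (by lia)]
  · rw [if_neg (by lia), if_neg (by lia), if_neg (by lia), sub_zero]

theorem IsRegularAt.resMode_mono {φ : V →ₗ[ℂ] P} {a : V} {N C : ℤ} (h : IsRegularAt φ a N C)
    {N' σ σ' : ℤ} (hN : N ≤ N') (hσ : N - C ≤ σ) (hσ' : σ ≤ σ') (hσN : N' - C ≤ σ') (n : ℤ) :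
    resMode N' σ' φ a n = resMode N σ φ a n := by
  have h1 : ∀ i : ℕ, resMode N (σ + i) φ a n = resMode N σ φ a n := by
    intro i
    induction i with
    | zero => simp
    | succ i ih => rw [← ih, Nat.cast_succ, ← add_assoc, h.resMode_succ (by lia)]
  have h2 : ∀ i : ℕ, N + i ≤ N' → resMode (N + i) σ' φ a n = resMode N σ' φ a n := by
    intro i hi
    induction i with
    | zero => simp
    | succ i ih =>
      rw [← ih (by push_cast at hi; lia), Nat.cast_succ, ← add_assoc,
        h.resMode_succ_left (by lia) (by push_cast at hi; lia)]
  have e1 := h1 (σ' - σ).toNat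
  have e2 := h2 (N' - N).toNat (by lia)
  rw [show σ + ((σ' - σ).toNat : ℤ) = σ' by lia] at e1
  rw [show N + ((N' - N).toNat : ℤ) = N' by lia] at e2
  rw [e2, e1]

open Classical in
/-- The mode `a_(n)` on functionals on `V` that are regular at `a`: the residue at `x = 0` of
`x^n φ (Y(a, x - 1) b)`. By `IsRegularAt.regMode_eq` it does not depend on the choice of the bounds
for the pole at `0` and the zero at `∞`. If `φ` is not regular at `a`, the value is `0`. -/
def regMode (φ : V →ₗ[ℂ] P) (a : V) (n : ℤ) : V →ₗ[ℂ] P :=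
  if h : ∃ p : ℤ × ℤ, IsRegularAt φ a p.1 p.2 then
    resMode h.choose.1 (h.choose.1 - h.choose.2) φ a n
  else 0

theorem IsRegularAt.regMode_eq {φ : V →ₗ[ℂ] P} {a : V} {N C : ℤ} (h : IsRegularAt φ a N C)
    {σ : ℤ} (hσ : N - C ≤ σ) (n : ℤ) : regMode φ a n = resMode N σ φ a n := by
  have hex : ∃ p : ℤ × ℤ, IsRegularAt φ a p.1 p.2 := ⟨(N, C), h⟩
  rw [regMode, dif_pos hex]
  have h' := hex.choose_spec
  set N₁ := hex.choose.1
  set C₁ := hex.choose.2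
  -- compare both with a common refinement
  obtain ⟨N₂, σ₂, i1, i2, i3, i4, i5, i6⟩ : ∃ N₂ σ₂ : ℤ, N ≤ N₂ ∧ N₁ ≤ N₂ ∧ σ ≤ σ₂ ∧
      N₁ - C₁ ≤ σ₂ ∧ N₂ - C ≤ σ₂ ∧ N₂ - C₁ ≤ σ₂ :=
    ⟨max N N₁, max σ (max (N₁ - C₁) (max (max N N₁ - C) (max N N₁ - C₁))), by lia, by lia, by lia,
      by lia, by lia, by lia⟩
  rw [← h.resMode_mono i1 hσ i3 i5, ← h'.resMode_mono i2 le_rfl i4 i6]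

theorem IsRegularAt.regMode_eq_zero {φ : V →ₗ[ℂ] P} {a : V} {N C : ℤ} (h : IsRegularAt φ a N C)
    {n : ℤ} (hn : N ≤ n) : regMode φ a n = 0 := by
  rw [h.regMode_eq le_rfl, resMode, show (N - n).toNat = 0 by lia]
  simp

theorem IsRegularAt.regMode_truncated {φ : V →ₗ[ℂ] P} {a : V} {N C : ℤ} (h : IsRegularAt φ a N C)
    (b : V) (n : ℤ) (hn : N ≤ n) : regMode φ a n b = 0 := by
  rw [h.regMode_eq_zero hn, LinearMap.zero_apply]

/-- The residue theorem for `x^n (x - 1)^(-τ) φ (Y(a, x - 1) b)`. -/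
theorem IsRegularAt.altSum_regMode {φ : V →ₗ[ℂ] P} {a : V} {N C : ℤ} (h : IsRegularAt φ a N C)
    (b : V) {n τ : ℤ} (hn : n - τ ≤ C) :
    altSum (-τ) (fun m => regMode φ a m b) n = oppRes φ a b τ n := by
  have key : ∀ j : ℕ, ∀ n τ : ℤ, n - τ ≤ C → N - C ≤ τ + j →
      altSum (-τ) (fun m => regMode φ a m b) n = oppRes φ a b τ n := by
    intro j
    induction j with
    | zero =>
      intro n τ hn hτ
      have ht : ∀ i, N ≤ i → (fun m => if m < N then oppRes φ a b τ m else 0) i = 0 :=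
        fun i hi => if_neg (by lia)
      have e : (fun m => regMode φ a m b) =
          altSum τ (fun m => if m < N then oppRes φ a b τ m else 0) := by
        funext m
        rw [h.regMode_eq (by simpa using hτ), resMode_apply]
      rw [e, altSum_altSum ht, neg_add_cancel, altSum_zero]
      split_ifs with hnN
      · rfl
      · rw [h.oppRes_eq_zero b (by lia) hn]
    | succ j ih =>
      intro n τ hn hτ
      rw [oppRes_succ, ← ih n (τ + 1) (by lia) (by push_cast at hτ; lia),
        ← ih (n + 1) (τ + 1) (by lia) (by push_cast at hτ; lia),
        show -τ = -(τ + 1) + 1 by ring, altSum_succ (h.regMode_truncated b)]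
  exact key (N - C - τ).toNat n τ hn (by lia)

/-- If there is no residue at `∞`, then the residues at `0` and at `1` are opposite. -/
theorem IsRegularAt.regMode_apply {φ : V →ₗ[ℂ] P} {a : V} {N C : ℤ} (h : IsRegularAt φ a N C)
    (b : V) {n : ℤ} (hn : n ≤ C) : regMode φ a n b = -φ (modeSum V n 0 a b) := by
  have := h.altSum_regMode b (n := n) (τ := 0) (by lia)
  rw [neg_zero, altSum_zero] at this
  rw [this, oppRes]
  simp

end Regular

/-! ### Families of products with inserted powers -/

section Pascal

variable {E : Type*} [AddCommGroup E]

/-- Families `Ω α β s r`, thought of as residues of `(1 + t)^α (1 + u)^β t^s u^r` times a formal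
distribution in `t` and `u`, that vanish for large `s` and for large `r`. -/
structure IsPascal (Ω : ℤ → ℤ → ℤ → ℤ → E) : Prop where
  left : ∀ α β s r, Ω (α + 1) β s r = Ω α β s r + Ω α β (s + 1) r
  right : ∀ α β s r, Ω α (β + 1) s r = Ω α β s r + Ω α β s (r + 1)
  trunc_left : ∀ α β r, ∃ S, ∀ s, S ≤ s → Ω α β s r = 0
  trunc_right : ∀ α β s, ∃ R, ∀ r, R ≤ r → Ω α β s r = 0

theorem IsPascal.sub {Ω Ω' : ℤ → ℤ → ℤ → ℤ → E} (h : IsPascal Ω) (h' : IsPascal Ω') :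
    IsPascal fun α β s r => Ω α β s r - Ω' α β s r where
  left α β s r := by rw [h.left, h'.left]; abel
  right α β s r := by rw [h.right, h'.right]; abel
  trunc_left α β r := by
    obtain ⟨S, hS⟩ := h.trunc_left α β r
    obtain ⟨S', hS'⟩ := h'.trunc_left α β r
    exact ⟨max S S', fun s hs => by rw [hS s (by lia), hS' s (by lia), sub_zero]⟩
  trunc_right α β s := by
    obtain ⟨S, hS⟩ := h.trunc_right α β s
    obtain ⟨S', hS'⟩ := h'.trunc_right α β s
    exact ⟨max S S', fun r hr => by rw [hS r (by lia), hS' r (by lia), sub_zero]⟩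

/-- A family of residues vanishes if it does so without the factors `(1 + t)^α (1 + u)^β`. -/
theorem IsPascal.eq_zero {Ω : ℤ → ℤ → ℤ → ℤ → E} (h : IsPascal Ω)
    (h0 : ∀ s r, Ω 0 0 s r = 0) (α β s r : ℤ) : Ω α β s r = 0 := by
  have h1 : ∀ α s r, Ω α 0 s r = 0 := by
    intro α
    induction α using Int.induction_on with
    | zero => exact h0
    | succ α ih => intro s r; rw [h.left, ih, ih, add_zero]
    | pred α ih =>
      intro s r
      obtain ⟨S, hS⟩ := h.trunc_left (-(α : ℤ) - 1) 0 r
      refine eq_of_add_succ (g := 0) (N := S) (f := fun s => Ω (-(α : ℤ) - 1) 0 s r)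
        hS (fun i _ => rfl) (fun n => ?_) s
      have := h.left (-(α : ℤ) - 1) 0 n r
      rw [sub_add_cancel, ih] at this
      simp [← this]
  induction β using Int.induction_on generalizing r with
  | zero => exact h1 α s r
  | succ β ih => rw [h.right, ih, ih, add_zero]
  | pred β ih =>
    obtain ⟨S, hS⟩ := h.trunc_right α (-(β : ℤ) - 1) s
    refine eq_of_add_succ (g := 0) (N := S) (f := fun r => Ω α (-(β : ℤ) - 1) s r)
      hS (fun i _ => rfl) (fun n => ?_) r
    have := h.right α (-(β : ℤ) - 1) s n
    rw [sub_add_cancel, ih] at this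
    simp [← this]

/-- Multiplication by `x - y` on coefficients of `x^(-p-1) y^(-q-1)`. -/
def shiftSub (f : ℤ → ℤ → E) (p q : ℤ) : E := f (p + 1) q - f p (q + 1)

/-- Multiplication by `t - u` on families of residues. -/
def shiftSubInner (Ω : ℤ → ℤ → ℤ → ℤ → E) (α β : ℤ) : ℤ → ℤ → E := shiftSub (Ω α β)

theorem shiftSubInner_iterate (n : ℕ) (Ω : ℤ → ℤ → ℤ → ℤ → E) (α β : ℤ) :
    shiftSubInner^[n] Ω α β = shiftSub^[n] (Ω α β) := by
  induction n generalizing Ω with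
  | zero => rfl
  | succ n ih => rw [Function.iterate_succ_apply, ih]; rfl

theorem IsPascal.shiftSubInner {Ω : ℤ → ℤ → ℤ → ℤ → E} (h : IsPascal Ω) :
    IsPascal (shiftSubInner Ω) where
  left α β s r := by simp only [_root_.shiftSubInner, shiftSub]; rw [h.left, h.left]; abel
  right α β s r := by simp only [_root_.shiftSubInner, shiftSub]; rw [h.right, h.right]; abel
  trunc_left α β r := by
    obtain ⟨S, hS⟩ := h.trunc_left α β r
    obtain ⟨S', hS'⟩ := h.trunc_left α β (r + 1)
    exact ⟨max S S', fun s hs => by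
      rw [_root_.shiftSubInner, shiftSub, hS _ (by lia), hS' s (by lia), sub_zero]⟩
  trunc_right α β s := by
    obtain ⟨S, hS⟩ := h.trunc_right α β s
    obtain ⟨S', hS'⟩ := h.trunc_right α β (s + 1)
    exact ⟨max S S', fun r hr => by
      rw [_root_.shiftSubInner, shiftSub, hS _ (by lia), hS' r (by lia), sub_zero]⟩

theorem IsPascal.iterate {Ω : ℤ → ℤ → ℤ → ℤ → E} (h : IsPascal Ω) (n : ℕ) :
    IsPascal (_root_.shiftSubInner^[n] Ω) := by
  induction n generalizing Ω with
  | zero => exact h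
  | succ n ih => exact ih h.shiftSubInner

/-- Multiplication by a power of `(1 + t) - (1 + u)` is multiplication by a power of `t - u`. -/
theorem IsPascal.shiftSub_outer {Ω : ℤ → ℤ → ℤ → ℤ → E} (h : IsPascal Ω) (n : ℕ) (s r α β : ℤ) :
    shiftSub^[n] (fun α β => Ω α β s r) α β = shiftSub^[n] (Ω α β) s r := by
  induction n generalizing Ω with
  | zero => rfl
  | succ n ih =>
    rw [Function.iterate_succ_apply, Function.iterate_succ_apply]
    rw [← show _root_.shiftSubInner Ω α β = shiftSub (Ω α β) from rfl, ← ih h.shiftSubInner]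
    have e : shiftSub (fun α β => Ω α β s r) = fun α β => _root_.shiftSubInner Ω α β s r := by
      funext α β
      simp only [shiftSub, _root_.shiftSubInner, h.left, h.right]
      abel
    rw [e]

/-- The `n`-th power of `x - y`, expanded by the binomial theorem. -/
theorem shiftSub_iterate_eq_sum {E : Type*} [AddCommGroup E] [Module ℂ E] (n : ℕ) (f : ℤ → ℤ → E)
    (p q : ℤ) : shiftSub^[n] f p q =
      ∑ j ∈ Finset.range (n + 1), ((-1 : ℂ) ^ j * n.choose j) • f (p + n - j) (q + j) := by
  induction n generalizing f with
  | zero => simp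
  | succ n ih =>
    rw [Function.iterate_succ_apply, ih]
    simp only [shiftSub, smul_sub, Finset.sum_sub_distrib]
    rw [Finset.sum_range_succ' _ (n + 1)]
    simp only [Nat.choose_succ_succ, Nat.cast_add, mul_add, add_smul, Finset.sum_add_distrib]
    have e1 : ∑ x ∈ Finset.range (n + 1), ((-1 : ℂ) ^ (x + 1) * n.choose x) •
        f (p + (n + 1 : ℕ) - (x + 1 : ℕ)) (q + (x + 1 : ℕ)) =
        -∑ x ∈ Finset.range (n + 1), ((-1 : ℂ) ^ x * n.choose x) • f (p + n - x) (q + x + 1) := by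
      rw [← Finset.sum_neg_distrib]
      refine Finset.sum_congr rfl fun x _ => ?_
      rw [pow_succ, show p + ((n + 1 : ℕ) : ℤ) - ((x + 1 : ℕ) : ℤ) = p + n - x by push_cast; ring,
        show q + ((x + 1 : ℕ) : ℤ) = q + x + 1 by push_cast; ring]
      module
    have e2 : ∑ x ∈ Finset.range (n + 1), ((-1 : ℂ) ^ (x + 1) * n.choose (x + 1)) •
        f (p + (n + 1 : ℕ) - (x + 1 : ℕ)) (q + (x + 1 : ℕ)) +
        ((-1 : ℂ) ^ 0 * (n + 1).choose 0) • f (p + (n + 1 : ℕ) - (0 : ℕ)) (q + (0 : ℕ)) =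
        ∑ x ∈ Finset.range (n + 1), ((-1 : ℂ) ^ x * n.choose x) • f (p + n - x + 1) (q + x) := by
      rw [Finset.sum_range_succ, Nat.choose_succ_self, Finset.sum_range_succ' _ n]
      simp only [Nat.cast_zero, mul_zero, zero_smul, add_zero, Nat.choose_zero_right]
      congr 1
      · refine Finset.sum_congr rfl fun x _ => ?_
        congr 2
        push_cast; ring
      · congr 2
        push_cast; ring
    push_cast at e1 e2 ⊢
    rw [e1, add_assoc, e2]
    abel

theorem sum_antidiagonal_choose_succ (α : ℤ) (c : ℕ → ℤ) (X : ℕ × ℕ → E) (j : ℕ) :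
    ∑ p ∈ Finset.HasAntidiagonal.antidiagonal (j + 1), (intBinom (α + 1) p.1 * c p.2) • X p =
      ∑ p ∈ Finset.HasAntidiagonal.antidiagonal (j + 1), (intBinom α p.1 * c p.2) • X p +
      ∑ p ∈ Finset.HasAntidiagonal.antidiagonal j,
        (intBinom α p.1 * c p.2) • X (p.1 + 1, p.2) := by
  rw [Finset.Nat.sum_antidiagonal_succ, Finset.Nat.sum_antidiagonal_succ]
  simp only [intBinom, Ring.choose_succ_succ, Ring.choose_zero_right, add_mul, add_smul,
    Finset.sum_add_distrib]
  abel

/-- The Pascal relation in the first pair of variables, for the right-hand side of the commutator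
formula `commFamily_eq`. -/
theorem sum_antidiagonal_pascal (α s : ℤ) (W : ℤ → ℤ → E)
    (hW : ∀ A S, W (A + 1) S = W A S + W A (S + 1)) (A S : ℤ) (j : ℕ) :
    ∑ p ∈ Finset.HasAntidiagonal.antidiagonal j,
        (intBinom (α + 1) p.1 * intBinom s p.2) • W (A + 1 - p.1) (S - p.2) =
      ∑ p ∈ Finset.HasAntidiagonal.antidiagonal j,
        (intBinom α p.1 * intBinom s p.2) • W (A - p.1) (S - p.2) +
      ∑ p ∈ Finset.HasAntidiagonal.antidiagonal j,
        (intBinom α p.1 * intBinom (s + 1) p.2) • W (A - p.1) (S + 1 - p.2) := by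
  cases j with
  | zero => simp [intBinom, hW]
  | succ j =>
    have h1 := sum_antidiagonal_choose_succ α (intBinom s)
      (fun p => W (A + 1 - p.1) (S - p.2)) j
    have h2 := sum_antidiagonal_choose_succ s (intBinom α)
      (fun p => W (A - p.2) (S + 1 - p.1)) j
    rw [← Finset.Nat.sum_antidiagonal_swap, ← Finset.Nat.sum_antidiagonal_swap (n := j + 1)
      (f := fun p => (intBinom s p.1 * intBinom α p.2) • W (A - p.2) (S + 1 - p.1)),
      ← Finset.Nat.sum_antidiagonal_swap (n := j)] at h2
    simp only [Prod.fst_swap, Prod.snd_swap, mul_comm (intBinom (s + 1) _),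
      mul_comm (intBinom s _)] at h2
    rw [h1, h2, ← add_assoc, ← Finset.sum_add_distrib]
    congr 1
    · refine Finset.sum_congr rfl fun p _ => ?_
      rw [show A + 1 - (p.1 : ℤ) = A - p.1 + 1 by ring, hW, smul_add,
        show S - (p.2 : ℤ) + 1 = S + 1 - p.2 by ring]
    · refine Finset.sum_congr rfl fun p _ => ?_
      push_cast
      congr 2 <;> ring

end Pascal

section Products

variable {V : Type*} {M : Type*} [AddCommGroup V] [Module ℂ V] [VertexAlgebra V]
    [AddCommGroup M] [Module ℂ M] [VertexModule V M]

theorem binomSum_truncated {E : Type*} [AddCommGroup E] {u : ℤ → E} {N : ℤ}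
    (h : ∀ i, N ≤ i → u i = 0) (α s : ℤ) (hs : N ≤ s) : binomSum α u s = 0 := by
  rw [binomSum_eq α u s 0 fun i hi => h i (by push_cast at hi; lia)]
  simp

/-- The factor `(1 + w)^(α + β)` may be inserted in two steps. -/
theorem modeSum_add (α β s : ℤ) (a : V) (x : M) :
    modeSum M (α + β) s a x = binomSum α (fun i => modeSum M β i a x) s := by
  obtain ⟨N, hN⟩ := modeSum_truncated β a x
  induction α using Int.induction_on generalizing s with
  | zero => rw [zero_add, binomSum_zero]
  | succ α ih => rw [binomSum_succ _ _ _ ⟨N, hN⟩, ← ih, ← ih, add_right_comm, modeSum_succ]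
  | pred α ih =>
    obtain ⟨N', hN'⟩ := modeSum_truncated (-(α : ℤ) - 1 + β) a x
    have ht := fun s hs => binomSum_truncated hN (-(α : ℤ) - 1) s hs
    refine eq_of_add_succ (N := max N N')
      (f := fun s => modeSum M (-(α : ℤ) - 1 + β) s a x)
      (g := binomSum (-(α : ℤ) - 1) (fun i => modeSum M β i a x))
      (fun i hi => hN' i (by lia)) (fun i hi => ht i (by lia)) (fun n => ?_) s
    have e := ih n
    rwa [show -(α : ℤ) + β = -(α : ℤ) - 1 + β + 1 by ring, modeSum_succ,
      show -(α : ℤ) = -(α : ℤ) - 1 + 1 by ring, binomSum_succ _ _ _ ⟨N, hN⟩,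
      sub_add_cancel] at e

variable (M) in
/-- The commutator of `a` and `c` with inserted powers. -/
def commFamily (a c : V) (x : M) (α β s r : ℤ) : M :=
  modeSum M α s a (modeSum M β r c x) - modeSum M β r c (modeSum M α s a x)

theorem isPascal_commFamily (a c : V) (x : M) : IsPascal (commFamily M a c x) where
  left α β s r := by simp only [commFamily, modeSum_succ, map_add]; abel
  right α β s r := by simp only [commFamily, modeSum_succ, map_add]; abel
  trunc_left α β r := by
    obtain ⟨S, hS⟩ := modeSum_truncated α a (modeSum M β r c x)
    obtain ⟨S', hS'⟩ := modeSum_truncated α a x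
    exact ⟨max S S', fun s hs => by
      rw [commFamily, hS s (by lia), hS' s (by lia), map_zero, sub_zero]⟩
  trunc_right α β s := by
    obtain ⟨S, hS⟩ := modeSum_truncated β c (modeSum M α s a x)
    obtain ⟨S', hS'⟩ := modeSum_truncated β c x
    exact ⟨max S S', fun s hs => by
      rw [commFamily, hS s (by lia), hS' s (by lia), map_zero, sub_zero]⟩

theorem modeSum_zero (s : ℤ) (a : V) (x : M) : modeSum M 0 s a x = mode M a s x :=
  binomSum_zero (fun i => mode M a i x) s

/-- Locality: the commutator is annihilated by a power of `x - y`. -/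
theorem commFamily_local (a c : V) (x : M) (n : ℕ) (hn : ∀ j, (n : ℤ) ≤ j → mode V a j c = 0)
    (s r α β : ℤ) : shiftSub^[n] (fun α β => commFamily M a c x α β s r) α β = 0 := by
  have h := isPascal_commFamily (M := M) a c x
  rw [h.shiftSub_outer, ← shiftSubInner_iterate]
  refine (h.iterate n).eq_zero (fun s r => ?_) α β s r
  rw [shiftSubInner_iterate, shiftSub_iterate_eq_sum]
  have B := mode_borcherds a c x r s n
  have hc : ∀ j : ℕ, intBinom (n : ℤ) j = (n.choose j : ℤ) := fun j => Ring.choose_natCast _ _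
  rw [finsum_eq_zero_of_forall_eq_zero fun j : ℕ => by
      rw [hn _ (by lia), mode_zero, LinearMap.zero_apply, smul_zero],
    finsum_eq_sum_range _ (n + 1) fun j hj => by
      rw [hc, Nat.choose_eq_zero_of_lt (by lia)]; simp,
    finsum_eq_sum_range _ (n + 1) fun j hj => by
      rw [hc, Nat.choose_eq_zero_of_lt (by lia)]; simp,
    ← Finset.sum_range_reflect (fun j => ((-1 : ℂ) ^ ((j : ℤ) + n) * intBinom n j) • _)] at B
  rw [B, ← Finset.sum_sub_distrib]
  refine Finset.sum_congr rfl fun j hj => ?_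
  have hj := Finset.mem_range.1 hj
  have hj' : n + 1 - 1 - j = n - j := by lia
  have hs : (-1 : ℂ) ^ (((n - j : ℕ) : ℤ) + n) = (-1) ^ j := by
    rw [show (((n - j : ℕ) : ℤ) + n) = ((2 * (n - j) + j : ℕ) : ℤ) by lia, zpow_natCast, pow_add,
      pow_mul]
    simp
  rw [hj', hs, hc, hc, Nat.choose_symm (by lia), commFamily, modeSum_zero, modeSum_zero,
    modeSum_zero, modeSum_zero, smul_sub]
  rw [show (n : ℤ) + r - ((n - j : ℕ) : ℤ) = r + j by lia,
    show s + ((n - j : ℕ) : ℤ) = s + n - j by lia]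
  push_cast
  rfl

/-- The commutator formula with inserted powers. -/
theorem commFamily_eq (a c : V) (x : M) (J : ℕ) (hJ : ∀ j, (J : ℤ) ≤ j → mode V a j c = 0)
    (α β s r : ℤ) : commFamily M a c x α β s r =
      ∑ j ∈ Finset.range J, ∑ p ∈ Finset.HasAntidiagonal.antidiagonal j,
        (intBinom α p.1 * intBinom s p.2) •
          modeSum M (α + β - p.1) (s + r - p.2) (mode V a j c) x := by
  rw [← sub_eq_zero]
  refine ((isPascal_commFamily a c x).sub (Ω' := fun α β s r =>
    ∑ j ∈ Finset.range J, ∑ p ∈ Finset.HasAntidiagonal.antidiagonal j,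
        (intBinom α p.1 * intBinom s p.2) •
          modeSum M (α + β - p.1) (s + r - p.2) (mode V a j c) x) ?_).eq_zero ?_ α β s r
  · have bound : ∃ K : ℤ, ∀ j ∈ Finset.range J, ∀ p ∈ Finset.HasAntidiagonal.antidiagonal j,
        ∀ A S, K ≤ S + p.2 → modeSum M A (S - p.2 + p.2) (mode V a j c) x = 0 := by
      obtain ⟨K, hK⟩ := exists_bound J (fun j i => mode M (mode V a j c) i x)
        (fun j => mode_truncated _ _) 0
      refine ⟨K + 2 * J, fun j hj p hp A S hS => ?_⟩
      have h1 := Finset.mem_range.1 hj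
      have h2 := Finset.HasAntidiagonal.mem_antidiagonal.1 hp
      rw [modeSum_apply]
      exact binomSum_truncated (N := K) (fun i hi => hK j h1 i (by lia)) _ _ (by lia)
    obtain ⟨K, hK⟩ := bound
    have hz : ∀ α β s r, K + J ≤ s + r → (∑ j ∈ Finset.range J,
        ∑ p ∈ Finset.HasAntidiagonal.antidiagonal j, (intBinom α p.1 * intBinom s p.2) •
          modeSum M (α + β - p.1) (s + r - p.2) (mode V a j c) x) = 0 := by
      intro α β s r h
      refine Finset.sum_eq_zero fun j hj => Finset.sum_eq_zero fun p hp => ?_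
      have h1 := Finset.mem_range.1 hj
      have h2 := Finset.HasAntidiagonal.mem_antidiagonal.1 hp
      have := hK j hj p hp (α + β - p.1) (s + r - p.2) (by lia)
      rw [sub_add_cancel] at this
      rw [this, smul_zero]
    refine ⟨fun α β s r => ?_, fun α β s r => ?_, fun α β r => ⟨K + J - r, fun s hs => ?_⟩,
      fun α β s => ⟨K + J - s, fun r hr => ?_⟩⟩
    · rw [← Finset.sum_add_distrib]
      refine Finset.sum_congr rfl fun j _ => ?_
      generalize mode V a j c = d
      rw [show α + 1 + β = α + β + 1 by ring, show s + 1 + r = s + r + 1 by ring]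
      exact sum_antidiagonal_pascal α s (fun A S => modeSum M A S d x)
        (fun A S => modeSum_succ A S d x) (α + β) (s + r) j
    · rw [← Finset.sum_add_distrib]
      refine Finset.sum_congr rfl fun j _ => ?_
      rw [← Finset.sum_add_distrib]
      refine Finset.sum_congr rfl fun p _ => ?_
      rw [show α + (β + 1) - (p.1 : ℤ) = α + β - p.1 + 1 by ring, modeSum_succ, smul_add,
        show s + (r + 1) - (p.2 : ℤ) = s + r - p.2 + 1 by ring]
    · exact hz _ _ _ _ (by lia)
    · exact hz _ _ _ _ (by lia)
  · intro s r
    rw [commFamily, modeSum_zero, modeSum_zero, modeSum_zero, modeSum_zero, mode_commutator,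
      finsum_eq_sum_range _ J fun j hj => by
        rw [hJ j (by lia), mode_zero, LinearMap.zero_apply, smul_zero], sub_eq_zero]
    refine Finset.sum_congr rfl fun j _ => ?_
    rw [Finset.sum_eq_single (0, j)]
    · simp [intBinom, modeSum_zero]
    · rintro ⟨i, l⟩ hp hne
      have h2 := Finset.HasAntidiagonal.mem_antidiagonal.1 hp
      have : i ≠ 0 := by
        rintro rfl
        exact hne (by simp at h2; simp [h2])
      rw [intBinom, Ring.choose_zero_pos ℤ (by lia), zero_mul, zero_smul]
    · simp

end Products

/-! ### The regular dual -/

section Linear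

variable {V : Type u} {P : Type v} [AddCommGroup V] [Module ℂ V] [VertexAlgebra V]
    [AddCommGroup P] [Module ℂ P]

theorem IsRegularAt.regMode_add {φ : V →ₗ[ℂ] P} {a a' : V} {N C N' C' : ℤ}
    (h : IsRegularAt φ a N C) (h' : IsRegularAt φ a' N' C') (n : ℤ) :
    regMode φ (a + a') n = regMode φ a n + regMode φ a' n := by
  have h1 := h.mono (le_max_left N N') (min_le_left C C')
  have h2 := h'.mono (le_max_right N N') (min_le_right C C')
  rw [h1.regMode_eq le_rfl, h2.regMode_eq le_rfl, (h1.add h2).regMode_eq le_rfl, resMode_add]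

theorem IsRegularAt.regMode_smul {φ : V →ₗ[ℂ] P} {a : V} {N C : ℤ}
    (h : IsRegularAt φ a N C) (r : ℂ) (n : ℤ) :
    regMode φ (r • a) n = r • regMode φ a n := by
  rw [h.regMode_eq le_rfl, (h.smul r).regMode_eq le_rfl, resMode_smul]

theorem IsRegularAt.regMode_add_left {φ φ' : V →ₗ[ℂ] P} {a : V} {N C N' C' : ℤ}
    (h : IsRegularAt φ a N C) (h' : IsRegularAt φ' a N' C') (n : ℤ) :
    regMode (φ + φ') a n = regMode φ a n + regMode φ' a n := by
  have h1 := h.mono (le_max_left N N') (min_le_left C C')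
  have h2 := h'.mono (le_max_right N N') (min_le_right C C')
  rw [h1.regMode_eq le_rfl, h2.regMode_eq le_rfl, (h1.add_left h2).regMode_eq le_rfl,
    resMode_add_left]

theorem IsRegularAt.regMode_smul_left {φ : V →ₗ[ℂ] P} {a : V} {N C : ℤ}
    (h : IsRegularAt φ a N C) (r : ℂ) (n : ℤ) :
    regMode (r • φ) a n = r • regMode φ a n := by
  rw [h.regMode_eq le_rfl, (h.smul_left r).regMode_eq le_rfl, resMode_smul_left]

theorem regMode_zero_left (a : V) (n : ℤ) : regMode (0 : V →ₗ[ℂ] P) a n = 0 := by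
  rw [(IsRegularAt.zero a n 0).regMode_eq_zero le_rfl]

/-- Modes preserve regularity: the residue at `x = 0` of `φ (Y(a, x - 1) Y(c, y - 1) b)` is a
rational function of `y`, since `a` and `c` are local. -/
theorem IsRegularAt.isRegularAt_regMode {φ : V →ₗ[ℂ] P} {a c : V} {N C Nc Cc N' : ℤ} {J : ℕ}
    (ha : IsRegularAt φ a N C) (hc : IsRegularAt φ c Nc Cc)
    (hJ : ∀ j, (J : ℤ) ≤ j → mode V a j c = 0)
    (hd : ∀ j : ℕ, j < J → IsRegularAt φ (mode V a j c) N' (C + Cc + 1 - j)) (n : ℤ) :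
    IsRegularAt (regMode φ a n) c (max Nc (N' + J - n)) Cc := by
  intro β ρ h1 h2 b
  rw [ha.regMode_eq le_rfl, resMode, LinearMap.sum_apply]
  refine Finset.sum_eq_zero fun i hi => ?_
  have hi := Finset.mem_range.1 hi
  have e := commFamily_eq a c b J hJ (n + i) β (-(N - C)) ρ
  rw [commFamily, sub_eq_iff_eq_add] at e
  simp only [LinearMap.smul_apply, LinearMap.neg_apply, LinearMap.comp_apply]
  rw [e, map_add, hc β ρ (by lia) h2, add_zero, map_sum, Finset.sum_eq_zero]
  · simp
  · intro j hj
    have hj := Finset.mem_range.1 hj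
    rw [map_sum]
    refine Finset.sum_eq_zero fun p hp => ?_
    have hp := Finset.HasAntidiagonal.mem_antidiagonal.1 hp
    rw [map_zsmul, hd j hj _ _ (by lia) (by lia), smul_zero]

end Linear

section Dual

variable (V : Type u) (P : Type v) [AddCommGroup V] [Module ℂ V] [ConformalVertexAlgebra V]
    [AddCommGroup P] [Module ℂ P]

/-- The regular dual of `V` with values in `P`: the functionals `φ` on `V` for which all series
`φ (Y(a, x - 1) b)` are expansions at `x = 1` of rational functions in `x` with poles at most at
`0`, `1` and `∞`, such that the order of the pole at `0` is bounded in terms of `a`, and such that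
there is a zero of order at least `Δ_a` at `∞`. -/
def regularDual : Submodule ℂ (V →ₗ[ℂ] P) where
  carrier := {φ | ∀ (Δ : ℤ) (a : V), a ∈ energySpace V V (Δ : ℂ) →
    ∃ N, IsRegularAt φ a N (Δ - 2)}
  zero_mem' := fun Δ a _ => ⟨0, IsRegularAt.zero a 0 _⟩
  add_mem' := by
    intro φ φ' h h' Δ a ha
    obtain ⟨N, hN⟩ := h Δ a ha
    obtain ⟨N', hN'⟩ := h' Δ a ha
    exact ⟨max N N', (hN.mono (le_max_left _ _) le_rfl).add_left
      (hN'.mono (le_max_right _ _) le_rfl)⟩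
  smul_mem' := by
    intro r φ h Δ a ha
    obtain ⟨N, hN⟩ := h Δ a ha
    exact ⟨N, hN.smul_left r⟩

variable {V P}

theorem exists_isRegularAt {φ : V →ₗ[ℂ] P} (hφ : φ ∈ regularDual V P) (a : V) :
    ∃ N C, IsRegularAt φ a N C := by
  refine energy_induction (p := fun a => ∃ N C, IsRegularAt φ a N C) (fun Δ a ha => ?_)
    (fun a a' h h' => ?_) a
  · obtain ⟨N, hN⟩ := hφ Δ a ha
    exact ⟨N, _, hN⟩
  · obtain ⟨N, C, h⟩ := h
    obtain ⟨N', C', h'⟩ := h'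
    exact ⟨max N N', min C C', (h.mono (le_max_left _ _) (min_le_left _ _)).add
      (h'.mono (le_max_right _ _) (min_le_right _ _))⟩

theorem regMode_mem {φ : V →ₗ[ℂ] P} (hφ : φ ∈ regularDual V P) (a : V) (n : ℤ) :
    regMode φ a n ∈ regularDual V P := by
  refine energy_induction (p := fun a => regMode φ a n ∈ regularDual V P) (fun Δ a ha => ?_)
    (fun a a' h h' => ?_) a
  · intro Θ c hc
    obtain ⟨N, hN⟩ := hφ Δ a ha
    obtain ⟨Nc, hNc⟩ := hφ Θ c hc
    obtain ⟨J, hJ⟩ := mode_nat_truncated a c 0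
    have hj : ∀ j : ℕ, mode V a j c ∈ energySpace V V ((Δ + Θ - j - 1 : ℤ) : ℂ) := fun j =>
      mode_mem_energySpace _ ha hc (by push_cast; ring)
    choose N' hN' using fun j : ℕ => hφ _ _ (hj j)
    obtain ⟨N'', hN''⟩ := exists_forall_lt_le J N'
    refine ⟨_, hN.isRegularAt_regMode hNc (J := J) (N' := N'') (fun j hj => ?_) (fun j hj => ?_) n⟩
    · have := hJ j.toNat (by lia)
      rwa [show (0 : ℤ) + (j.toNat : ℤ) = j by lia] at this
    · exact (hN' j).mono (hN'' j hj) (by lia)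
  · obtain ⟨N, C, h1⟩ := exists_isRegularAt hφ a
    obtain ⟨N', C', h2⟩ := exists_isRegularAt hφ a'
    rw [h1.regMode_add h2]
    exact add_mem h h'

end Dual

/-! ### Fields with given modes -/

section OfModes

variable {V : Type*} {M : Type*} [AddCommGroup V] [Module ℂ V]
    [AddCommGroup M] [Module ℂ M]

theorem bddBelow_support_of_truncated {A : ℤ → Module.End ℂ M} {x : M}
    (h : ∃ N : ℤ, ∀ n, N ≤ n → A n x = 0) :
    BddBelow (Function.support fun n => A (-n - 1) x) := by
  obtain ⟨N, hN⟩ := h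
  refine ⟨-N, fun n hn => ?_⟩
  by_contra hc
  exact hn (hN _ (by lia))

/-- The state-field map with given modes. -/
def fieldsOfModes (A : V →ₗ[ℂ] ℤ → Module.End ℂ M)
    (hA : ∀ a x, ∃ N : ℤ, ∀ n, N ≤ n → A a n x = 0) : V →ₗ[ℂ] VertexOperator ℂ M where
  toFun a := VertexOperator.of_coeff (fun n => A a (-n - 1)) fun x =>
    bddBelow_support_of_truncated (hA a x)
  map_add' a b := by
    refine HVertexOperator.coeff_inj (funext fun n => ?_)
    ext x
    simp
  map_smul' r a := by
    refine HVertexOperator.coeff_inj (funext fun n => ?_)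
    ext x
    simp

theorem fieldsOfModes_ncoeff (A : V →ₗ[ℂ] ℤ → Module.End ℂ M)
    (hA : ∀ a x, ∃ N : ℤ, ∀ n, N ≤ n → A a n x = 0) (a : V) (n : ℤ) :
    (fieldsOfModes A hA a)[[n]] = A a n :=
  (VertexOperator.ncoeff_of_coeff _ (fun x => bddBelow_support_of_truncated (hA a x)) n).trans
    (congrArg (A a) (by ring))

end OfModes

/-! ### Defects of the Borcherds identity -/

section Defect

variable {E : Type*} [AddCommGroup E] [Module ℂ E]

theorem altSum_add {f g : ℤ → E} (hf : ∃ N : ℤ, ∀ i, N ≤ i → f i = 0)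
    (hg : ∃ N : ℤ, ∀ i, N ≤ i → g i = 0) (σ n : ℤ) :
    altSum σ (fun i => f i + g i) n = altSum σ f n + altSum σ g n := by
  obtain ⟨N, hf⟩ := hf
  obtain ⟨N', hg⟩ := hg
  have := altSum_sub (N := max N N') (f := fun i => f i + g i) (g := g)
    (fun i hi => by rw [hf i (by lia), hg i (by lia), add_zero]) (fun i hi => hg i (by lia)) σ n
  simp only [add_sub_cancel_right] at this
  rw [this, sub_add_cancel]

theorem altSum_smul (r : ℂ) (f : ℤ → E) (σ n : ℤ) :
    altSum σ (fun i => r • f i) n = r • altSum σ f n := by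
  simp only [altSum, smul_finsum]
  refine finsum_congr fun j => ?_
  rw [smul_comm]

theorem altSum_sum {ι : Type*} (s : Finset ι) (f : ι → ℤ → E)
    (hf : ∀ j, ∃ N : ℤ, ∀ i, N ≤ i → f j i = 0) (σ n : ℤ) :
    altSum σ (fun i => ∑ j ∈ s, f j i) n = ∑ j ∈ s, altSum σ (f j) n ∧
      ∃ N : ℤ, ∀ i, N ≤ i → ∑ j ∈ s, f j i = 0 := by
  classical
  induction s using Finset.induction_on with
  | empty => exact ⟨by simp [altSum], 0, fun _ _ => by simp⟩
  | insert j s hj ih =>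
    simp only [Finset.sum_insert hj]
    refine ⟨by rw [altSum_add (hf j) ih.2, ih.1], ?_⟩
    obtain ⟨N, hN⟩ := hf j
    obtain ⟨N', hN'⟩ := ih.2
    exact ⟨max N N', fun i hi => by rw [hN i (by lia), hN' i (by lia), add_zero]⟩

/-- The defect of the Borcherds identity with parameters `k`, `m`, `n`, on the plane where
`m + k + n` is a constant `T`: the three sequences stand for `i ↦ (a_(i) c)_(T - i)`,
`i ↦ a_(T - i) c_(i)` and `i ↦ c_(T - i) a_(i)`. -/
def borcherdsDefect (w A C : ℤ → E) (m k n : ℤ) : E :=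
  binomSum m w n - altSum n A k + (-1 : ℂ) ^ n • altSum n C m

theorem borcherdsDefect_sub {w A C : ℤ → E} (hw : ∃ N : ℤ, ∀ i, N ≤ i → w i = 0)
    (hA : ∃ N : ℤ, ∀ i, N ≤ i → A i = 0) (hC : ∃ N : ℤ, ∀ i, N ≤ i → C i = 0) (m k n : ℤ) :
    borcherdsDefect w A C (m + 1) k n - borcherdsDefect w A C m (k + 1) n =
      borcherdsDefect w A C m k (n + 1) := by
  obtain ⟨NA, hA⟩ := hA
  obtain ⟨NC, hC⟩ := hC
  simp only [borcherdsDefect]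
  rw [binomSum_succ m w n hw, altSum_succ hA, altSum_succ hC, zpow_add_one₀ (by norm_num)]
  module

/-- If the Borcherds identity holds for all large `n`, and for every `n` with one choice of the
other parameters, then it holds everywhere: by descending induction on `n` the difference
`borcherdsDefect_sub` vanishes, so that the defect depends on `n` only. -/
theorem borcherdsDefect_eq_zero {w A C : ℤ → E} (hw : ∃ N : ℤ, ∀ i, N ≤ i → w i = 0)
    (hA : ∃ N : ℤ, ∀ i, N ≤ i → A i = 0) (hC : ∃ N : ℤ, ∀ i, N ≤ i → C i = 0) (T n₀ : ℤ)
    (h0 : ∀ m k n, m + k + n = T → n₀ ≤ n → borcherdsDefect w A C m k n = 0)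
    (h1 : ∀ n, ∃ m k, m + k + n = T ∧ borcherdsDefect w A C m k n = 0) (m k n : ℤ)
    (hT : m + k + n = T) : borcherdsDefect w A C m k n = 0 := by
  have key : ∀ j : ℕ, ∀ m k n, m + k + n = T → n₀ ≤ n + j → borcherdsDefect w A C m k n = 0 := by
    intro j
    induction j with
    | zero => intro m k n h hn; exact h0 m k n h (by simpa using hn)
    | succ j ih =>
      intro m k n h hn
      have step : ∀ m, borcherdsDefect w A C (m + 1) (T - n - (m + 1)) n =
          borcherdsDefect w A C m (T - n - m) n := by
        intro m
        have := borcherdsDefect_sub hw hA hC m (T - n - (m + 1)) n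
        rw [ih m (T - n - (m + 1)) (n + 1) (by lia) (by push_cast at hn; lia), sub_eq_zero] at this
        rw [this]
        congr 1
        ring
      have const : ∀ i m : ℤ, borcherdsDefect w A C (m + i) (T - n - (m + i)) n =
          borcherdsDefect w A C m (T - n - m) n := by
        intro i m
        induction i using Int.induction_on with
        | zero => rw [add_zero]
        | succ i ih => rw [← add_assoc, step, ih]
        | pred i ih =>
          rw [← ih, ← step, ← add_sub_assoc, sub_add_cancel]
      obtain ⟨m', k', hT', h'⟩ := h1 n
      have := const (m - m') m'
      rw [add_sub_cancel, show T - n - m = k by lia, show T - n - m' = k' by lia, h'] at this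
      exact this
  exact key (n₀ - n).toNat m k n hT (by lia)

/-- Two-variable version of `eq_zero_of_altSum_eq_zero`. -/
theorem eq_zero_of_altSum_altSum_eq_zero {f : ℤ → ℤ → E} {m₀ k₀ K : ℤ} (σ τ : ℤ)
    (h1 : ∀ m k, m₀ ≤ m → K ≤ k → f m k = 0) (h2 : ∀ m k, k₀ ≤ k → K ≤ m → f m k = 0)
    (h : ∀ m k, m₀ ≤ m → k₀ ≤ k → m < K → k < K →
      altSum σ (fun m => altSum τ (f m) k) m = 0) (m k : ℤ) (hm : m₀ ≤ m) (hk : k₀ ≤ k) :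
    f m k = 0 := by
  have hz : ∀ m k, m₀ ≤ m → k₀ ≤ k → altSum τ (f m) k = 0 := by
    intro m k hm hk
    have ht : ∀ m, K ≤ m → altSum τ (f m) k = 0 := fun m hm =>
      altSum_truncated (fun i hi => h2 m i hi hm) τ k hk
    refine eq_zero_of_altSum_eq_zero (f := fun m => altSum τ (f m) k) ht σ (fun i hi => ?_) m hm
    rcases lt_or_ge i K with hi' | hi'
    · rcases lt_or_ge k K with hk' | hk'
      · exact h i k hi hk hi' hk'
      · exact altSum_truncated (N := m₀)
          (fun j hj => altSum_truncated (fun l hl => h1 j l hj hl) τ k hk') σ i hi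
    · exact altSum_truncated ht σ i hi'
  exact eq_zero_of_altSum_eq_zero (fun i hi => h1 m i hm hi) τ (fun i hi => hz m i hm hi) k hk

end Defect

theorem choose_mul_choose_comm (r : ℤ) (i j : ℕ) :
    intBinom r j * intBinom (r - j) i = intBinom r i * intBinom (r - i) j := by
  have h1 := Ring.choose_smul_choose r (n := i + j) (k := j) (by lia)
  have h2 := Ring.choose_smul_choose r (n := i + j) (k := i) (by lia)
  rw [Nat.add_sub_cancel] at h1
  rw [Nat.add_sub_cancel_left] at h2
  rw [intBinom, intBinom, intBinom, intBinom, ← h1, ← h2, Nat.choose_symm_add]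

section Regular

variable {V : Type u} {P : Type v} [AddCommGroup V] [Module ℂ V] [VertexAlgebra V]
    [AddCommGroup P] [Module ℂ P]

/-- The residue theorem in `x` for `x^m (x - y)^n φ (Y(a, x - 1) Y(c, y - 1) b)`. -/
theorem IsRegularAt.sum_modeSum_add_sum_regMode {φ : V →ₗ[ℂ] P} {a : V} {N C : ℤ}
    (ha : IsRegularAt φ a N C) (c b : V) {m n : ℤ} (hmn : m + n ≤ C) (k q : ℤ) (J : ℕ)
    (hJ : N ≤ m + J) :
    φ (∑ᶠ j : ℕ, ((-1 : ℂ) ^ j * intBinom n j) • modeSum V m (n - j) a (modeSum V k (q + j) c b)) +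
      (-1 : ℂ) ^ n • ∑ i ∈ Finset.range J, ((-1 : ℂ) ^ i * intBinom n i) •
        regMode φ a (m + i) (modeSum V (n + k - i) q c b) = 0 := by
  obtain ⟨L', hL'⟩ := modeSum_truncated k c b
  obtain ⟨L, hL⟩ : ∃ L : ℕ, L' ≤ q + L := ⟨(L' - q).toNat, by lia⟩
  have hL : ∀ i, q + L ≤ i → modeSum V k i c b = 0 := fun i hi => hL' i (by lia)
  rw [finsum_eq_sum_range _ L fun j hj => by rw [hL _ (by lia), map_zero, smul_zero], map_sum]
  have e1 : ∀ j : ℕ, ∀ b', φ (modeSum V m (n - j) a b') =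
      -((-1 : ℂ) ^ ((j : ℤ) - n) • ∑ i ∈ Finset.range J,
        ((-1 : ℂ) ^ i * intBinom (n - j) i) • regMode φ a (m + i) b') := by
    intro j b'
    have := ha.altSum_regMode b' (n := m) (τ := j - n) (by lia)
    rw [altSum_eq _ _ m J fun i hi => ha.regMode_truncated b' i (by lia), neg_sub] at this
    rw [this, oppRes, neg_sub, smul_neg, neg_neg, smul_smul, ← mul_zpow]
    simp
  have e2 : ∀ i : ℕ, modeSum V (n + k - i) q c b =
      ∑ j ∈ Finset.range L, intBinom (n - i) j • modeSum V k (q + j) c b := by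
    intro i
    rw [show n + k - i = n - i + k by ring, modeSum_add, binomSum_eq _ _ _ L hL]
  simp only [map_smul, e1, e2, map_sum, map_zsmul, Finset.smul_sum, smul_neg]
  rw [Finset.sum_comm (s := Finset.range J), ← Finset.sum_add_distrib]
  refine Finset.sum_eq_zero fun j _ => ?_
  rw [neg_add_eq_zero]
  refine Finset.sum_congr rfl fun i _ => ?_
  have h1 : ((-1 : ℂ) ^ ((j : ℤ) - n)) * (-1) ^ j = (-1) ^ n := by
    rw [← zpow_natCast, ← zpow_add₀ (by norm_num), show (j : ℤ) - n + j = n + 2 * (j - n) by ring,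
      zpow_add₀ (by norm_num), zpow_mul]
    norm_num
  have h2 := congrArg (Int.cast : ℤ → ℂ) (choose_mul_choose_comm n i j)
  push_cast at h2
  rw [← Int.cast_smul_eq_zsmul ℂ, smul_smul, smul_smul, smul_smul, smul_smul, ← h1]
  congr 1
  linear_combination ((-1 : ℂ) ^ ((j : ℤ) - n)) * (-1) ^ j * (-1) ^ i * h2

end Regular

/-! ### The Borcherds identity on the regular dual -/

section Regular

variable {V : Type u} {P : Type v} [AddCommGroup V] [Module ℂ V] [VertexAlgebra V]
    [AddCommGroup P] [Module ℂ P]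

/-- The defect of the Borcherds identity for `regMode`. -/
def regDefect (φ : V →ₗ[ℂ] P) (a c b : V) (m k n : ℤ) : P :=
  borcherdsDefect (fun i => regMode φ (mode V a i c) (m + k + n - i) b)
    (fun i => regMode (regMode φ c i) a (m + k + n - i) b)
    (fun i => regMode (regMode φ a i) c (m + k + n - i) b) m k n

/-- The Borcherds identity holds when `k` is so large that the products `a_(i) c_(j)` do not
contribute, and `m + n` is so small that there is no residue at `∞`. It is obtained from the
Borcherds identity in `V` by applying `φ` and taking residues first in the position of `a`, then in
that of `c`. -/
theorem regDefect_eq_zero_of_le {φ : V →ₗ[ℂ] P}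
    (h1 : ∀ a, ∃ N C, IsRegularAt φ a N C)
    (h2 : ∀ a p c, ∃ N C, IsRegularAt (regMode φ a p) c N C)
    {a c : V} {Na Ca Nc Cc : ℤ} (ha : IsRegularAt φ a Na Ca) (hc : IsRegularAt φ c Nc Cc)
    (b : V) {m k n : ℤ} (hmn : m + n ≤ Ca) (hk : Nc ≤ k) : regDefect φ a c b m k n = 0 := by
  obtain ⟨J₁, hJ₁⟩ := mode_truncated (M := V) a c
  obtain ⟨J, j1, j2⟩ : ∃ J : ℕ, J₁ ≤ n + J ∧ Na ≤ m + J :=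
    ⟨(max (J₁ - n) (Na - m)).toNat, by lia, by lia⟩
  choose N₁ C₁ hr₁ using h1
  choose N₂ C₂ hr₂ using h2
  let g : ℤ → P := fun k => ∑ j ∈ Finset.range J,
    (((intBinom m j : ℤ) : ℂ) • regMode φ (mode V a (n + j) c) (k + (m - j)) b +
      ((-1 : ℂ) ^ n * ((-1 : ℂ) ^ j * intBinom n j)) •
        regMode (regMode φ a (m + j)) c (k + (n - j)) b)
  have hg : regDefect φ a c b m k n = g k := by
    rw [regDefect, borcherdsDefect, binomSum_eq m _ n J fun i hi => by
        rw [hJ₁ i (by lia), show (0 : V) = (0 : ℂ) • (0 : V) by simp,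
          (hr₁ 0).regMode_smul, zero_smul, LinearMap.zero_apply],
      altSum_truncated (N := Nc) (fun i hi => by
        rw [hc.regMode_eq_zero hi, regMode_zero_left, LinearMap.zero_apply]) n k hk,
      altSum_eq n _ m J fun i hi => by
        rw [ha.regMode_eq_zero (by lia), regMode_zero_left, LinearMap.zero_apply],
      sub_zero, Finset.smul_sum, ← Finset.sum_add_distrib]
    refine Finset.sum_congr rfl fun j _ => ?_
    rw [smul_smul, Int.cast_smul_eq_zsmul, show m + k + n - (n + j) = k + (m - j) by ring,
      show m + k + n - (m + j) = k + (n - j) by ring]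
  have htr : ∀ j : ℕ, ∃ N : ℤ, ∀ k, N ≤ k →
      (((intBinom m j : ℤ) : ℂ) • regMode φ (mode V a (n + j) c) (k + (m - j)) b +
      ((-1 : ℂ) ^ n * ((-1 : ℂ) ^ j * intBinom n j)) •
        regMode (regMode φ a (m + j)) c (k + (n - j)) b) = 0 := fun j =>
    ⟨max (N₁ (mode V a (n + j) c) - (m - j)) (N₂ a (m + j) c - (n - j)), fun k hk => by
      rw [(hr₁ _).regMode_truncated b _ (by lia), (hr₂ _ _ _).regMode_truncated b _ (by lia),
        smul_zero, smul_zero, add_zero]⟩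
  obtain ⟨K, hK⟩ := (altSum_sum (Finset.range J) _ htr 0 0).2
  obtain ⟨r₁, hr1⟩ := exists_forall_lt_le J fun j => K + (m - j) - C₁ (mode V a (n + j) c)
  obtain ⟨r₂, hr2⟩ := exists_forall_lt_le J fun j => K + (n - j) - C₂ a (m + j) c
  obtain ⟨r, i1, i2, i3⟩ : ∃ r : ℤ, r₁ ≤ r ∧ r₂ ≤ r ∧ K + n - Cc ≤ r :=
    ⟨max r₁ (max r₂ (K + n - Cc)), by lia, by lia, by lia⟩
  -- after multiplication by a power of `y - 1` there is no residue at infinity in the variable `y`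
  rw [hg]
  refine eq_zero_of_altSum_eq_zero (f := g) hK (-r) (n₀ := Nc) (fun i hi => ?_) k hk
  rcases le_or_gt K i with hiK | hiK
  · exact altSum_truncated hK _ _ hiK
  rw [(altSum_sum (Finset.range J) _ htr (-r) i).1]
  have e : ∀ j ∈ Finset.range J, altSum (-r) (fun k =>
      (((intBinom m j : ℤ) : ℂ) • regMode φ (mode V a (n + j) c) (k + (m - j)) b +
      ((-1 : ℂ) ^ n * ((-1 : ℂ) ^ j * intBinom n j)) •
        regMode (regMode φ a (m + j)) c (k + (n - j)) b)) i =
      -((-1 : ℂ) ^ r • (φ (intBinom m j • modeSum V (m + i - j) (-r) (mode V a (n + j) c) b) +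
        (-1 : ℂ) ^ n • (((-1 : ℂ) ^ j * intBinom n j) •
          regMode φ a (m + j) (modeSum V (n + i - j) (-r) c b)))) := by
    intro j hj
    have hj := Finset.mem_range.1 hj
    have b1 := hr1 j hj
    have b2 := hr2 j hj
    rw [altSum_add, altSum_smul, altSum_smul,
      altSum_shift (-r) (fun k => regMode φ (mode V a (n + j) c) k b),
      altSum_shift (-r) (fun k => regMode (regMode φ a (m + j)) c k b),
      (hr₁ _).altSum_regMode b (by lia), (hr₂ _ _ _).altSum_regMode b (by lia), oppRes, oppRes,
      map_zsmul, ← Int.cast_smul_eq_zsmul ℂ, show i + (m - j) = m + i - j by ring,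
      show i + (n - j) = n + i - j by ring]
    · module
    · exact ⟨N₁ (mode V a (n + j) c) - (m - j), fun k hk => by
        rw [(hr₁ _).regMode_truncated b _ (by lia), smul_zero]⟩
    · exact ⟨N₂ a (m + j) c - (n - j), fun k hk => by
        rw [(hr₂ _ _ _).regMode_truncated b _ (by lia), smul_zero]⟩
  rw [Finset.sum_congr rfl e, Finset.sum_neg_distrib, ← Finset.smul_sum, Finset.sum_add_distrib,
    ← map_sum, ← Finset.smul_sum]
  have B := modeSum_borcherds a c b m i n (-r)
  rw [finsum_eq_sum_range (fun j : ℕ => intBinom m j • _) J fun j hj => by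
    rw [hJ₁ _ (by lia), map_zero, LinearMap.zero_apply, smul_zero] ] at B
  have R := ha.sum_modeSum_add_sum_regMode c b hmn i (-r) J j2
  have Z : φ (∑ᶠ j : ℕ, ((-1 : ℂ) ^ ((j : ℤ) + n) * intBinom n j) •
      modeSum V i (n + -r - j) c (modeSum V m j a b)) = 0 :=
    finsum_induction (p := fun x => φ x = 0) (map_zero φ)
      (fun x y hx hy => by rw [map_add, hx, hy, add_zero])
      (fun j => by rw [map_smul, hc _ _ hi (by lia), smul_zero])
  rw [B, map_sub, Z, sub_zero, R, smul_zero, neg_zero]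

/-- Weak commutativity of the fields `regMode`: it follows from locality of `a` and `c` on `V`,
since both orders of taking residues at the origin express the result by residues at `1`. -/
theorem regDefect_eq_zero_of_local {φ : V →ₗ[ℂ] P}
    (h1 : ∀ a, ∃ N C, IsRegularAt φ a N C)
    (h2 : ∀ a p c, ∃ N C, IsRegularAt (regMode φ a p) c N C)
    (a c b : V) (m k : ℤ) (n : ℕ) (hn : ∀ j, (n : ℤ) ≤ j → mode V a j c = 0) :
    regDefect φ a c b m k n = 0 := by
  choose N₁ C₁ hr₁ using h1
  choose N₂ C₂ hr₂ using h2
  let f : ℤ → ℤ → P := fun m k =>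
    regMode (regMode φ c k) a m b - regMode (regMode φ a m) c k b
  have hc : ∀ j : ℕ, intBinom (n : ℤ) j = (n.choose j : ℤ) := fun j => Ring.choose_natCast _ _
  have hf : regDefect φ a c b m k n = -shiftSub^[n] f m k := by
    rw [regDefect, borcherdsDefect, binomSum_truncated (N := n) (fun i hi => by
        rw [hn i (by lia), show (0 : V) = (0 : ℂ) • (0 : V) by simp,
          (hr₁ 0).regMode_smul, zero_smul, LinearMap.zero_apply]) _ _ le_rfl, zero_sub,
      shiftSub_iterate_eq_sum, altSum, altSum,
      finsum_eq_sum_range _ (n + 1) fun j hj => by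
        rw [hc, Nat.choose_eq_zero_of_lt (by lia)]; simp,
      finsum_eq_sum_range _ (n + 1) fun j hj => by
        rw [hc, Nat.choose_eq_zero_of_lt (by lia)]; simp,
      ← Finset.sum_range_reflect (fun j => ((-1 : ℂ) ^ j * intBinom n j) •
        regMode (regMode φ a (m + j)) c (m + k + n - (m + j)) b), Finset.smul_sum, neg_add_eq_sub,
      ← Finset.sum_sub_distrib, ← Finset.sum_neg_distrib]
    refine Finset.sum_congr rfl fun j hj => ?_
    have hj := Finset.mem_range.1 hj
    have hj' : n + 1 - 1 - j = n - j := by lia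
    have hs : (-1 : ℂ) ^ (n : ℤ) * (-1) ^ (n - j) = (-1) ^ j := by
      rw [zpow_natCast, ← pow_add, show n + (n - j) = 2 * (n - j) + j by lia, pow_add, pow_mul]
      simp
    rw [hj', hc, hc, Nat.choose_symm (by lia), smul_smul, ← mul_assoc, hs,
      show m + k + n - (k + j) = m + n - j by ring,
      show m + k + n - (m + ((n - j : ℕ) : ℤ)) = k + j by lia,
      show m + ((n - j : ℕ) : ℤ) = m + n - j by lia]
    simp only [f]
    push_cast
    module
  rw [hf, neg_eq_zero]
  -- bounds for the region where `f` does not vanish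
  obtain ⟨I, i1⟩ : ∃ I : ℕ, N₁ a ≤ m + I := ⟨(N₁ a - m).toNat, by lia⟩
  obtain ⟨L, l1⟩ : ∃ L : ℕ, N₁ c ≤ k + L := ⟨(N₁ c - k).toNat, by lia⟩
  obtain ⟨K₁, k1⟩ := exists_forall_lt_le I fun i => N₂ a (m + i) c
  obtain ⟨K₂, k2⟩ := exists_forall_lt_le L fun i => N₂ c (k + i) a
  obtain ⟨K, k3, k4, k5, k6⟩ : ∃ K : ℤ, K₁ ≤ K ∧ K₂ ≤ K ∧ N₁ a ≤ K ∧ N₁ c ≤ K :=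
    ⟨max (max K₁ K₂) (max (N₁ a) (N₁ c)), by lia, by lia, by lia, by lia⟩
  have za : ∀ p, N₁ a ≤ p → regMode φ a p = 0 := fun p hp => (hr₁ a).regMode_eq_zero hp
  have zc : ∀ p, N₁ c ≤ p → regMode φ c p = 0 := fun p hp => (hr₁ c).regMode_eq_zero hp
  have f1 : ∀ p q, m ≤ p → K ≤ q → f p q = 0 := by
    intro p q hp hq
    simp only [f]
    rw [zc q (by lia), regMode_zero_left, LinearMap.zero_apply, zero_sub, neg_eq_zero]
    rcases le_or_gt (N₁ a) p with h | h
    · rw [za p h, regMode_zero_left, LinearMap.zero_apply]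
    · have := k1 (p - m).toNat (by lia)
      rw [show m + ((p - m).toNat : ℤ) = p by lia] at this
      exact (hr₂ a p c).regMode_truncated b _ (by lia)
  have f2 : ∀ p q, k ≤ q → K ≤ p → f p q = 0 := by
    intro p q hq hp
    simp only [f]
    rw [za p (by lia), regMode_zero_left, LinearMap.zero_apply, sub_zero]
    rcases le_or_gt (N₁ c) q with h | h
    · rw [zc q h, regMode_zero_left, LinearMap.zero_apply]
    · have := k2 (q - k).toNat (by lia)
      rw [show k + ((q - k).toNat : ℤ) = q by lia] at this
      exact (hr₂ c q a).regMode_truncated b _ (by lia)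
  -- exponents for which there are no residues at infinity
  obtain ⟨r₁, hr1⟩ := exists_forall_lt_le I fun i => K + n - C₂ a (m + i) c
  obtain ⟨r, r2, r3⟩ : ∃ r : ℤ, r₁ ≤ r ∧ K + n - C₁ c ≤ r :=
    ⟨max r₁ (K + n - C₁ c), by lia, by lia⟩
  obtain ⟨s₁, hs1⟩ := exists_forall_lt_le L fun i => K + n - C₂ c (k + i) a
  obtain ⟨s, s2, s3⟩ : ∃ s : ℤ, s₁ ≤ s ∧ K + n - C₁ a ≤ s :=
    ⟨max s₁ (K + n - C₁ a), by lia, by lia⟩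
  have G : ∀ p q, m ≤ p → k ≤ q → p < K + n → q < K + n →
      altSum (-s) (fun p => altSum (-r) (f p) q) p =
        -((-1 : ℂ) ^ s • (-1 : ℂ) ^ r • φ (commFamily V a c b p q (-s) (-r))) := by
    intro p q hp hq hpK hqK
    have tr1 : ∀ p, ∀ i, N₁ c ≤ i → regMode (regMode φ c i) a p b = 0 := fun p i hi => by
      rw [zc i hi, regMode_zero_left, LinearMap.zero_apply]
    have e0 : (fun p => altSum (-r) (f p) q) = fun p =>
        altSum (-r) (fun q => regMode (regMode φ c q) a p b) q -
        altSum (-r) (fun q => regMode (regMode φ a p) c q b) q := by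
      funext p
      exact altSum_sub (N := max (N₁ c) (N₂ a p c)) (fun i hi => tr1 p i (by lia))
        (fun i hi => (hr₂ a p c).regMode_truncated b i (by lia)) _ _
    have e1 : ∀ p, altSum (-r) (fun q => regMode (regMode φ c q) a p b) q =
        ∑ j ∈ Finset.range L, ((-1 : ℂ) ^ j * intBinom (-r) j) •
          regMode (regMode φ c (q + j)) a p b := fun p =>
      altSum_eq _ _ _ L fun i hi => tr1 p i (by lia)
    have tr2 : ∀ j : ℕ, ∃ N : ℤ, ∀ p, N ≤ p → ((-1 : ℂ) ^ j * intBinom (-r) j) •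
        regMode (regMode φ c (q + j)) a p b = 0 := fun j =>
      ⟨N₂ c (q + j) a, fun p hp => by rw [(hr₂ _ _ _).regMode_truncated b p hp, smul_zero]⟩
    have e2 : altSum (-s) (fun p => altSum (-r) (fun q => regMode (regMode φ c q) a p b) q) p =
        (-1 : ℂ) ^ s • (-1 : ℂ) ^ r • φ (modeSum V q (-r) c (modeSum V p (-s) a b)) := by
      simp only [e1]
      rw [(altSum_sum (Finset.range L) _ tr2 (-s) p).1]
      have : ∀ j ∈ Finset.range L, altSum (-s) (fun p => ((-1 : ℂ) ^ j * intBinom (-r) j) •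
          regMode (regMode φ c (q + j)) a p b) p = -((-1 : ℂ) ^ s •
            ((-1 : ℂ) ^ j * intBinom (-r) j) • regMode φ c (q + j) (modeSum V p (-s) a b)) := by
        intro j hj
        rw [altSum_smul]
        rcases le_or_gt (N₁ c) (q + j) with h | h
        · rw [zc _ h]
          simp [regMode_zero_left, altSum]
        · have := hs1 (q + j - k).toNat (by lia)
          rw [show k + ((q + j - k).toNat : ℤ) = q + j by lia] at this
          rw [(hr₂ c (q + j) a).altSum_regMode b (by lia), oppRes]
          module
      rw [Finset.sum_congr rfl this, Finset.sum_neg_distrib, ← Finset.smul_sum,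
        ← altSum_eq (-r) (fun i => regMode φ c i (modeSum V p (-s) a b)) q L fun i hi =>
          (hr₁ c).regMode_truncated _ i (by lia),
        (hr₁ c).altSum_regMode _ (by lia), oppRes, smul_neg, neg_neg]
    have e3 : altSum (-s) (fun p => altSum (-r) (fun q => regMode (regMode φ a p) c q b) q) p =
        (-1 : ℂ) ^ s • (-1 : ℂ) ^ r • φ (modeSum V p (-s) a (modeSum V q (-r) c b)) := by
      have : ∀ i, p ≤ i → altSum (-r) (fun q => regMode (regMode φ a i) c q b) q =
          (-(-1 : ℂ) ^ r) • regMode φ a i (modeSum V q (-r) c b) := by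
        intro i hi
        rcases le_or_gt (N₁ a) i with h | h
        · rw [za _ h]
          simp [regMode_zero_left, altSum]
        · have := hr1 (i - m).toNat (by lia)
          rw [show m + ((i - m).toNat : ℤ) = i by lia] at this
          rw [(hr₂ a i c).altSum_regMode b (by lia), oppRes]
          module
      rw [altSum_congr this, altSum_smul, (hr₁ a).altSum_regMode _ (by lia), oppRes]
      module
    have t1 : ∃ N : ℤ, ∀ i, N ≤ i →
        altSum (-r) (fun q => regMode (regMode φ c q) a i b) q = 0 := by
      obtain ⟨N, hN⟩ := (altSum_sum (Finset.range L) _ tr2 0 0).2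
      exact ⟨N, fun i hi => by rw [e1, hN i hi]⟩
    obtain ⟨N, hN⟩ := t1
    rw [e0, altSum_sub (N := max N (N₁ a)) (fun i hi => hN i (by lia)) (fun i hi => by
      rw [za i (by lia)]; simp [regMode_zero_left, altSum]), e2, e3, commFamily, map_sub]
    module
  refine eq_zero_of_altSum_altSum_eq_zero (m₀ := m) (k₀ := k) (K := K) (-s) (-r)
    (fun p q hp hq => ?_) (fun p q hq hp => ?_) (fun p q hp hq hpK hqK => ?_) m k le_rfl le_rfl
  · rw [shiftSub_iterate_eq_sum]
    refine Finset.sum_eq_zero fun j hj => ?_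
    have := Finset.mem_range.1 hj
    rw [f1 _ _ (by lia) (by lia), smul_zero]
  · rw [shiftSub_iterate_eq_sum]
    refine Finset.sum_eq_zero fun j hj => ?_
    have := Finset.mem_range.1 hj
    rw [f2 _ _ (by lia) (by lia), smul_zero]
  · have tf : ∀ p, ∃ N : ℤ, ∀ q, N ≤ q → f p q = 0 := fun p =>
      ⟨max (N₁ c) (N₂ a p c), fun q hq => by
        simp only [f]
        rw [zc q (by lia), regMode_zero_left, LinearMap.zero_apply,
          (hr₂ a p c).regMode_truncated b q (by lia), sub_zero]⟩
    have e1 : (fun p => altSum (-r) (shiftSub^[n] f p) q) = fun p =>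
        ∑ j ∈ Finset.range (n + 1), ((-1 : ℂ) ^ j * n.choose j) •
          altSum (-r) (f (p + n - j)) (q + j) := by
      funext p
      have e : shiftSub^[n] f p = fun q => ∑ j ∈ Finset.range (n + 1),
          ((-1 : ℂ) ^ j * n.choose j) • f (p + n - j) (q + j) :=
        funext fun q => shiftSub_iterate_eq_sum n f p q
      rw [e, (altSum_sum (Finset.range (n + 1)) (fun (j : ℕ) q =>
        ((-1 : ℂ) ^ j * n.choose j) • f (p + n - j) (q + j)) (fun j => ?_) (-r) q).1]
      · refine Finset.sum_congr rfl fun j _ => ?_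
        rw [altSum_smul, altSum_shift]
      · obtain ⟨N, hN⟩ := tf (p + n - j)
        exact ⟨N - j, fun i hi => by rw [hN _ (by lia), smul_zero]⟩
    rw [e1, (altSum_sum (Finset.range (n + 1)) (fun (j : ℕ) p => ((-1 : ℂ) ^ j * n.choose j) •
          altSum (-r) (f (p + n - j)) (q + j)) (fun j => ?_) (-s) p).1]
    · have e2 : ∀ j ∈ Finset.range (n + 1), altSum (-s) (fun p => ((-1 : ℂ) ^ j * n.choose j) •
          altSum (-r) (f (p + n - j)) (q + j)) p = -((-1 : ℂ) ^ s • (-1 : ℂ) ^ r •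
            φ (((-1 : ℂ) ^ j * n.choose j) •
              commFamily V a c b (p + n - j) (q + j) (-s) (-r))) := by
        intro j hj
        have hj := Finset.mem_range.1 hj
        have sh : (fun p => altSum (-r) (f (p + n - j)) (q + j)) = fun p =>
            (fun p => altSum (-r) (f p) (q + j)) (p + (n - j)) := by
          funext p
          rw [add_sub_assoc]
        rw [altSum_smul, sh, altSum_shift (-s) (fun p => altSum (-r) (f p) (q + j)),
          ← add_sub_assoc,
          G _ _ (by lia) (by lia) (by lia) (by lia), map_smul]
        module
      rw [Finset.sum_congr rfl e2, Finset.sum_neg_distrib, ← Finset.smul_sum, ← Finset.smul_sum,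
        ← map_sum, ← shiftSub_iterate_eq_sum n (fun α β => commFamily V a c b α β (-s) (-r)),
        commFamily_local a c b n hn, map_zero, smul_zero, smul_zero, neg_zero]
    · exact ⟨K + j, fun i hi => by
        rw [altSum_truncated (N := k) (fun q' hq' => f2 _ q' hq' (by lia)) _ _ (by lia),
          smul_zero]⟩

theorem regDefect_eq_zero {φ : V →ₗ[ℂ] P}
    (h1 : ∀ a, ∃ N C, IsRegularAt φ a N C)
    (h2 : ∀ a p c, ∃ N C, IsRegularAt (regMode φ a p) c N C) (a c b : V) (m k n : ℤ) :
    regDefect φ a c b m k n = 0 := by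
  obtain ⟨J, hJ⟩ := mode_truncated (M := V) a c
  obtain ⟨Na, Ca, ha⟩ := h1 a
  obtain ⟨Nc, Cc, hc⟩ := h1 c
  refine borcherdsDefect_eq_zero ⟨J, fun i hi => ?_⟩ ⟨Nc, fun i hi => ?_⟩ ⟨Na, fun i hi => ?_⟩
    (m + k + n) (max J 0) (fun m' k' n' hT hn => ?_) (fun n' => ?_) m k n rfl
  · obtain ⟨N, C, h0⟩ := h1 0
    rw [hJ i hi, show (0 : V) = (0 : ℂ) • (0 : V) by simp, h0.regMode_smul, zero_smul,
      LinearMap.zero_apply]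
  · rw [hc.regMode_eq_zero hi, regMode_zero_left, LinearMap.zero_apply]
  · rw [ha.regMode_eq_zero hi, regMode_zero_left, LinearMap.zero_apply]
  · rw [← hT]
    obtain ⟨n', rfl⟩ : ∃ i : ℕ, n' = i := ⟨n'.toNat, by lia⟩
    exact regDefect_eq_zero_of_local h1 h2 a c b m' k' n' fun j hj => hJ j (by lia)
  · refine ⟨m + k - max Nc (m + k + n - Ca) + n - n', max Nc (m + k + n - Ca), by ring, ?_⟩
    have := regDefect_eq_zero_of_le (k := max Nc (m + k + n - Ca)) (n := n')
      (m := m + k - max Nc (m + k + n - Ca) + n - n') h1 h2 ha hc b (by lia) (by lia)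
    rw [regDefect, show m + k - max Nc (m + k + n - Ca) + n - n' + max Nc (m + k + n - Ca) + n' =
      m + k + n by ring] at this
    exact this

/-- The Borcherds identity for the modes on functionals. -/
theorem regMode_borcherds {φ : V →ₗ[ℂ] P}
    (h1 : ∀ a, ∃ N C, IsRegularAt φ a N C)
    (h2 : ∀ a p c, ∃ N C, IsRegularAt (regMode φ a p) c N C) (a c b : V) (k m n : ℤ) :
    (∑ᶠ j : ℕ, intBinom m j • regMode φ (mode V a (n + j) c) (m + k - j) b) =
      (∑ᶠ j : ℕ, ((-1 : ℂ) ^ j * intBinom n j) •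
        regMode (regMode φ c (k + j)) a (m + n - j) b) -
      ∑ᶠ j : ℕ, ((-1 : ℂ) ^ ((j : ℤ) + n) * intBinom n j) •
        regMode (regMode φ a (m + j)) c (n + k - j) b := by
  have h := regDefect_eq_zero h1 h2 a c b m k n
  rw [regDefect, borcherdsDefect, binomSum, altSum, altSum, smul_finsum] at h
  rw [← sub_eq_zero, ← h, ← sub_add]
  congr 1
  · congr 1
    · refine finsum_congr fun j => ?_
      rw [show m + k + n - (n + j) = m + k - j by ring]
    · refine finsum_congr fun j => ?_
      rw [show m + k + n - (k + j) = m + n - j by ring]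
  · refine finsum_congr fun j => ?_
    rw [show m + k + n - (m + j) = n + k - j by ring, smul_smul, zpow_add₀ (by norm_num),
      zpow_natCast]
    congr 1
    ring

end Regular

/-! ### The module structure on the regular dual -/

section DualModule

variable {V : Type u} {P : Type v} [AddCommGroup V] [Module ℂ V] [ConformalVertexAlgebra V]
    [AddCommGroup P] [Module ℂ P]

theorem isRegularAt_vacuum (φ : V →ₗ[ℂ] P) : IsRegularAt φ (vacuum V) 0 (-2) := by
  intro α s hα hs b
  rw [modeSum_apply, binomSum, finsum_eq_zero_of_forall_eq_zero, map_zero]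
  intro j
  rw [mode_vacuum]
  split_ifs with h
  · obtain ⟨α, rfl⟩ : ∃ i : ℕ, α = i := ⟨α.toNat, by lia⟩
    have : intBinom (α : ℤ) j = (α.choose j : ℤ) := Ring.choose_natCast _ _
    rw [this, Nat.choose_eq_zero_of_lt (by lia)]
    simp
  · rw [smul_zero]

theorem regMode_vacuum (φ : V →ₗ[ℂ] P) (n : ℤ) :
    regMode φ (vacuum V) n = if n = -1 then φ else 0 := by
  have h := isRegularAt_vacuum φ
  ext b
  have h2 : ∀ n ≤ -2, regMode φ (vacuum V) n b = 0 := fun n hn => by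
    rw [h.regMode_apply b hn]
    have : modeSum V n 0 (vacuum V) b = 0 := by
      rw [modeSum_apply, binomSum, finsum_eq_zero_of_forall_eq_zero]
      intro j
      rw [mode_vacuum, if_neg (by lia), smul_zero]
    rw [this, map_zero, neg_zero]
  rcases lt_trichotomy n (-1) with hn | rfl | hn
  · rw [h2 n (by lia), if_neg (by lia), LinearMap.zero_apply]
  · have := h.altSum_regMode b (n := -1) (τ := 1) (by lia)
    rw [altSum_eq _ _ _ 1 fun i hi => h.regMode_truncated b i (by push_cast at hi; lia), oppRes,
      modeSum_apply, binomSum, finsum_eq_single _ 0 fun j hj => by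
        rw [mode_vacuum, if_neg (by lia), smul_zero], mode_vacuum] at this
    simpa using this
  · rw [h.regMode_eq_zero (by lia), if_neg (by lia)]

/-- The modes on a subspace of the regular dual that is stable under all modes. -/
def dualModes {W : Submodule ℂ (V →ₗ[ℂ] P)} (hW : W ≤ regularDual V P)
    (hcl : ∀ φ ∈ W, ∀ (a : V) (n : ℤ), regMode φ a n ∈ W) : V →ₗ[ℂ] ℤ → Module.End ℂ W where
  toFun a n :=
    { toFun := fun φ => ⟨regMode φ.1 a n, hcl _ φ.2 a n⟩
      map_add' := fun φ φ' => by
        obtain ⟨N, C, h⟩ := exists_isRegularAt (hW φ.2) a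
        obtain ⟨N', C', h'⟩ := exists_isRegularAt (hW φ'.2) a
        exact Subtype.ext (h.regMode_add_left h' n)
      map_smul' := fun r φ => by
        obtain ⟨N, C, h⟩ := exists_isRegularAt (hW φ.2) a
        exact Subtype.ext (h.regMode_smul_left r n) }
  map_add' a a' := by
    funext n
    refine LinearMap.ext fun φ => Subtype.ext ?_
    obtain ⟨N, C, h⟩ := exists_isRegularAt (hW φ.2) a
    obtain ⟨N', C', h'⟩ := exists_isRegularAt (hW φ.2) a'
    exact h.regMode_add h' n
  map_smul' r a := by
    funext n
    refine LinearMap.ext fun φ => Subtype.ext ?_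
    obtain ⟨N, C, h⟩ := exists_isRegularAt (hW φ.2) a
    exact h.regMode_smul r n

theorem dualModes_truncated {W : Submodule ℂ (V →ₗ[ℂ] P)} (hW : W ≤ regularDual V P)
    (hcl : ∀ φ ∈ W, ∀ (a : V) (n : ℤ), regMode φ a n ∈ W) (a : V) (φ : W) :
    ∃ N : ℤ, ∀ n, N ≤ n → dualModes hW hcl a n φ = 0 := by
  obtain ⟨N, C, h⟩ := exists_isRegularAt (hW φ.2) a
  exact ⟨N, fun n hn => Subtype.ext (h.regMode_eq_zero hn)⟩

theorem finite_support_of_truncated {E : Type*} [AddCommGroup E] [Module ℂ E] (f : ℤ → E)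
    (N s : ℤ) (h : ∀ n, N ≤ n → f n = 0) (c : ℕ → ℂ) :
    (Function.support fun j : ℕ => c j • f (s + j)).Finite := by
  refine (Set.finite_lt_nat (N - s).toNat).subset fun j hj => ?_
  by_contra hc
  refine hj ?_
  have := h (s + j) (by simp at hc; lia)
  simp only [this, smul_zero]

/-- A subspace of the regular dual that is stable under all modes is a module. -/
abbrev dualModule {W : Submodule ℂ (V →ₗ[ℂ] P)} (hW : W ≤ regularDual V P)
    (hcl : ∀ φ ∈ W, ∀ (a : V) (n : ℤ), regMode φ a n ∈ W) : VertexModule V W where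
  YM := fieldsOfModes (dualModes hW hcl) (dualModes_truncated hW hcl)
  vac_mode n φ := by
    rw [fieldsOfModes_ncoeff]
    refine Subtype.ext ((regMode_vacuum φ.1 n).trans ?_)
    split_ifs <;> rfl
  borcherds a c φ k m n := by
    simp only [fieldsOfModes_ncoeff]
    change (∑ᶠ j : ℕ, intBinom m j •
        dualModes hW hcl (mode V a (n + j) c) (m + k - j) φ) = _
    refine Subtype.ext (LinearMap.ext fun b => ?_)
    let ev : W →+ P := (LinearMap.applyₗ b ∘ₗ W.subtype).toAddMonoidHom
    have h1 : ∀ a, ∃ N C, IsRegularAt φ.1 a N C := exists_isRegularAt (hW φ.2)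
    have h2 : ∀ a p c, ∃ N C, IsRegularAt (regMode φ.1 a p) c N C := fun a p c =>
      exists_isRegularAt (regMode_mem (hW φ.2) a p) c
    have B := regMode_borcherds h1 h2 a c b k m n
    obtain ⟨N₁, hN₁⟩ := mode_truncated (M := V) a c
    obtain ⟨N₂, C₂, hN₂⟩ := h1 a
    obtain ⟨N₃, C₃, hN₃⟩ := h1 c
    have e1 : ev (∑ᶠ j : ℕ, intBinom m j •
        dualModes hW hcl (mode V a (n + j) c) (m + k - j) φ) =
        ∑ᶠ j : ℕ, intBinom m j • regMode φ.1 (mode V a (n + j) c) (m + k - j) b := by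
      rw [AddMonoidHom.map_finsum]
      · exact finsum_congr fun j => map_zsmul ev _ _
      · refine (finite_support_of_truncated
          (fun i => dualModes hW hcl (mode V a i c) (m + k + n - i) φ) N₁ n (fun i hi => ?_)
          (fun j => ((intBinom m j : ℤ) : ℂ))).subset fun j hj => ?_
        · rw [hN₁ i hi, map_zero]; rfl
        · simpa only [Function.mem_support, Int.cast_smul_eq_zsmul,
            show m + k + n - (n + j) = m + k - j by ring] using hj
    have e2 : ev (∑ᶠ j : ℕ, ((-1 : ℂ) ^ j * intBinom n j) •
        dualModes hW hcl a (m + n - j) (dualModes hW hcl c (k + j) φ)) =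
        ∑ᶠ j : ℕ, ((-1 : ℂ) ^ j * intBinom n j) •
          regMode (regMode φ.1 c (k + j)) a (m + n - j) b := by
      rw [AddMonoidHom.map_finsum]
      · rfl
      · refine (finite_support_of_truncated
          (fun i => dualModes hW hcl a (m + k + n - i) (dualModes hW hcl c i φ)) N₃ k
          (fun i hi => ?_) (fun j => (-1 : ℂ) ^ j * intBinom n j)).subset fun j hj => ?_
        · have : dualModes hW hcl c i φ = 0 := Subtype.ext (hN₃.regMode_eq_zero hi)
          rw [this, map_zero]
        · simpa only [Function.mem_support,
            show m + k + n - (k + j) = m + n - j by ring] using hj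
    have e3 : ev (∑ᶠ j : ℕ, ((-1 : ℂ) ^ ((j : ℤ) + n) * intBinom n j) •
        dualModes hW hcl c (n + k - j) (dualModes hW hcl a (m + j) φ)) =
        ∑ᶠ j : ℕ, ((-1 : ℂ) ^ ((j : ℤ) + n) * intBinom n j) •
          regMode (regMode φ.1 a (m + j)) c (n + k - j) b := by
      rw [AddMonoidHom.map_finsum]
      · rfl
      · refine (finite_support_of_truncated
          (fun i => dualModes hW hcl c (m + k + n - i) (dualModes hW hcl a i φ)) N₂ m
          (fun i hi => ?_) (fun j => (-1 : ℂ) ^ ((j : ℤ) + n) * intBinom n j)).subset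
            fun j hj => ?_
        · have : dualModes hW hcl a i φ = 0 := Subtype.ext (hN₂.regMode_eq_zero hi)
          rw [this, map_zero]
        · simpa only [Function.mem_support,
            show m + k + n - (m + j) = n + k - j by ring] using hj
    rw [← e1, ← e2, ← e3, ← map_sub] at B
    exact B

theorem dualModule_mode {W : Submodule ℂ (V →ₗ[ℂ] P)} (hW : W ≤ regularDual V P)
    (hcl : ∀ φ ∈ W, ∀ (a : V) (n : ℤ), regMode φ a n ∈ W) (a : V) (n : ℤ) (φ : W) :
    letI := dualModule hW hcl
    (mode W a n φ : V →ₗ[ℂ] P) = regMode φ.1 a n := by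
  let _ := dualModule hW hcl
  change (((fieldsOfModes (dualModes hW hcl) (dualModes_truncated hW hcl) a)[[n]]) φ).1 = _
  rw [fieldsOfModes_ncoeff]
  rfl

end DualModule

/-! ### Modes that shift the energy by a fixed amount -/

section Shift

variable {V : Type*} {M : Type*} [AddCommGroup V] [Module ℂ V] [ConformalVertexAlgebra V]
    [AddCommGroup M] [Module ℂ M] [VertexModule V M]

variable (M) in
/-- The mode `a_(Δ - 1 - d)` for `a ∈ V_Δ`, which raises energies by `d`, extended linearly to
all `a ∈ V`. -/
def shiftMode (d : ℤ) : V →ₗ[ℂ] Module.End ℂ M := byWeight fun Δ => modeHom M (Δ - 1 - d)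

theorem shiftMode_apply (d : ℤ) {Δ : ℤ} {a : V} (ha : a ∈ energySpace V V (Δ : ℂ)) :
    shiftMode M d a = mode M a (Δ - 1 - d) := by
  rw [shiftMode, byWeight_apply _ ha]; rfl

theorem shiftMode_zero : shiftMode M 0 = zeroMode (V := V) M := by
  simp only [shiftMode, zeroMode, sub_zero]

theorem mode_eq_shiftMode {Δ : ℤ} {a : V} (ha : a ∈ energySpace V V (Δ : ℂ)) (n : ℤ) :
    mode M a n = shiftMode M (Δ - 1 - n) a := by
  rw [shiftMode_apply _ ha, sub_sub_cancel]

theorem shiftMode_vacuum (d : ℤ) (x : M) :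
    shiftMode M d (vacuum V) x = if d = 0 then x else 0 := by
  rw [shiftMode_apply (Δ := 0) _ (by simpa using vacuum_mem), mode_vacuum]
  congr 1
  exact propext (by lia)

theorem shiftMode_mem_energySpace {Δ Θ : ℂ} (d : ℤ) (a : V) {x : M} (hx : x ∈ energySpace V M Δ)
    (hΘ : Θ = Δ + d) : shiftMode M d a x ∈ energySpace V M Θ := by
  refine energy_induction (p := fun a => shiftMode M d a x ∈ energySpace V M Θ)
    (fun Ξ a ha => ?_) (fun a a' h h' => by simpa using add_mem h h') a
  rw [shiftMode_apply _ ha]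
  exact mode_mem_energySpace _ ha hx (by rw [hΘ]; push_cast; ring)

/-- The Borcherds identity for products with an inserted power `(1 + w)^α`. -/
theorem shiftMode_modeSum {Θ Ξ : ℤ} {a b : V} (ha : a ∈ energySpace V V (Θ : ℂ))
    (hb : b ∈ energySpace V V (Ξ : ℂ)) (d α s : ℤ) (x : M) :
    shiftMode M d (modeSum V α s a b) x =
      (∑ᶠ j : ℕ, ((-1 : ℂ) ^ j * intBinom s j) •
        mode M a (α + s - j) (mode M b (Θ + Ξ - s - 2 - d - α + j) x)) -
      ∑ᶠ j : ℕ, ((-1 : ℂ) ^ ((j : ℤ) + s) * intBinom s j) •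
        mode M b (Θ + Ξ - 2 - d - α - j) (mode M a (α + j) x) := by
  obtain ⟨N, hN⟩ := mode_nat_truncated a b s
  have hf : ∀ j : ℕ, mode V a (s + j) b ∈ energySpace V V ((Θ + Ξ - s - 1 - j : ℤ) : ℂ) := fun j =>
    mode_mem_energySpace _ ha hb (by push_cast; ring)
  have B := mode_borcherds a b x (Θ + Ξ - s - 2 - d - α) α s
  rw [modeSum_apply, binomSum,
    finsum_eq_sum_range _ N (fun j hj => by rw [hN j hj, smul_zero]), map_sum, LinearMap.sum_apply,
    show Θ + Ξ - 2 - d - α = s + (Θ + Ξ - s - 2 - d - α) by ring, ← B,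
    finsum_eq_sum_range _ N (fun j hj => by
      rw [hN j hj, mode_zero, LinearMap.zero_apply, smul_zero])]
  refine Finset.sum_congr rfl fun j _ => ?_
  rw [map_zsmul, LinearMap.smul_apply, shiftMode_apply _ (hf j)]
  congr 3
  ring

end Shift

/-! ### Vectors of lowest energy -/

section Top

variable {V : Type*} {M : Type*} [AddCommGroup V] [Module ℂ V] [ConformalVertexAlgebra V]
    [AddCommGroup M] [Module ℂ M] [VertexModule V M]

variable (V) in
/-- The vectors that are annihilated by all modes that lower energies. -/
def IsTopVector (x : M) : Prop :=
  ∀ (Θ : ℤ) (a : V), a ∈ energySpace V V (Θ : ℂ) → ∀ n, Θ ≤ n → mode M a n x = 0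

/-- On vectors of lowest energy, the product of the Zhu algebra acts as composition. -/
theorem IsTopVector.zeroMode_mul {x : M} (hx : IsTopVector V x) (a b : V) :
    zeroMode M (zhuProd (-1) a b) x = zeroMode M a (zeroMode M b x) := by
  refine energy_induction (p := fun a => zeroMode M (zhuProd (-1) a b) x =
    zeroMode M a (zeroMode M b x)) (fun Θ a ha => ?_) (fun a a' h h' => by simp [h, h']) a
  refine energy_induction (p := fun b => zeroMode M (zhuProd (-1) a b) x =
    zeroMode M a (zeroMode M b x)) (fun Ξ b hb => ?_) (fun b b' h h' => by simp [h, h']) b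
  rw [zhuProd_apply _ ha, ← shiftMode_zero, shiftMode_modeSum ha hb,
    finsum_eq_single _ 0 fun j hj => by rw [hx Ξ b hb _ (by lia), map_zero, smul_zero],
    finsum_eq_zero_of_forall_eq_zero fun j => by
      rw [hx Θ a ha _ (by lia), map_zero, smul_zero], shiftMode_apply _ ha, shiftMode_apply _ hb,
    sub_zero, sign_binom_neg_one, one_smul, sub_zero, sub_zero,
    show Θ + -1 - ((0 : ℕ) : ℤ) = Θ - 1 by simp; rfl,
    show Θ + Ξ - -1 - 2 - Θ + ((0 : ℕ) : ℤ) = Ξ - 1 - 0 by simp; ring]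

theorem IsTopVector.zeroMode_modeSum_eq_zero {x : M} (hx : IsTopVector V x) {Θ : ℤ} {a : V}
    (ha : a ∈ energySpace V V (Θ : ℂ)) {s : ℤ} (hs : s ≤ -2) (b : V) :
    zeroMode M (modeSum V Θ s a b) x = 0 := by
  refine energy_induction (p := fun b => zeroMode M (modeSum V Θ s a b) x = 0)
    (fun Ξ b hb => ?_) (fun b b' h h' => by simp [h, h']) b
  rw [← shiftMode_zero, shiftMode_modeSum ha hb,
    finsum_eq_zero_of_forall_eq_zero fun j => by rw [hx Ξ b hb _ (by lia), map_zero, smul_zero],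
    finsum_eq_zero_of_forall_eq_zero fun j => by
      rw [hx Θ a ha _ (by lia), map_zero, smul_zero], sub_zero]

theorem IsTopVector.add {x y : M} (hx : IsTopVector V x) (hy : IsTopVector V y) :
    IsTopVector V (x + y) := fun Θ a ha n hn => by
  rw [map_add, hx Θ a ha n hn, hy Θ a ha n hn, add_zero]

theorem IsTopVector.zeroMode {x : M} (hx : IsTopVector V x) (a : V) :
    IsTopVector V (zeroMode M a x) := by
  refine energy_induction (p := fun a => IsTopVector V (_root_.zeroMode M a x))
    (fun Δ a ha => ?_) (fun a a' h h' => by simpa using h.add h') a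
  intro Θ c hc n hn
  have := mode_commutator c a n (Δ - 1) x
  rw [hx Θ c hc n hn, map_zero, sub_zero, finsum_eq_zero_of_forall_eq_zero fun j => by
    rw [hx (Θ + Δ - j - 1) _ (mode_mem_energySpace _ hc ha (by push_cast; ring)) _ (by lia),
      smul_zero] ] at this
  rw [zeroMode_apply ha, this]

theorem IsTopVector.shiftMode_eq_zero {x : M} (hx : IsTopVector V x) {d : ℤ} (hd : d < 0) (a : V) :
    shiftMode M d a x = 0 := by
  refine energy_induction (p := fun a => shiftMode M d a x = 0)
    (fun Δ a ha => ?_) (fun a a' h h' => by simp [h, h']) a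
  rw [shiftMode_apply _ ha]
  exact hx Δ a ha _ (by lia)

end Top

/-! ### Functionals on the Zhu algebra -/

section Functional

variable {V : Type u} {P : Type v} [AddCommGroup V] [Module ℂ V] [ConformalVertexAlgebra V]
    [AddCommGroup P] [Module ℂ P]

theorem modeSum_mem_zhuIdeal {Δ : ℤ} {a : V} (ha : a ∈ energySpace V V (Δ : ℂ)) (b : V) (i : ℕ)
    {s : ℤ} (hs : i + s ≤ -2) : modeSum V (Δ + i) s a b ∈ zhuIdeal V := by
  induction i generalizing s with
  | zero =>
    simp only [Nat.cast_zero, add_zero, ← zhuProd_apply _ ha]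
    exact zhuProd_mem' _ (by simpa using hs) _ _
  | succ i ih =>
    push_cast at hs
    rw [Nat.cast_succ, ← add_assoc, modeSum_succ]
    exact add_mem (ih (by lia)) (ih (by lia))

theorem isRegularAt_of_zhuIdeal {f : V →ₗ[ℂ] P} (hf : ∀ x ∈ zhuIdeal V, f x = 0) {Δ : ℤ} {a : V}
    (ha : a ∈ energySpace V V (Δ : ℂ)) : IsRegularAt f a Δ (Δ - 2) := by
  intro α s h1 h2 b
  have := modeSum_mem_zhuIdeal ha b (α - Δ).toNat (s := s) (by lia)
  rw [show Δ + ((α - Δ).toNat : ℤ) = α by lia] at this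
  exact hf _ this

theorem mem_regularDual_of_zhuIdeal {f : V →ₗ[ℂ] P} (hf : ∀ x ∈ zhuIdeal V, f x = 0) :
    f ∈ regularDual V P := fun Δ _ ha => ⟨Δ, isRegularAt_of_zhuIdeal hf ha⟩

instance regularDual.vertexModule : VertexModule V (regularDual V P) :=
  dualModule le_rfl fun _ hφ a n => regMode_mem hφ a n

theorem regularDual_mode (a : V) (n : ℤ) (φ : regularDual V P) :
    (mode (regularDual V P) a n φ : V →ₗ[ℂ] P) = regMode φ.1 a n :=
  dualModule_mode le_rfl (fun _ hφ a n => regMode_mem hφ a n) a n φ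

theorem isTopVector_of_zhuIdeal {f : V →ₗ[ℂ] P} (hf : ∀ x ∈ zhuIdeal V, f x = 0) :
    IsTopVector V (⟨f, mem_regularDual_of_zhuIdeal hf⟩ : regularDual V P) := by
  intro Θ a ha n hn
  refine Subtype.ext ?_
  rw [regularDual_mode]
  exact (isRegularAt_of_zhuIdeal hf ha).regMode_eq_zero hn

/-- A functional is determined by the values at the vacuum of its images under all modes: this is
the residue theorem for `x^(Δ - 1) (x - 1)^(-1) φ (Y(a, x - 1) |0⟩)`. -/
theorem finsum_mode_vacuum (φ : regularDual V P) {Δ : ℤ} {a : V}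
    (ha : a ∈ energySpace V V (Δ : ℂ)) :
    ∑ᶠ j : ℕ, (mode (regularDual V P) a (Δ - 1 + j) φ).1 (vacuum V) = φ.1 a := by
  obtain ⟨N, h⟩ := φ.2 Δ a ha
  have := h.altSum_regMode (vacuum V) (n := Δ - 1) (τ := 1) (by lia)
  rw [altSum, oppRes, modeSum_eq _ _ _ _ 1
    (fun i hi => mode_apply_vacuum_nonneg _ _ (by push_cast at hi; lia))] at this
  simp only [sign_binom_neg_one, one_smul] at this
  simp only [regularDual_mode, this]
  simp [mode_apply_vacuum]

theorem mode_vacuum_eq_zero (φ : regularDual V P) {Δ : ℤ} {a : V}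
    (ha : a ∈ energySpace V V (Δ : ℂ)) {n : ℤ} (hn : n ≤ Δ - 2) :
    (mode (regularDual V P) a n φ).1 (vacuum V) = 0 := by
  obtain ⟨N, h⟩ := φ.2 Δ a ha
  rw [regularDual_mode, h.regMode_apply _ hn, modeSum_eq _ _ _ _ 0
    (fun i hi => mode_apply_vacuum_nonneg _ _ (by push_cast at hi; lia))]
  simp

theorem exists_mode_vacuum_ne_zero {φ : regularDual V P} (hφ : φ ≠ 0) :
    ∃ (a : V) (n : ℤ), (mode (regularDual V P) a n φ).1 (vacuum V) ≠ 0 := by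
  by_contra! h
  refine hφ (Subtype.ext (LinearMap.ext fun a => ?_))
  refine energy_induction (p := fun a => φ.1 a = 0) (fun Δ a ha => ?_)
    (fun a a' h h' => by rw [map_add, h, h', add_zero]) a
  rw [← finsum_mode_vacuum φ ha]
  exact finsum_eq_zero_of_forall_eq_zero fun j => h _ _

theorem IsTopVector.zeroMode_vacuum {φ : regularDual V P} (h : IsTopVector V φ) (a : V) :
    (_root_.zeroMode (regularDual V P) a φ).1 (vacuum V) = φ.1 a := by
  refine energy_induction (p := fun a => (_root_.zeroMode (regularDual V P) a φ).1 (vacuum V) =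
    φ.1 a) (fun Δ a ha => ?_) (fun a a' h h' => ?_) a
  · rw [← finsum_mode_vacuum φ ha, zeroMode_apply ha, finsum_eq_single _ 0 fun j hj => by
      rw [h Δ a ha _ (by lia)]; rfl]
    simp
  · rw [map_add, map_add, ← h, ← h']
    rfl

/-- On a functional on `A(V)` the zero mode of `a` acts as right multiplication by `a`. -/
theorem IsTopVector.zeroMode_regularDual {φ : regularDual V P} (h : IsTopVector V φ) (a b : V) :
    (_root_.zeroMode (regularDual V P) a φ).1 b = φ.1 (zhuProd (-1) b a) := by
  rw [← (h.zeroMode a).zeroMode_vacuum b, ← h.zeroMode_mul, h.zeroMode_vacuum]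

/-- The commutator in `A(V)`, computed in the regular dual of `V` with values in `A(V)`. -/
theorem zhuMk_commutator {Δ : ℤ} {a : V} (ha : a ∈ energySpace V V (Δ : ℂ)) (b : V) :
    zhuMk V a * zhuMk V b - zhuMk V b * zhuMk V a = zhuMk V (modeSum V (Δ - 1) 0 a b) := by
  have hf : ∀ x ∈ zhuIdeal V, zhuMk V x = 0 := fun x hx => zhuMk_eq_zero.2 hx
  have ht := isTopVector_of_zhuIdeal hf
  have h1 := ht.zeroMode_regularDual a b
  have h := isRegularAt_of_zhuIdeal hf ha
  have h2 := h.altSum_regMode b (n := Δ - 1) (τ := 1) (by lia)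
  rw [altSum_eq _ _ _ 1 fun i hi => h.regMode_truncated b i (by push_cast at hi; lia), oppRes] at h2
  rw [zeroMode_apply ha, regularDual_mode] at h1
  have h3 : zhuMk V (zhuProd (-1) b a) = zhuMk V (modeSum V (Δ - 1) (-1) a b) := by
    rw [← h1]
    simpa using h2
  rw [zhuMk_mul, zhuMk_mul, h3, ← map_sub, zhuProd_apply _ ha]
  congr 1
  have := modeSum_succ (Δ - 1) (-1) a b
  rw [sub_add_cancel, neg_add_cancel] at this
  rw [this, add_sub_cancel_left]

/-- The conformal vector has weight `2`, by the Virasoro relation for `L_0` and `L_(-2)`. -/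
theorem omega_mem : omega V ∈ energySpace V V 2 := by
  have := ConformalVertexAlgebra.virasoro (V := V) 0 (-2) (vacuum V)
  have e := mode_apply_vacuum (omega V)
  rw [mem_energySpace]
  simp only [zero_add, show (-2 : ℤ) + 1 = -1 by norm_num, e] at this
  rw [mode_apply_vacuum_nonneg (omega V) 1 (by norm_num), map_zero, if_neg (by norm_num)] at this
  simpa using this

/-- `L_(-1) b + L_0 b` vanishes in `A(V)`, since it is the residue for `b` and the vacuum. -/
theorem translation_add_mem (b : V) :
    mode V (omega V) 0 b + mode V (omega V) 1 b ∈ zhuIdeal V := by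
  refine energy_induction (p := fun b => mode V (omega V) 0 b + mode V (omega V) 1 b ∈ zhuIdeal V)
    (fun Δ b hb => ?_) (fun b b' h h' => ?_) b
  · have := zhuProd_mem' (-2) le_rfl b (vacuum V)
    rw [zhuProd_apply _ hb, modeSum_eq _ _ _ _ 2
      (fun i hi => mode_apply_vacuum_nonneg _ _ (by push_cast at hi; lia))] at this
    rw [ConformalVertexAlgebra.translation, mem_energySpace.1 hb]
    simpa [Finset.sum_range_succ, mode_apply_vacuum, Int.cast_smul_eq_zsmul] using this
  · have := add_mem h h'
    rw [map_add, map_add]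
    convert this using 1
    abel

/-- The class of `ω` is central in `A(V)`. -/
theorem zhuMk_omega_mul (b : V) :
    zhuMk V (omega V) * zhuMk V b = zhuMk V b * zhuMk V (omega V) := by
  rw [← sub_eq_zero, zhuMk_commutator (Δ := 2) (by simpa using omega_mem), zhuMk_eq_zero]
  have : modeSum V (2 - 1) 0 (omega V) b = mode V (omega V) 0 b + mode V (omega V) 1 b := by
    have := modeSum_succ 0 0 (omega V) b
    rw [modeSum_zero, modeSum_zero] at this
    simpa using this
  rw [this]
  exact translation_add_mem b

end Functional

/-! ### Eigenspaces and subspaces -/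

section Eigen

variable {E : Type*} [AddCommGroup E] [Module ℂ E]

theorem mem_of_iSupIndep {ι κ : Type*} {W : ι → Submodule ℂ E} (hW : iSupIndep W)
    {X : κ → Submodule ℂ E} {g : κ → ι} (hg : Function.Injective g) (hX : ∀ j, X j ≤ W (g j))
    {j : κ} {x : E} (hx : x ∈ W (g j)) (hx' : x ∈ ⨆ j, X j) : x ∈ X j := by
  have h : ⨆ j, X j ≤ X j ⊔ ⨆ (i) (_ : i ≠ g j), W i := by
    refine iSup_le fun j' => ?_
    by_cases hj : j' = j
    · exact hj ▸ le_sup_left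
    · exact le_sup_of_le_right ((hX j').trans
        (le_iSup₂_of_le (g j') (fun e => hj (hg e)) le_rfl))
  obtain ⟨y, hy, z, hz, rfl⟩ := Submodule.mem_sup.1 (h hx')
  have hz0 : z = 0 := by
    refine Submodule.disjoint_def.1 (hW (g j)) z ?_ hz
    simpa using sub_mem hx (hX j hy)
  rwa [hz0, add_zero]

theorem eq_zero_of_iSupIndep {ι κ : Type*} {W : ι → Submodule ℂ E} (hW : iSupIndep W)
    {X : κ → Submodule ℂ E} {g : κ → ι} (hX : ∀ j, X j ≤ W (g j))
    {i : ι} (hi : ∀ j, g j ≠ i) {x : E} (hx : x ∈ W i) (hx' : x ∈ ⨆ j, X j) : x = 0 := by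
  refine Submodule.disjoint_def.1 (hW i) x hx ?_
  exact iSup_le (fun j => (hX j).trans (le_iSup₂_of_le (g j) (hi j) le_rfl)) hx'

/-- The components of a vector of an invariant subspace with respect to the eigenspaces of an
operator belong to the subspace. -/
theorem component_mem {f : Module.End ℂ E} {W : Submodule ℂ E} (hW : ∀ x ∈ W, f x ∈ W) {μ : ℂ}
    {y z : E} (hy : y ∈ f.eigenspace μ) (hz : z ∈ ⨆ (ν) (_ : ν ≠ μ), f.eigenspace ν)
    (h : y + z ∈ W) : y ∈ W := by
  let f' : Module.End ℂ (E ⧸ W) := W.mapQ W f hW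
  have hmap : ∀ ν, (f.eigenspace ν).map W.mkQ ≤ f'.eigenspace ν := by
    rintro ν _ ⟨x, hx, rfl⟩
    rw [Module.End.mem_eigenspace_iff]
    change W.mkQ (f x) = _
    rw [Module.End.mem_eigenspace_iff.1 hx, map_smul]
  have hz' : W.mkQ z ∈ ⨆ (ν) (_ : ν ≠ μ), f'.eigenspace ν := by
    have := Submodule.mem_map_of_mem (f := W.mkQ) hz
    simp only [Submodule.map_iSup] at this
    exact iSup₂_mono (fun ν _ => hmap ν) this
  have hy' : W.mkQ y ∈ f'.eigenspace μ := hmap μ ⟨y, hy, rfl⟩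
  have hyz : W.mkQ y + W.mkQ z = 0 := by
    rw [← map_add]
    exact (Submodule.Quotient.mk_eq_zero W).2 h
  have := Submodule.disjoint_def.1 (f'.eigenspaces_iSupIndep μ) (W.mkQ y) hy' (by
    rw [eq_neg_of_add_eq_zero_left hyz]
    exact neg_mem hz')
  exact (Submodule.Quotient.mk_eq_zero W).1 this

theorem mem_iSup_inf_eigenspace {f : Module.End ℂ E} {W : Submodule ℂ E}
    (hW : ∀ x ∈ W, f x ∈ W) {ι : Type*} {g : ι → ℂ} (hg : Function.Injective g) {x : E}
    (hx : x ∈ W) (hx' : x ∈ ⨆ i, f.eigenspace (g i)) : x ∈ ⨆ i, W ⊓ f.eigenspace (g i) := by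
  classical
  obtain ⟨m, hm, rfl⟩ := (Submodule.mem_iSup_iff_exists_finsupp _ _).1 hx'
  refine Submodule.sum_mem _ fun i hi => Submodule.mem_iSup_of_mem i ⟨?_, hm i⟩
  refine component_mem hW (z := ∑ j ∈ m.support.erase i, m j) (hm i) ?_ ?_
  · refine Submodule.sum_mem _ fun j hj => ?_
    exact Submodule.mem_iSup_of_mem (g j) (Submodule.mem_iSup_of_mem
      (fun e => Finset.ne_of_mem_erase hj (hg e)) (hm j))
  · rwa [Finset.add_sum_erase _ _ hi]

end Eigen

/-! ### The stable Zhu algebra -/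

section Charges

variable {V : Type u} [AddCommGroup V] [Module ℂ V] [ChargedConformalVertexAlgebra V]

variable (V) in
theorem iSup_chargeSpace : ⨆ c : ℤ, chargeSpace V V (c : ℂ) = ⊤ :=
  ChargedConformalVertexAlgebra.charges_integral

variable (V) in
theorem chargeSpace_bijective :
    Function.Bijective (DirectSum.coeLinearMap fun c : ℤ => chargeSpace V V (c : ℂ)) := by
  apply DirectSum.isInternal_submodule_of_iSupIndep_of_iSup_eq_top
  · exact (Module.End.eigenspaces_iSupIndep (mode V (chargeCurrent V) 0)).comp
      (f := fun c : ℤ => (c : ℂ)) Int.cast_injective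
  · exact iSup_chargeSpace V

theorem charge_induction {p : V → Prop}
    (h : ∀ (c : ℤ) (a : V), a ∈ chargeSpace V V (c : ℂ) → p a)
    (hadd : ∀ a b, p a → p b → p (a + b)) (a : V) : p a := by
  have ha : a ∈ ⨆ c : ℤ, chargeSpace V V (c : ℂ) := by rw [iSup_chargeSpace]; trivial
  exact Submodule.iSup_induction _ (motive := p) ha h (h 0 0 (zero_mem _)) hadd

theorem weight_induction {p : V → Prop}
    (h : ∀ (Δ c : ℤ) (a : V), a ∈ weightSpace V V (Δ : ℂ) (c : ℂ) → p a)
    (hadd : ∀ a b, p a → p b → p (a + b)) (a : V) : p a := by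
  refine energy_induction (fun Δ a ha => ?_) hadd a
  have := mem_iSup_inf_eigenspace (f := mode V (chargeCurrent V) 0)
    (W := energySpace V V (Δ : ℂ)) (fun x hx => charge_mem_energySpace hx)
    (g := fun c : ℤ => (c : ℂ)) Int.cast_injective ha (by
      have : ⨆ c : ℤ, chargeSpace V V (c : ℂ) = ⊤ := iSup_chargeSpace V
      change a ∈ ⨆ c : ℤ, chargeSpace V V (c : ℂ)
      rw [this]
      trivial)
  exact Submodule.iSup_induction _ (motive := p) this (fun c a ha => h Δ c a ha)
    (h 0 0 0 (zero_mem _)) hadd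

/-- The projection `V → V^(0)`. -/
def chargeZeroPart : V →ₗ[ℂ] chargeSpace V V ((0 : ℤ) : ℂ) :=
  (DirectSum.component ℂ ℤ (fun c : ℤ => chargeSpace V V (c : ℂ)) 0).comp
    (LinearEquiv.ofBijective (DirectSum.coeLinearMap fun c : ℤ => chargeSpace V V (c : ℂ))
      (chargeSpace_bijective V)).symm.toLinearMap

theorem chargeZeroPart_eq {c : ℤ} {a : V} (ha : a ∈ chargeSpace V V (c : ℂ)) :
    (chargeZeroPart a : V) = if c = 0 then a else 0 := by
  have : (LinearEquiv.ofBijective (DirectSum.coeLinearMap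
      fun c : ℤ => chargeSpace V V (c : ℂ)) (chargeSpace_bijective V)).symm a =
      DirectSum.lof ℂ ℤ (fun c : ℤ => chargeSpace V V (c : ℂ)) c ⟨a, ha⟩ := by
    rw [LinearEquiv.symm_apply_eq]
    simp
  rw [chargeZeroPart, LinearMap.comp_apply, LinearEquiv.coe_coe, this]
  split_ifs with h
  · subst h
    rw [DirectSum.component.lof_self]
  · rw [DirectSum.component.of, dif_neg h]
    rfl

theorem zhuProd_mem_chargeSpace {c d : ℤ} {a b : V} (s : ℤ) (ha : a ∈ chargeSpace V V (c : ℂ))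
    (hb : b ∈ chargeSpace V V (d : ℂ)) : zhuProd s a b ∈ chargeSpace V V ((c + d : ℤ) : ℂ) := by
  rw [mem_chargeSpace] at *
  rw [zhuProd_derivation, ha, hb, map_smul, map_smul, LinearMap.smul_apply]
  push_cast
  module

theorem vacuum_mem_chargeSpace : vacuum V ∈ chargeSpace V V ((0 : ℤ) : ℂ) := by
  rw [mem_chargeSpace, mode_apply_vacuum_nonneg _ _ le_rfl]
  simp

variable (V) in
/-- The linear map `V → A(V)^(0) → A^stab(V)` that vanishes on vectors of nonzero charge. -/
def stableClass : V →ₗ[ℂ] StableZhuAlgebra V :=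
  (Ideal.Quotient.mkₐ ℂ (stableIdeal V)).toLinearMap ∘ₗ
    ((zhuMk V ∘ₗ (chargeSpace V V ((0 : ℤ) : ℂ)).subtype).codRestrict
      (Subalgebra.toSubmodule (zhuZero V)) fun a => ⟨a, a.2, rfl⟩) ∘ₗ chargeZeroPart

theorem stableClass_of_charge_zero {a : V} (ha : a ∈ chargeSpace V V ((0 : ℤ) : ℂ)) :
    stableClass V a = Ideal.Quotient.mk (stableIdeal V) ⟨zhuMk V a, a, ha, rfl⟩ := by
  have h := chargeZeroPart_eq ha
  rw [if_pos rfl] at h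
  change Ideal.Quotient.mk (stableIdeal V) ⟨zhuMk V (chargeZeroPart a : V), _⟩ = _
  congr 2
  rw [h]

theorem stableClass_of_charge_ne_zero {c : ℤ} (hc : c ≠ 0) {a : V}
    (ha : a ∈ chargeSpace V V (c : ℂ)) : stableClass V a = 0 := by
  have h : chargeZeroPart a = 0 := Subtype.ext ((chargeZeroPart_eq ha).trans (if_neg hc))
  rw [stableClass, LinearMap.comp_apply, LinearMap.comp_apply, h, map_zero, map_zero]

theorem stableClass_vacuum : stableClass V (vacuum V) = 1 := by
  rw [stableClass_of_charge_zero vacuum_mem_chargeSpace]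
  rfl

/-- The Zhu ideal is graded by charge. -/
theorem stableClass_zhuIdeal {x : V} (hx : x ∈ zhuIdeal V) : stableClass V x = 0 := by
  induction hx using Submodule.span_induction with
  | zero => simp
  | add u v _ _ hu hv => simp [hu, hv]
  | smul r u _ hu => simp [hu]
  | mem u hu =>
    obtain ⟨a, b, rfl⟩ := hu
    refine charge_induction (p := fun a => stableClass V (zhuProd (-2) a b) = 0)
      (fun c a ha => ?_) (fun a a' h h' => by simp [h, h']) a
    refine charge_induction (p := fun b => stableClass V (zhuProd (-2) a b) = 0)
      (fun d b hb => ?_) (fun b b' h h' => by simp [h, h']) b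
    have h := zhuProd_mem_chargeSpace (-2) ha hb
    by_cases hcd : c + d = 0
    · rw [hcd] at h
      rw [stableClass_of_charge_zero h, Ideal.Quotient.eq_zero_iff_mem]
      have : (⟨zhuMk V (zhuProd (-2) a b), _, h, rfl⟩ : zhuZero V) = 0 :=
        Subtype.ext (zhuMk_eq_zero.2 (zhuProd_mem' _ le_rfl _ _))
      rw [this]
      exact zero_mem _
    · exact stableClass_of_charge_ne_zero hcd h

theorem stableClass_congr {a b : V} (h : zhuMk V a = zhuMk V b) :
    stableClass V a = stableClass V b := by
  rw [← sub_eq_zero, ← map_sub]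
  exact stableClass_zhuIdeal (zhuMk_eq_zero.1 (by rw [map_sub, h, sub_self]))

theorem stableClass_mul {a : V} (ha : zhuMk V a ∈ zhuZero V) (b : V) :
    stableClass V (zhuProd (-1) b a) = stableClass V b * stableClass V a := by
  have ha' := ha
  obtain ⟨a', ha', h⟩ := ha'
  refine charge_induction (p := fun b => stableClass V (zhuProd (-1) b a) =
    stableClass V b * stableClass V a) (fun c b hb => ?_)
    (fun b b' h h' => by simp only [map_add, LinearMap.add_apply, h, h', add_mul]) b
  have h1 : zhuMk V (zhuProd (-1) b a) = zhuMk V (zhuProd (-1) b a') := by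
    rw [← zhuMk_mul, ← zhuMk_mul, h]
  have h2 := zhuProd_mem_chargeSpace (-1) hb ha'
  rw [add_zero] at h2
  rw [stableClass_congr h1, ← stableClass_congr h]
  by_cases hc : c = 0
  · subst hc
    rw [stableClass_of_charge_zero h2, stableClass_of_charge_zero hb,
      stableClass_of_charge_zero ha', ← map_mul]
    rfl
  · rw [stableClass_of_charge_ne_zero hc h2, stableClass_of_charge_ne_zero hc hb, zero_mul]

theorem stableClass_mul_of_pos {c : ℤ} (hc : 0 < c) {a : V} (ha : a ∈ chargeSpace V V (c : ℂ))
    (b : V) : stableClass V (zhuProd (-1) b a) = 0 := by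
  refine charge_induction (p := fun b => stableClass V (zhuProd (-1) b a) = 0)
    (fun d b hb => ?_) (fun b b' h h' => by simp [h, h']) b
  have h := zhuProd_mem_chargeSpace (-1) hb ha
  by_cases hcd : d + c = 0
  · rw [hcd] at h
    rw [stableClass_of_charge_zero h, Ideal.Quotient.eq_zero_iff_mem]
    change zhuMk V b * zhuMk V a ∈ zhuPositive V
    exact Ideal.mul_mem_left _ _ (Ideal.subset_span ⟨c, hc, a, ha, rfl⟩)
  · exact stableClass_of_charge_ne_zero hcd h

theorem stableClass_surjective (y : StableZhuAlgebra V) :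
    ∃ a ∈ chargeSpace V V ((0 : ℤ) : ℂ), stableClass V a = y := by
  obtain ⟨⟨_, a, ha, rfl⟩, rfl⟩ := Ideal.Quotient.mk_surjective y
  exact ⟨a, ha, stableClass_of_charge_zero ha⟩

/-- The commutator formula on the vacuum gives `h_(0) h = -h_(0) h`. -/
theorem current_mem_chargeSpace : chargeCurrent V ∈ chargeSpace V V ((0 : ℤ) : ℂ) := by
  have h := mode_commutator (chargeCurrent V) (chargeCurrent V) (-1) 0 (vacuum V)
  rw [mode_apply_vacuum_nonneg _ 0 le_rfl, map_zero, mode_apply_vacuum,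
    finsum_eq_sum_range _ 2 fun j hj => by
      rw [ChargedConformalVertexAlgebra.current_mode _ (by lia), mode_zero, LinearMap.zero_apply,
        smul_zero] ] at h
  have h1 : mode V (mode V (chargeCurrent V) 1 (chargeCurrent V)) (-2) (vacuum V) = 0 := by
    rw [ChargedConformalVertexAlgebra.current_mode_one, mode_smul, LinearMap.smul_apply,
      mode_vacuum, if_neg (by norm_num), smul_zero]
  simp only [Finset.sum_range_succ, Finset.sum_range_zero, zero_add, intBinom,
    Ring.choose_zero_right, Ring.choose_one_right, Nat.cast_zero, Nat.cast_one, one_smul,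
    add_zero, sub_zero, show (-1 : ℤ) - 1 = -2 by norm_num, h1, smul_zero, mode_apply_vacuum] at h
  rw [mem_chargeSpace, Int.cast_zero, zero_smul]
  generalize mode V (chargeCurrent V) 0 (chargeCurrent V) = x at h
  have h2 : (2 : ℂ) • x = 0 := by
    rw [two_smul]
    nth_rewrite 1 [← h]
    simp
  simpa using h2

theorem current_mode_mem_zhuIdeal {x : V} (hx : x ∈ zhuIdeal V) :
    mode V (chargeCurrent V) 0 x ∈ zhuIdeal V := by
  induction hx using Submodule.span_induction with
  | zero => simp
  | add u v _ _ hu hv => simpa using add_mem hu hv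
  | smul r u _ hu => simpa using Submodule.smul_mem _ r hu
  | mem u hu =>
    obtain ⟨a, b, rfl⟩ := hu
    rw [zhuProd_derivation]
    exact add_mem (zhuProd_mem' _ le_rfl _ _) (zhuProd_mem' _ le_rfl _ _)

theorem zhuMk_current_commutator (b : V) :
    zhuMk V (chargeCurrent V) * zhuMk V b - zhuMk V b * zhuMk V (chargeCurrent V) =
      zhuMk V (mode V (chargeCurrent V) 0 b) := by
  rw [zhuMk_commutator (Δ := 1) (by simpa using current_mem (V := V)), sub_self, modeSum_zero]

/-- If `h_(0) a` vanishes in `A(V)`, then so do the components of `a` of nonzero charge. -/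
theorem mem_zhuZero_of_current {a : V} (ha : mode V (chargeCurrent V) 0 a ∈ zhuIdeal V) :
    zhuMk V a ∈ zhuZero V := by
  classical
  have h : a ∈ ⨆ c : ℤ, chargeSpace V V (c : ℂ) := by rw [iSup_chargeSpace]; trivial
  obtain ⟨m, hm, rfl⟩ := (Submodule.mem_iSup_iff_exists_finsupp _ _).1 h
  have key : ∀ c ∈ m.support, c ≠ 0 → m c ∈ zhuIdeal V := by
    intro c hc hc0
    have h1 : mode V (chargeCurrent V) 0 (m c) = (c : ℂ) • m c := mem_chargeSpace.1 (hm c)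
    have h2 : mode V (chargeCurrent V) 0 (m c) +
        ∑ d ∈ m.support.erase c, mode V (chargeCurrent V) 0 (m d) ∈ zhuIdeal V := by
      rw [Finset.add_sum_erase _ (fun d => mode V (chargeCurrent V) 0 (m d)) hc, ← map_sum]
      exact ha
    have := component_mem (f := mode V (chargeCurrent V) 0) (μ := c)
      (fun x hx => current_mode_mem_zhuIdeal hx) ?_ ?_ h2
    · rw [h1] at this
      exact (Submodule.smul_mem_iff _ (by exact_mod_cast hc0)).1 this
    · rw [h1]
      exact Submodule.smul_mem _ _ (hm c)
    · refine Submodule.sum_mem _ fun d hd => Submodule.mem_iSup_of_mem (d : ℂ)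
        (Submodule.mem_iSup_of_mem ?_ ?_)
      · exact_mod_cast Finset.ne_of_mem_erase hd
      · have : mode V (chargeCurrent V) 0 (m d) = (d : ℂ) • m d := mem_chargeSpace.1 (hm d)
        rw [this]
        exact Submodule.smul_mem _ _ (hm d)
  change zhuMk V (∑ c ∈ m.support, m c) ∈ zhuZero V
  rw [map_sum]
  refine sum_mem fun c hc => ?_
  by_cases hc0 : c = 0
  · exact ⟨m c, by simpa [hc0] using hm 0, rfl⟩
  · rw [zhuMk_eq_zero.2 (key c hc hc0)]
    exact zero_mem _

/-- The class of `ω` has charge zero, since it commutes with the class of the current. -/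
theorem omega_mem_zhuZero : zhuMk V (omega V) ∈ zhuZero V := by
  refine mem_zhuZero_of_current (zhuMk_eq_zero.1 ?_)
  rw [← zhuMk_current_commutator, ← zhuMk_omega_mul, sub_self]

theorem current_mem_zhuZero : zhuMk V (chargeCurrent V) ∈ zhuZero V :=
  ⟨_, current_mem_chargeSpace, rfl⟩

theorem stableClass_mul_comm_of_commute {a : V} (ha : zhuMk V a ∈ zhuZero V)
    (h : ∀ b ∈ chargeSpace V V ((0 : ℤ) : ℂ), zhuMk V a * zhuMk V b = zhuMk V b * zhuMk V a)
    (y : StableZhuAlgebra V) : stableClass V a * y = y * stableClass V a := by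
  obtain ⟨b, hb, rfl⟩ := stableClass_surjective y
  rw [← stableClass_mul ha, ← stableClass_mul ⟨b, hb, rfl⟩]
  exact stableClass_congr (by rw [← zhuMk_mul, ← zhuMk_mul, h b hb])

theorem stableClass_omega_mul (y : StableZhuAlgebra V) :
    stableClass V (omega V) * y = y * stableClass V (omega V) :=
  stableClass_mul_comm_of_commute omega_mem_zhuZero (fun b _ => zhuMk_omega_mul b) y

theorem stableClass_current_mul (y : StableZhuAlgebra V) :
    stableClass V (chargeCurrent V) * y = y * stableClass V (chargeCurrent V) :=
  stableClass_mul_comm_of_commute current_mem_zhuZero (fun b hb => by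
    rw [← sub_eq_zero, zhuMk_current_commutator, mem_chargeSpace.1 hb]
    simp) y

end Charges

/-! ### Functionals on the stable Zhu algebra -/

section Peak

variable {V : Type u} [AddCommGroup V] [Module ℂ V] [ChargedConformalVertexAlgebra V]
    {P : Type v} [AddCommGroup P] [Module ℂ P] [Module (StableZhuAlgebra V) P]
    [IsScalarTower ℂ (StableZhuAlgebra V) P]

/-- Schur's lemma. -/
theorem exists_eq_smul_of_central [IsSimpleModule (StableZhuAlgebra V) P] [FiniteDimensional ℂ P]
    {z : StableZhuAlgebra V} (hz : ∀ y, z * y = y * z) : ∃ μ : ℂ, ∀ p : P, z • p = μ • p := by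
  have : Nontrivial P := IsSimpleModule.nontrivial (StableZhuAlgebra V) P
  have : SMulCommClass ℂ (StableZhuAlgebra V) P := IsScalarTower.to_smulCommClass
  let f : Module.End ℂ P :=
    { toFun := fun p => z • p
      map_add' := smul_add z
      map_smul' := fun r p => smul_comm z r p }
  obtain ⟨μ, hμ⟩ := Module.End.exists_eigenvalue f
  let W : Submodule (StableZhuAlgebra V) P :=
    { carrier := {p | z • p = μ • p}
      add_mem' := fun {p q} hp hq => by
        simp only [Set.mem_ofPred_eq] at *
        rw [smul_add, smul_add, hp, hq]
      zero_mem' := by simp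
      smul_mem' := fun y p hp => by
        simp only [Set.mem_ofPred_eq] at *
        rw [← mul_smul, hz, mul_smul, hp, smul_comm] }
  obtain ⟨p, hp, hp0⟩ := hμ.exists_hasEigenvector
  have hW : W = ⊤ := (eq_bot_or_eq_top W).resolve_left fun h => hp0 (by
    have : p ∈ W := Module.End.mem_eigenspace_iff.1 hp
    rw [h] at this
    exact this)
  exact ⟨μ, fun p => by
    have : p ∈ W := by rw [hW]; trivial
    exact this⟩

variable (V P) in
/-- The functional `b ↦ [b] p` on `V`, for `p ∈ P`, which vanishes on vectors of nonzero charge. -/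
def peakFunctional : P →ₗ[ℂ] regularDual V P where
  toFun p := ⟨(LinearMap.toSpanSingleton (StableZhuAlgebra V) P p).restrictScalars ℂ ∘ₗ
    stableClass V, mem_regularDual_of_zhuIdeal fun x hx => by
      simp [stableClass_zhuIdeal hx]⟩
  map_add' p q := by
    refine Subtype.ext (LinearMap.ext fun b => ?_)
    simp
  map_smul' r p := by
    refine Subtype.ext (LinearMap.ext fun b => ?_)
    have : SMulCommClass ℂ (StableZhuAlgebra V) P := IsScalarTower.to_smulCommClass
    exact (smul_comm r (stableClass V b) p).symm

theorem peakFunctional_apply (p : P) (b : V) :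
    (peakFunctional V P p).1 b = stableClass V b • p := rfl

theorem isTopVector_peakFunctional (p : P) : IsTopVector V (peakFunctional V P p) :=
  isTopVector_of_zhuIdeal (f := (peakFunctional V P p).1) fun x hx => by
    rw [peakFunctional_apply, stableClass_zhuIdeal hx, zero_smul]

theorem zeroMode_peakFunctional {a : V} (ha : zhuMk V a ∈ zhuZero V) (p : P) :
    zeroMode (regularDual V P) a (peakFunctional V P p) =
      peakFunctional V P (stableClass V a • p) := by
  refine Subtype.ext (LinearMap.ext fun b => ?_)
  rw [(isTopVector_peakFunctional p).zeroMode_regularDual, peakFunctional_apply,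
    peakFunctional_apply, stableClass_mul ha, mul_smul]

theorem zeroMode_peakFunctional_of_pos {c : ℤ} (hc : 0 < c) {a : V}
    (ha : a ∈ chargeSpace V V (c : ℂ)) (p : P) :
    zeroMode (regularDual V P) a (peakFunctional V P p) = 0 := by
  refine Subtype.ext (LinearMap.ext fun b => ?_)
  rw [(isTopVector_peakFunctional p).zeroMode_regularDual, peakFunctional_apply,
    stableClass_mul_of_pos hc ha, zero_smul]
  rfl

variable (V P) in
/-- The classes of `ω` and of the current are central in the stable Zhu algebra, hence they act on
`P` by scalars. -/
theorem exists_weight_peakFunctional [IsSimpleModule (StableZhuAlgebra V) P]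
    [FiniteDimensional ℂ P] : ∃ Δ k : ℂ, ∀ p : P,
      peakFunctional V P p ∈ weightSpace V (regularDual V P) Δ k := by
  obtain ⟨Δ, hΔ⟩ := exists_eq_smul_of_central (P := P) (stableClass_omega_mul (V := V))
  obtain ⟨k, hk⟩ := exists_eq_smul_of_central (P := P) (stableClass_current_mul (V := V))
  refine ⟨Δ, k, fun p => ⟨mem_energySpace.2 ?_, mem_chargeSpace.2 ?_⟩⟩
  · have := zeroMode_peakFunctional (omega_mem_zhuZero (V := V)) p
    rw [zeroMode_apply (Δ := 2) (by simpa using omega_mem (V := V)), hΔ, map_smul] at this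
    simpa using this
  · have := zeroMode_peakFunctional (current_mem_zhuZero (V := V)) p
    rw [zeroMode_apply (Δ := 1) (by simpa using current_mem (V := V)), hk, map_smul] at this
    simpa using this

end Peak

/-! ### Modules generated by their peak space -/

section PeakGenerated

variable {V : Type*} {M : Type*} {P : Type*} [AddCommGroup V] [Module ℂ V]
    [ChargedConformalVertexAlgebra V] [AddCommGroup M] [Module ℂ M] [VertexModule V M]
    [AddCommGroup P] [Module ℂ P]

theorem shiftMode_derivation (d : ℤ) (a : V) (x : M) :
    mode M (chargeCurrent V) 0 (shiftMode M d a x) =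
      shiftMode M d (mode V (chargeCurrent V) 0 a) x +
        shiftMode M d a (mode M (chargeCurrent V) 0 x) := by
  refine energy_induction (p := fun a => mode M (chargeCurrent V) 0 (shiftMode M d a x) =
      shiftMode M d (mode V (chargeCurrent V) 0 a) x +
        shiftMode M d a (mode M (chargeCurrent V) 0 x))
    (fun Δ a ha => ?_) (fun a a' h h' => ?_) a
  · rw [shiftMode_apply _ ha, shiftMode_apply _ (charge_mem_energySpace ha), mode_derivation]
  · simp only [map_add, LinearMap.add_apply, h, h']
    abel

theorem shiftMode_mem_chargeSpace (d : ℤ) {c k Θ : ℂ} {a : V} {x : M} (ha : a ∈ chargeSpace V V c)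
    (hx : x ∈ chargeSpace V M k) (hΘ : Θ = k + c) : shiftMode M d a x ∈ chargeSpace V M Θ := by
  rw [mem_chargeSpace] at *
  rw [shiftMode_derivation, ha, hx, map_smul, map_smul, LinearMap.smul_apply, hΘ]
  module

variable (V) in
/-- The module `M` is generated by the image of `F`, which consists of vectors of weight `(Δ₀, k₀)`
that are annihilated by the modes that lower energies and by the zero modes of positive charge, and
on which the zero modes of charge zero act through the stable Zhu algebra. Moreover `ε` is a left
inverse of `F` that vanishes on all other weight spaces, but on no nonzero submodule; hence every
nonzero submodule meets the image of `F`. -/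
structure IsPeakGenerated [Module (StableZhuAlgebra V) P] (F : P →ₗ[ℂ] M) (ε : M →ₗ[ℂ] P)
    (Δ₀ k₀ : ℂ) : Prop where
  eq_top : ∀ W : Submodule ℂ M, (∀ (a : V) (n : ℤ) (p : P), mode M a n (F p) ∈ W) → W = ⊤
  top : ∀ p, IsTopVector V (F p)
  mem : ∀ p, F p ∈ weightSpace V M Δ₀ k₀
  zeroMode : ∀ a : V, zhuMk V a ∈ zhuZero V → ∀ p,
    zeroMode M a (F p) = F (stableClass V a • p)
  zeroMode_of_pos : ∀ c : ℤ, 0 < c → ∀ a ∈ chargeSpace V V (c : ℂ), ∀ p,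
    _root_.zeroMode M a (F p) = 0
  exists_ne_zero : ∀ x : M, x ≠ 0 → ∃ (a : V) (n : ℤ), ε (mode M a n x) ≠ 0
  ε_zeroMode : ∀ (a : V) (p : P), ε (_root_.zeroMode M a (F p)) = stableClass V a • p
  ε_mode : ∀ (Δ : ℤ) (a : V), a ∈ energySpace V V (Δ : ℂ) → ∀ n ≤ Δ - 2, ∀ x : M,
    ε (mode M a n x) = 0

variable (V) in
/-- The span of the vectors `a_(Δ - 1 - d) F(p)` for `a ∈ V_Δ` of charge `c`. -/
def gradedPiece (F : P →ₗ[ℂ] M) (d c : ℤ) : Submodule ℂ M :=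
  Submodule.map₂ (shiftMode M d) (chargeSpace V V (c : ℂ)) (LinearMap.range F)

theorem zeroMode_vacuum_apply (x : M) : zeroMode M (vacuum V) x = x := by
  rw [← shiftMode_zero, shiftMode_vacuum, if_pos rfl]

theorem iSup_gradedPiece_eq_map₂ (F : P →ₗ[ℂ] M) (d : ℤ) : ⨆ c, gradedPiece V F d c =
    Submodule.map₂ (shiftMode (V := V) M d) ⊤ (LinearMap.range F) := by
  rw [← iSup_chargeSpace V, Submodule.map₂_iSup_left]
  rfl

theorem shiftMode_mem_iSup (F : P →ₗ[ℂ] M) (d : ℤ) (a : V) (p : P) :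
    shiftMode M d a (F p) ∈ ⨆ c, gradedPiece V F d c := by
  rw [iSup_gradedPiece_eq_map₂]
  exact Submodule.apply_mem_map₂ _ trivial ⟨p, rfl⟩

theorem injective_add_intCast (z : ℂ) : Function.Injective fun d : ℤ => z + d :=
  fun _ _ e => by simpa using e

theorem iSup_eq_sup_iSup_ne {ι : Type*} (X : ι → Submodule ℂ M) (i : ι) :
    ⨆ j, X j = X i ⊔ ⨆ (j) (_ : j ≠ i), X j := by
  refine le_antisymm (iSup_le fun j => ?_) (sup_le (le_iSup X i) (iSup₂_le fun j _ => le_iSup X j))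
  by_cases hj : j = i
  · exact hj ▸ le_sup_left
  · exact le_sup_of_le_right (le_iSup₂_of_le j hj le_rfl)

namespace IsPeakGenerated

variable [Module (StableZhuAlgebra V) P] {F : P →ₗ[ℂ] M} {ε : M →ₗ[ℂ] P}
    {Δ₀ k₀ : ℂ}

theorem ε_apply (h : IsPeakGenerated V F ε Δ₀ k₀) (p : P) : ε (F p) = p := by
  rw [← zeroMode_vacuum_apply (V := V) (F p), h.ε_zeroMode, stableClass_vacuum, one_smul]

theorem injective (h : IsPeakGenerated V F ε Δ₀ k₀) : Function.Injective F :=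
  Function.LeftInverse.injective h.ε_apply

theorem gradedPiece_le (h : IsPeakGenerated V F ε Δ₀ k₀) (d c : ℤ) :
    gradedPiece V F d c ≤ weightSpace V M (Δ₀ + d) (k₀ + c) := by
  rw [gradedPiece, Submodule.map₂_le]
  rintro a ha _ ⟨p, rfl⟩
  exact ⟨shiftMode_mem_energySpace d a (h.mem p).1 rfl,
    shiftMode_mem_chargeSpace d ha (h.mem p).2 rfl⟩

theorem iSup_gradedPiece (h : IsPeakGenerated V F ε Δ₀ k₀) : ⨆ d, ⨆ c, gradedPiece V F d c = ⊤ := by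
  refine h.eq_top _ fun a n p => ?_
  refine energy_induction (p := fun a => mode M a n (F p) ∈ ⨆ d, ⨆ c, gradedPiece V F d c)
    (fun Δ a ha => ?_) (fun a a' h1 h2 => ?_) a
  · rw [mode_eq_shiftMode ha]
    exact Submodule.mem_iSup_of_mem _ (shiftMode_mem_iSup F _ _ _)
  · rw [mode_add]
    exact add_mem h1 h2

theorem iSup_gradedPiece_le (h : IsPeakGenerated V F ε Δ₀ k₀) (d : ℤ) :
    ⨆ c, gradedPiece V F d c ≤ energySpace V M (Δ₀ + d) :=
  iSup_le fun c => (h.gradedPiece_le d c).trans inf_le_left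

theorem energySpace_eq (h : IsPeakGenerated V F ε Δ₀ k₀) (d : ℤ) :
    energySpace V M (Δ₀ + d) = ⨆ c, gradedPiece V F d c := by
  refine le_antisymm (fun x hx => ?_) (h.iSup_gradedPiece_le d)
  refine mem_of_iSupIndep (W := Module.End.eigenspace (mode M (omega V) 1))
    (Module.End.eigenspaces_iSupIndep (mode M (omega V) 1)) (X := fun d => ⨆ c, gradedPiece V F d c)
    (g := fun d : ℤ => Δ₀ + d) (injective_add_intCast Δ₀) h.iSup_gradedPiece_le hx ?_
  rw [h.iSup_gradedPiece]
  trivial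

theorem exists_energy (h : IsPeakGenerated V F ε Δ₀ k₀) {Δ : ℂ} {x : M}
    (hx : x ∈ energySpace V M Δ) (hx0 : x ≠ 0) :
    ∃ d : ℤ, Δ₀ + d = Δ := by
  by_contra! hd
  refine hx0 (eq_zero_of_iSupIndep (W := Module.End.eigenspace (mode M (omega V) 1))
    (Module.End.eigenspaces_iSupIndep (mode M (omega V) 1)) (X := fun d => ⨆ c, gradedPiece V F d c)
    (g := fun d : ℤ => Δ₀ + d) h.iSup_gradedPiece_le hd hx ?_)
  rw [h.iSup_gradedPiece]
  trivial

theorem gradedPiece_le_chargeSpace (h : IsPeakGenerated V F ε Δ₀ k₀) (d c : ℤ) :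
    gradedPiece V F d c ≤ chargeSpace V M (k₀ + c) :=
  (h.gradedPiece_le d c).trans inf_le_right

theorem weightSpace_eq (h : IsPeakGenerated V F ε Δ₀ k₀) (d c : ℤ) :
    weightSpace V M (Δ₀ + d) (k₀ + c) = gradedPiece V F d c := by
  refine le_antisymm (fun x hx => ?_) (h.gradedPiece_le d c)
  refine mem_of_iSupIndep (W := Module.End.eigenspace (mode M (chargeCurrent V) 0))
    (Module.End.eigenspaces_iSupIndep (mode M (chargeCurrent V) 0)) (X := gradedPiece V F d)
    (g := fun d : ℤ => k₀ + d) (injective_add_intCast k₀) (h.gradedPiece_le_chargeSpace d) hx.2 ?_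
  rw [← h.energySpace_eq]
  exact hx.1

theorem exists_weight (h : IsPeakGenerated V F ε Δ₀ k₀) {Δ k : ℂ} {x : M}
    (hx : x ∈ weightSpace V M Δ k) (hx0 : x ≠ 0) :
    ∃ d c : ℤ, Δ₀ + d = Δ ∧ k₀ + c = k := by
  obtain ⟨d, rfl⟩ := h.exists_energy hx.1 hx0
  refine ⟨d, ?_⟩
  by_contra! hd
  refine hx0 (eq_zero_of_iSupIndep (W := Module.End.eigenspace (mode M (chargeCurrent V) 0))
    (Module.End.eigenspaces_iSupIndep (mode M (chargeCurrent V) 0)) (X := gradedPiece V F d)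
    (g := fun d : ℤ => k₀ + d) (h.gradedPiece_le_chargeSpace d) (fun c => hd c rfl) hx.2 ?_)
  rw [← h.energySpace_eq]
  exact hx.1

theorem gradedPiece_of_neg (h : IsPeakGenerated V F ε Δ₀ k₀) {d : ℤ} (hd : d < 0) (c : ℤ) :
    gradedPiece V F d c = ⊥ := by
  rw [gradedPiece, eq_bot_iff, Submodule.map₂_le]
  rintro a ha _ ⟨p, rfl⟩
  rw [(h.top p).shiftMode_eq_zero hd]
  exact zero_mem _

theorem gradedPiece_zero_of_pos (h : IsPeakGenerated V F ε Δ₀ k₀) {c : ℤ} (hc : 0 < c) :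
    gradedPiece V F 0 c = ⊥ := by
  rw [gradedPiece, eq_bot_iff, Submodule.map₂_le]
  rintro a ha _ ⟨p, rfl⟩
  rw [shiftMode_zero, h.zeroMode_of_pos c hc a ha]
  exact zero_mem _

theorem gradedPiece_zero_zero (h : IsPeakGenerated V F ε Δ₀ k₀) :
    gradedPiece V F 0 0 = LinearMap.range F := by
  refine le_antisymm ?_ ?_
  · rw [gradedPiece, Submodule.map₂_le]
    rintro a ha _ ⟨p, rfl⟩
    rw [shiftMode_zero, h.zeroMode a ⟨a, ha, rfl⟩]
    exact ⟨_, rfl⟩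
  · rintro _ ⟨p, rfl⟩
    rw [← zeroMode_vacuum_apply (V := V) (F p), ← shiftMode_zero]
    exact Submodule.apply_mem_map₂ _ vacuum_mem_chargeSpace ⟨p, rfl⟩

theorem weightSpace_peak (h : IsPeakGenerated V F ε Δ₀ k₀) :
    weightSpace V M Δ₀ k₀ = LinearMap.range F := by
  rw [← h.gradedPiece_zero_zero, ← h.weightSpace_eq]
  simp

theorem eq_zero_of_energy_neg (h : IsPeakGenerated V F ε Δ₀ k₀) {d : ℤ} (hd : d < 0) {x : M}
    (hx : x ∈ energySpace V M (Δ₀ + d)) :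
    x = 0 := by
  rw [h.energySpace_eq, iSup_congr (h.gradedPiece_of_neg hd), iSup_bot] at hx
  exact hx

open scoped ComplexOrder in
theorem isPeakWeight (h : IsPeakGenerated V F ε Δ₀ k₀) [Nontrivial P] : IsPeakWeight V M Δ₀ k₀ := by
  obtain ⟨p, hp⟩ := exists_ne (0 : P)
  have hF : F p ≠ 0 := fun e => hp (h.injective (by rw [e, map_zero]))
  refine ⟨⟨fun hbot => hF ?_, fun Δ hΔ => ?_⟩, ⟨fun hbot => hF ?_, fun k hk => ?_⟩⟩
  · have := (h.mem p).1
    rw [hbot] at this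
    exact this
  · obtain ⟨x, hx, hx0⟩ := Submodule.exists_mem_ne_zero_of_ne_bot hΔ
    obtain ⟨d, rfl⟩ := h.exists_energy hx hx0
    have hd : 0 ≤ d := by
      by_contra! hd
      exact hx0 (h.eq_zero_of_energy_neg hd hx)
    rw [le_add_iff_nonneg_right]
    exact_mod_cast hd
  · have := h.mem p
    rw [hbot] at this
    exact this
  · obtain ⟨x, hx, hx0⟩ := Submodule.exists_mem_ne_zero_of_ne_bot hk
    obtain ⟨d, c, hd, rfl⟩ := h.exists_weight hx hx0
    have hd0 : d = 0 := by simpa using hd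
    subst hd0
    have hc : c ≤ 0 := by
      by_contra! hc
      rw [← hd, h.weightSpace_eq, h.gradedPiece_zero_of_pos hc] at hx
      exact hx0 hx
    rw [add_le_iff_nonpos_right]
    exact_mod_cast hc

/-- The map `F`, with values in the peak space. -/
def peakMap (h : IsPeakGenerated V F ε Δ₀ k₀) (hp : IsPeakWeight V M Δ₀ k₀) :
    P →ₗ[StableZhuAlgebra V] PeakSpace hp where
  toFun p := (⟨F p, h.mem p⟩ : weightSpace V M Δ₀ k₀)
  map_add' p q := Subtype.ext (F.map_add p q)
  map_smul' y p := by
    obtain ⟨⟨_, a, ha, rfl⟩, rfl⟩ := Ideal.Quotient.mk_surjective y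
    refine Subtype.ext ?_
    have := h.zeroMode a ⟨a, ha, rfl⟩ p
    rw [stableClass_of_charge_zero ha] at this
    exact this.symm

theorem peakMap_bijective (h : IsPeakGenerated V F ε Δ₀ k₀) (hp : IsPeakWeight V M Δ₀ k₀) :
    Function.Bijective (h.peakMap hp) := by
  refine ⟨fun _ _ e => h.injective (congrArg Subtype.val e), fun x => ?_⟩
  have hx : x.1 ∈ weightSpace V M Δ₀ k₀ := x.2
  obtain ⟨p, hp⟩ := h.weightSpace_peak.le hx
  exact ⟨p, Subtype.ext hp⟩

theorem ε_of_energy_ne (h : IsPeakGenerated V F ε Δ₀ k₀) {x : M}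
    (hx : x ∈ ⨆ (Δ) (_ : Δ ≠ Δ₀), energySpace V M Δ) : ε x = 0 := by
  have : ⨆ (Δ) (_ : Δ ≠ Δ₀), energySpace V M Δ ≤ LinearMap.ker ε := by
    refine iSup₂_le fun Δ hΔ y hy => ?_
    by_cases hy0 : y = 0
    · rw [hy0]
      exact zero_mem _
    obtain ⟨d, rfl⟩ := h.exists_energy hy hy0
    have hd : d ≠ 0 := fun e => hΔ (by simp [e])
    rcases lt_or_gt_of_ne hd with hd | hd
    · exact absurd (h.eq_zero_of_energy_neg hd hy) hy0
    · rw [h.energySpace_eq, iSup_gradedPiece_eq_map₂] at hy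
      refine Submodule.map₂_le.2 ?_ hy
      rintro a - _ ⟨p, rfl⟩
      rw [LinearMap.mem_ker]
      refine energy_induction (p := fun a => ε (shiftMode M d a (F p)) = 0) (fun Θ a ha => ?_)
        (fun a a' h1 h2 => by simp [h1, h2]) a
      rw [shiftMode_apply _ ha]
      exact h.ε_mode Θ a ha _ (by lia) _
  exact this hx

theorem ε_of_charge_ne (h : IsPeakGenerated V F ε Δ₀ k₀) {x : M}
    (hx : x ∈ ⨆ (c : ℤ) (_ : c ≠ 0), gradedPiece V F 0 c) :
    ε x = 0 := by
  have : ⨆ (c : ℤ) (_ : c ≠ 0), gradedPiece V F 0 c ≤ LinearMap.ker ε := by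
    refine iSup₂_le fun c hc => ?_
    rw [gradedPiece, Submodule.map₂_le]
    rintro a ha _ ⟨p, rfl⟩
    rw [LinearMap.mem_ker, shiftMode_zero, h.ε_zeroMode, stableClass_of_charge_ne_zero hc ha,
      zero_smul]
  exact this hx

/-- In a nonzero submodule there is a vector on which `ε` does not vanish, and its component in the
peak space belongs to the submodule. -/
theorem isIrreducible (h : IsPeakGenerated V F ε Δ₀ k₀) [IsSimpleModule (StableZhuAlgebra V) P] :
    IsIrreducibleVertexModule V M := by
  have : Nontrivial P := IsSimpleModule.nontrivial (StableZhuAlgebra V) P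
  refine ⟨h.injective.nontrivial, fun W hW => ?_⟩
  rw [or_iff_not_imp_left]
  intro hbot
  obtain ⟨x, hx, hx0⟩ := Submodule.exists_mem_ne_zero_of_ne_bot hbot
  obtain ⟨a, n, hn⟩ := h.exists_ne_zero x hx0
  have hy := hW a n x hx
  generalize mode M a n x = y at hn hy
  -- the component of energy `Δ₀`
  obtain ⟨y₁, hy₁, y₂, hy₂, rfl⟩ : ∃ y₁ ∈ energySpace V M Δ₀,
      ∃ y₂ ∈ ⨆ (Δ) (_ : Δ ≠ Δ₀), energySpace V M Δ, y₁ + y₂ = y := by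
    rw [← Submodule.mem_sup, ← iSup_eq_sup_iSup_ne]
    have : (⊤ : Submodule ℂ M) ≤ ⨆ Δ, energySpace V M Δ := by
      rw [← h.iSup_gradedPiece]
      exact iSup_le fun d => (h.iSup_gradedPiece_le d).trans (le_iSup (energySpace V M) _)
    exact this trivial
  have hyW := component_mem (f := mode M (omega V) 1) (hW _ _) hy₁ hy₂ hy
  rw [map_add, h.ε_of_energy_ne hy₂, add_zero] at hn
  -- the component of charge `k₀`
  obtain ⟨z₁, hz₁, z₂, hz₂, rfl⟩ : ∃ z₁ ∈ gradedPiece V F 0 0,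
      ∃ z₂ ∈ ⨆ (c : ℤ) (_ : c ≠ 0), gradedPiece V F 0 c, z₁ + z₂ = y₁ := by
    rw [← Submodule.mem_sup, ← iSup_eq_sup_iSup_ne, ← h.energySpace_eq]
    simpa using hy₁
  rw [map_add, h.ε_of_charge_ne hz₂, add_zero] at hn
  have hzW := component_mem (f := mode M (chargeCurrent V) 0) (μ := k₀ + (0 : ℤ)) (hW _ _)
    (h.gradedPiece_le_chargeSpace 0 0 hz₁) (by
      have : ⨆ (c : ℤ) (_ : c ≠ 0), gradedPiece V F 0 c ≤
          ⨆ (k) (_ : k ≠ k₀ + (0 : ℤ)), chargeSpace V M k :=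
        iSup₂_le fun c hc => (h.gradedPiece_le_chargeSpace 0 c).trans
          (le_iSup₂_of_le (k₀ + c) (fun e => hc (injective_add_intCast k₀ e)) le_rfl)
      exact this hz₂) hyW
  rw [h.gradedPiece_zero_zero] at hz₁
  obtain ⟨p, rfl⟩ := hz₁
  -- the part of `P` that is contained in `W`
  let Q : Submodule (StableZhuAlgebra V) P :=
    { carrier := {q | F q ∈ W}
      add_mem' := fun {q q'} hq hq' => by
        rw [Set.mem_ofPred_eq, map_add]
        exact add_mem hq hq'
      zero_mem' := by simp
      smul_mem' := fun y q hq => by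
        obtain ⟨a, ha, rfl⟩ := stableClass_surjective y
        rw [Set.mem_ofPred_eq, ← h.zeroMode a ⟨a, ha, rfl⟩]
        refine energy_induction (p := fun a => _root_.zeroMode M a (F q) ∈ W) (fun Θ a ha => ?_)
          (fun a a' h1 h2 => by rw [map_add]; exact add_mem h1 h2) a
        rw [zeroMode_apply ha]
        exact hW _ _ _ hq }
  have hQ : Q = ⊤ := (eq_bot_or_eq_top Q).resolve_left fun e => hn (by
    have : p ∈ Q := hzW
    rw [e, Submodule.mem_bot] at this
    rw [this, map_zero, map_zero])
  refine h.eq_top W fun a n q => hW a n _ ?_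
  have : q ∈ Q := by rw [hQ]; trivial
  exact this

end IsPeakGenerated

end PeakGenerated

/-! ### Strong generators -/

section Generators

variable {V : Type u} [AddCommGroup V] [Module ℂ V]

/-- The sum of the spaces `V_w'` with `w' < w`. -/
def energyBelow (V : Type u) [AddCommGroup V] [Module ℂ V] [ConformalVertexAlgebra V] (w : ℤ) :
    Submodule ℂ V :=
  ⨆ (w' : ℤ) (_ : w' < w), energySpace V V (w' : ℂ)

theorem mem_energyBelow [ConformalVertexAlgebra V] {w w' : ℤ} (h : w' < w) {v : V}
    (hv : v ∈ energySpace V V (w' : ℂ)) : v ∈ energyBelow V w :=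
  Submodule.mem_iSup_of_mem w' (Submodule.mem_iSup_of_mem h hv)

theorem modeSum_sub_mem_energyBelow [ConformalVertexAlgebra V] {Θ w : ℤ} {a b : V}
    (ha : a ∈ energySpace V V (Θ : ℂ)) (hb : b ∈ energySpace V V (w : ℂ)) (α s : ℤ) :
    modeSum V α s a b - mode V a s b ∈ energyBelow V (Θ + w - s - 1) := by
  obtain ⟨N, hN⟩ := mode_nat_truncated a b s
  have := finsum_mem_of_succ (energyBelow V (Θ + w - s - 1))
    (fun j : ℕ => intBinom α j • mode V a (s + j) b) N (fun j hj => by rw [hN j hj, smul_zero])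
    (fun j => ?_)
  · simpa [modeSum_apply, binomSum] using this
  · rw [← Int.cast_smul_eq_zsmul ℂ]
    exact Submodule.smul_mem _ _ (mem_energyBelow (w' := Θ + w - (s + (j + 1 : ℕ)) - 1)
      (by push_cast; lia) (mode_mem_energySpace _ ha hb (by push_cast; ring)))

theorem modeSum_mem_energyBelow [ConformalVertexAlgebra V] {Θ w : ℤ} {a b : V}
    (ha : a ∈ energySpace V V (Θ : ℂ)) (hb : b ∈ energyBelow V w) (α s : ℤ) :
    modeSum V α s a b ∈ energyBelow V (Θ + w - s - 1) := by
  have : energyBelow V w ≤ (energyBelow V (Θ + w - s - 1)).comap (modeSum V α s a) := by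
    refine iSup₂_le fun w' hw' b hb => ?_
    rw [Submodule.mem_comap, modeSum_apply, binomSum]
    refine finsum_mem_of_forall _ _ fun j => ?_
    rw [← Int.cast_smul_eq_zsmul ℂ]
    exact Submodule.smul_mem _ _ (mem_energyBelow (w' := Θ + w' - (s + j) - 1)
      (by lia) (mode_mem_energySpace _ ha hb (by push_cast; ring)))
  exact this hb

/-- An induction principle for strong generators: in the products `u_(-n) v` one may insert factors
`(1 + w)^α`, since this changes them by vectors of smaller weight. -/
theorem eq_top_of_strongGenerators [ConformalVertexAlgebra V] {ι : Type*} {u : ι → V} {Θ : ι → ℤ}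
    (hu : ∀ i, u i ∈ energySpace V V (Θ i : ℂ))
    (hspan : Submodule.span ℂ {v | StrongMonomial (Set.range u) v} = ⊤) (G : Submodule ℂ V)
    (h0 : vacuum V ∈ G)
    (h1 : ∀ i, ∀ n : ℤ, 1 ≤ n → ∃ α, ∀ v ∈ G, modeSum V α (-n) (u i) v ∈ G) : G = ⊤ := by
  have key : ∀ v, StrongMonomial (Set.range u) v →
      ∃ w : ℤ, v ∈ energySpace V V (w : ℂ) ∧ v ∈ G ⊔ energyBelow V w := by
    intro v hv
    induction hv with
    | vacuum => exact ⟨0, by simpa using vacuum_mem, Submodule.mem_sup_left h0⟩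
    | mode u' n v hu' hn _ ih =>
      obtain ⟨i, rfl⟩ := hu'
      obtain ⟨w, hw, hv⟩ := ih
      obtain ⟨α, hα⟩ := h1 i n hn
      refine ⟨Θ i + w - -n - 1, mode_mem_energySpace _ (hu i) hw (by push_cast; ring), ?_⟩
      obtain ⟨g, hg, v', hv', e⟩ := Submodule.mem_sup.1 hv
      have e1 : mode V (u i) (-n) v = modeSum V α (-n) (u i) g +
          (modeSum V α (-n) (u i) v' - (modeSum V α (-n) (u i) v - mode V (u i) (-n) v)) := by
        nth_rewrite 2 [← e]
        rw [map_add]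
        abel
      rw [e1]
      exact Submodule.add_mem_sup (hα g hg) (sub_mem (modeSum_mem_energyBelow (hu i) hv' _ _)
        (modeSum_sub_mem_energyBelow (hu i) hw _ _))
  have hle : ∀ w : ℤ, energySpace V V (w : ℂ) ≤ G ⊔ energyBelow V w := by
    intro w v hv
    refine (mem_of_iSupIndep (W := Module.End.eigenspace (mode V (omega V) 1))
      (Module.End.eigenspaces_iSupIndep (mode V (omega V) 1))
      (X := fun w : ℤ => energySpace V V (w : ℂ) ⊓ (G ⊔ energyBelow V w))
      (g := fun w : ℤ => (w : ℂ)) Int.cast_injective (fun w => inf_le_left) hv ?_).2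
    have : Submodule.span ℂ {v | StrongMonomial (Set.range u) v} ≤
        ⨆ w : ℤ, energySpace V V (w : ℂ) ⊓ (G ⊔ energyBelow V w) :=
      Submodule.span_le.2 fun v hv => by
        obtain ⟨w, hw⟩ := key v hv
        exact Submodule.mem_iSup_of_mem w hw
    rw [hspan] at this
    exact this trivial
  obtain ⟨B, hB⟩ := ConformalVertexAlgebra.weights_bounded (V := V)
  have hG : ∀ j : ℕ, ∀ w : ℤ, w < B + j → energySpace V V (w : ℂ) ≤ G := by
    intro j
    induction j with
    | zero =>
      intro w hw
      have : energySpace V V (w : ℂ) = ⊥ := hB w (by simpa using hw)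
      rw [this]
      exact bot_le
    | succ j ih =>
      intro w hw
      refine (hle w).trans (sup_le le_rfl (iSup₂_le fun w' hw' => ih w' ?_))
      push_cast at hw
      lia
  rw [eq_top_iff, ← show ⨆ w : ℤ, energySpace V V (w : ℂ) = ⊤ from
    ConformalVertexAlgebra.weights_integral]
  exact iSup_le fun w => hG (w - B + 1).toNat w (by lia)

/-- The components of finitely many strong generators are strong generators of definite weight and
charge. -/
theorem FinitelyStronglyGenerated.exists_homogeneous [ChargedConformalVertexAlgebra V]
    (hV : FinitelyStronglyGenerated V) : ∃ (ι : Type u) (_ : Finite ι) (u : ι → V) (Θ e : ι → ℤ),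
      (∀ i, u i ∈ weightSpace V V (Θ i : ℂ) (e i : ℂ)) ∧
        Submodule.span ℂ {v | StrongMonomial (Set.range u) v} = ⊤ := by
  obtain ⟨U, hU, hspan⟩ := hV
  have hex : ∀ a : V, ∃ S : Set V, S.Finite ∧
      (∀ b ∈ S, ∃ Θ e : ℤ, b ∈ weightSpace V V (Θ : ℂ) (e : ℂ)) ∧ a ∈ Submodule.span ℂ S := by
    refine weight_induction (fun Θ e a ha => ⟨{a}, Set.finite_singleton a, ?_, ?_⟩) ?_
    · rintro _ rfl
      exact ⟨Θ, e, ha⟩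
    · exact Submodule.subset_span rfl
    · rintro a b ⟨S, hS, hS', haS⟩ ⟨T, hT, hT', hbT⟩
      exact ⟨S ∪ T, hS.union hT, fun c hc => hc.elim (hS' c) (hT' c),
        add_mem (Submodule.span_mono Set.subset_union_left haS)
          (Submodule.span_mono Set.subset_union_right hbT)⟩
  choose S hS hS' hmem using hex
  have hT : (⋃ a ∈ U, S a).Finite := hU.biUnion fun a _ => hS a
  have hT' : ∀ b : ↥(⋃ a ∈ U, S a), ∃ Θ e : ℤ, (b : V) ∈ weightSpace V V (Θ : ℂ) (e : ℂ) := by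
    rintro ⟨b, hb⟩
    obtain ⟨a, ha, hb⟩ := Set.mem_iUnion₂.1 hb
    exact hS' a b hb
  choose Θ e hΘ using hT'
  refine ⟨↥(⋃ a ∈ U, S a), hT, Subtype.val, Θ, e, hΘ, ?_⟩
  rw [Subtype.range_coe, eq_top_iff, ← hspan, Submodule.span_le]
  intro v hv
  induction hv with
  | vacuum => exact Submodule.subset_span StrongMonomial.vacuum
  | mode a n v ha hn _ ih =>
    -- both factors are linear combinations, of generators and of monomials
    have h2 : ∀ b ∈ ⋃ a ∈ U, S a, mode V b (-n) v ∈
        Submodule.span ℂ {v | StrongMonomial (⋃ a ∈ U, S a) v} := by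
      intro b hb
      have : Submodule.span ℂ {v | StrongMonomial (⋃ a ∈ U, S a) v} ≤
          (Submodule.span ℂ {v | StrongMonomial (⋃ a ∈ U, S a) v}).comap (mode V b (-n)) :=
        Submodule.span_le.2 fun v hv => Submodule.subset_span (StrongMonomial.mode b n v hb hn hv)
      exact this ih
    have h3 : Submodule.span ℂ (S a) ≤ (Submodule.span ℂ
        {v | StrongMonomial (⋃ a ∈ U, S a) v}).comap ((modeHom V (-n)).flip v) :=
      Submodule.span_le.2 fun b hb => h2 b (Set.mem_iUnion₂.2 ⟨a, ha, hb⟩)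
    exact h3 (hmem a)

end Generators

/-! ### Finiteness of modules generated by their peak space -/

namespace IsPeakGenerated

variable {V : Type u} {M : Type*} {P : Type*} [AddCommGroup V] [Module ℂ V]
    [ChargedConformalVertexAlgebra V] [AddCommGroup M] [Module ℂ M] [VertexModule V M]
    [AddCommGroup P] [Module ℂ P] [Module (StableZhuAlgebra V) P] {F : P →ₗ[ℂ] M} {ε : M →ₗ[ℂ] P}
    {Δ₀ k₀ : ℂ}

theorem isTopVector (h : IsPeakGenerated V F ε Δ₀ k₀) {x : M} (hx : x ∈ energySpace V M Δ₀) :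
    IsTopVector V x := fun Θ a ha n hn =>
  h.eq_zero_of_energy_neg (d := Θ - n - 1) (by lia)
    (mode_mem_energySpace n ha hx (by push_cast; ring))

/-- On a vector `x` of lowest energy, the product `a_(s) b` with a factor `(1 + w)^(Θ - 1)` inserted
acts, up to a sign, as the zero mode of `a` followed by `b`, modulo images of the modes of `a` that
raise energies. -/
theorem shiftMode_modeSum_add_mem (h : IsPeakGenerated V F ε Δ₀ k₀) {Θ : ℤ} {a : V}
    (ha : a ∈ energySpace V V (Θ : ℂ)) {d : ℕ} {Y : Submodule ℂ M}
    (hY : ∀ j : ℕ, j < d → ∀ y ∈ energySpace V M (Δ₀ + (d - 1 - j : ℤ)),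
      shiftMode M (j + 1) a y ∈ Y) {s : ℤ} (hs : s ≤ -1) (b : V) {x : M}
    (hx : x ∈ energySpace V M Δ₀) :
    shiftMode M d (modeSum V (Θ - 1) s a b) x +
      (-1 : ℂ) ^ s • shiftMode M d b (_root_.zeroMode M a x) ∈ Y := by
  refine energy_induction (p := fun b => shiftMode M d (modeSum V (Θ - 1) s a b) x +
    (-1 : ℂ) ^ s • shiftMode M d b (_root_.zeroMode M a x) ∈ Y) (fun Ξ b hb => ?_)
    (fun b b' h1 h2 => ?_) b
  · rw [shiftMode_modeSum ha hb, finsum_eq_single (fun j : ℕ => ((-1 : ℂ) ^ ((j : ℤ) + s) *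
      intBinom s j) • _) 0 fun j hj => by rw [h.isTopVector hx Θ a ha _ (by lia), map_zero,
        smul_zero], zeroMode_apply ha, shiftMode_apply d hb,
      show Θ + Ξ - 2 - d - (Θ - 1) - ((0 : ℕ) : ℤ) = Ξ - 1 - d by simp; ring,
      show Θ - 1 + ((0 : ℕ) : ℤ) = Θ - 1 by simp]
    simp only [Nat.cast_zero, zero_add, intBinom, Ring.choose_zero_right, Int.cast_one, mul_one,
      sub_add_cancel]
    refine finsum_mem_of_forall _ _ fun j => Submodule.smul_mem _ _ ?_
    have hy : mode M b (Θ + Ξ - s - 2 - d - (Θ - 1) + j) x ∈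
        energySpace V M (Δ₀ + ((d : ℤ) - 1 - (j - s - 1) : ℤ)) :=
      mode_mem_energySpace _ hb hx (by push_cast; ring)
    rcases lt_or_ge (j - s - 1) (d : ℤ) with hj | hj
    · have := hY (j - s - 1).toNat (by lia) _ (by
        rwa [show ((j - s - 1).toNat : ℤ) = j - s - 1 by lia])
      rw [shiftMode_apply _ ha, show ((j - s - 1).toNat : ℤ) = j - s - 1 by lia,
        show Θ - 1 - (j - s - 1 + 1) = Θ - 1 + s - j by ring] at this
      exact this
    · rw [h.eq_zero_of_energy_neg (by lia) hy, map_zero]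
      exact zero_mem _
  · convert add_mem h1 h2 using 1
    simp only [map_add, LinearMap.add_apply, smul_add]
    abel

section

variable {ι : Type*} {u : ι → V} {Θ e : ι → ℤ}

/-- The vectors of positive energy are sums of images under the modes of the generators that raise
energies. Modulo these images the generators can be moved to the right, where their zero modes
preserve the vectors of lowest energy. -/
theorem energySpace_le (h : IsPeakGenerated V F ε Δ₀ k₀)
    (hu : ∀ i, u i ∈ energySpace V V (Θ i : ℂ))
    (hspan : Submodule.span ℂ {v | StrongMonomial (Set.range u) v} = ⊤) {d : ℕ} (hd : d ≠ 0) :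
    energySpace V M (Δ₀ + (d : ℤ)) ≤ ⨆ (i) (j : Fin d),
      (energySpace V M (Δ₀ + (d - 1 - j : ℤ))).map (shiftMode M (j + 1) (u i)) := by
  set Y := ⨆ (i) (j : Fin d),
      (energySpace V M (Δ₀ + (d - 1 - j : ℤ))).map (shiftMode M (j + 1) (u i)) with hYdef
  let G : Submodule ℂ V := ⨅ x : energySpace V M Δ₀, Y.comap ((shiftMode M d).flip x)
  have hG : ∀ b, b ∈ G ↔ ∀ x ∈ energySpace V M Δ₀, shiftMode M d b x ∈ Y := fun b => by
    simp [G, Submodule.mem_iInf]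
  have htop : G = ⊤ := by
    refine eq_top_of_strongGenerators hu hspan G ?_ fun i n hn => ⟨Θ i - 1, fun v hv => ?_⟩
    · rw [hG]
      intro x _
      rw [shiftMode_vacuum, if_neg (by exact_mod_cast hd)]
      exact zero_mem _
    · rw [hG] at hv ⊢
      intro x hx
      have h1 := h.shiftMode_modeSum_add_mem (hu i) (d := d) (Y := Y) (fun j hj y hy =>
        Submodule.mem_iSup_of_mem i (Submodule.mem_iSup_of_mem ⟨j, hj⟩ ⟨y, hy, rfl⟩))
        (s := -n) (by lia) v hx
      have h2 := hv _ (zeroMode_mem_energySpace (u i) hx)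
      simpa using sub_mem h1 (Submodule.smul_mem _ ((-1 : ℂ) ^ (-n)) h2)
  rw [h.energySpace_eq, iSup_gradedPiece_eq_map₂, Submodule.map₂_le]
  rintro b - _ ⟨p, rfl⟩
  exact (hG b).1 (by rw [htop]; trivial) _ (h.mem p).1

/-- The vectors of lowest energy are obtained from the peak space by zero modes of generators of
negative charge. -/
theorem energySpace_zero_le (h : IsPeakGenerated V F ε Δ₀ k₀)
    (hu : ∀ i, u i ∈ weightSpace V V (Θ i : ℂ) (e i : ℂ))
    (hspan : Submodule.span ℂ {v | StrongMonomial (Set.range u) v} = ⊤) :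
    energySpace V M Δ₀ ≤ LinearMap.range F ⊔
      ⨆ i : {i // e i < 0}, (energySpace V M Δ₀).map (_root_.zeroMode M (u i)) := by
  set Z := LinearMap.range F ⊔
      ⨆ i : {i // e i < 0}, (energySpace V M Δ₀).map (_root_.zeroMode M (u i)) with hZdef
  let G : Submodule ℂ V := ⨅ p : P, Z.comap ((_root_.zeroMode M).flip (F p))
  have hG : ∀ b, b ∈ G ↔ ∀ p, _root_.zeroMode M b (F p) ∈ Z := fun b => by
    simp [G, Submodule.mem_iInf]
  have htop : G = ⊤ := by
    refine eq_top_of_strongGenerators (fun i => (hu i).1) hspan G ?_ fun i n hn => ?_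
    · rw [hG]
      intro p
      rw [zeroMode_vacuum_apply]
      exact Submodule.mem_sup_left ⟨p, rfl⟩
    rcases lt_or_ge (e i) 0 with hi | hi
    · -- generators of negative charge are moved to the left
      refine ⟨Θ i, fun v _ => (hG _).2 fun p => ?_⟩
      rcases hn.eq_or_lt with rfl | hn
      · rw [← zhuProd_apply _ (hu i).1, (h.top p).zeroMode_mul]
        exact Submodule.mem_sup_right (Submodule.mem_iSup_of_mem ⟨i, hi⟩
          ⟨_, zeroMode_mem_energySpace v (h.mem p).1, rfl⟩)
      · rw [(h.top p).zeroMode_modeSum_eq_zero (hu i).1 (by lia)]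
        exact zero_mem _
    · -- the other generators are moved to the right, where they preserve the peak space
      refine ⟨Θ i - 1, fun v hv => (hG _).2 fun p => ?_⟩
      have h1 := h.shiftMode_modeSum_add_mem (hu i).1 (d := 0) (Y := Z) (fun j hj => by lia)
        (s := -n) (by lia) v (h.mem p).1
      rw [Nat.cast_zero, shiftMode_zero] at h1
      have h2 : _root_.zeroMode M v (_root_.zeroMode M (u i) (F p)) ∈ Z := by
        rcases hi.eq_or_lt with hi | hi
        · rw [h.zeroMode (u i) ⟨u i, hi ▸ (hu i).2, rfl⟩]
          exact (hG v).1 hv _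
        · rw [h.zeroMode_of_pos (e i) hi (u i) (hu i).2, map_zero]
          exact zero_mem _
      simpa using sub_mem h1 (Submodule.smul_mem _ ((-1 : ℂ) ^ (-n)) h2)
  have := h.energySpace_eq 0
  rw [Int.cast_zero, add_zero] at this
  rw [this, iSup_gradedPiece_eq_map₂, Submodule.map₂_le]
  rintro b - _ ⟨p, rfl⟩
  rw [shiftMode_zero]
  exact (hG b).1 (by rw [htop]; trivial) p

theorem map_shiftMode_gradedPiece_le (h : IsPeakGenerated V F ε Δ₀ k₀) {a : V} {c : ℤ}
    (ha : a ∈ chargeSpace V V (c : ℂ)) (i d k : ℤ) :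
    (gradedPiece V F d k).map (shiftMode M i a) ≤ chargeSpace V M (k₀ + (k + c : ℤ)) := by
  rintro _ ⟨x, hx, rfl⟩
  exact shiftMode_mem_chargeSpace i ha (h.gradedPiece_le_chargeSpace d k hx) (by push_cast; ring)

/-- A bound for a sum of graded pieces by subspaces of fixed charge bounds each piece. -/
theorem gradedPiece_le_of_iSup (h : IsPeakGenerated V F ε Δ₀ k₀) {d : ℤ} {Y : ℤ → Submodule ℂ M}
    (hY : ∀ c, Y c ≤ chargeSpace V M (k₀ + c))
    (hle : energySpace V M (Δ₀ + d) ≤ ⨆ c, Y c) (c : ℤ) : gradedPiece V F d c ≤ Y c := fun _ hx =>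
  mem_of_iSupIndep (W := Module.End.eigenspace (mode M (chargeCurrent V) 0))
    (Module.End.eigenspaces_iSupIndep (mode M (chargeCurrent V) 0)) (X := Y)
    (g := fun d : ℤ => k₀ + d) (injective_add_intCast k₀) hY
    (h.gradedPiece_le_chargeSpace d c hx) (hle (h.gradedPiece_le d c hx).1)

theorem gradedPiece_le_iSup (h : IsPeakGenerated V F ε Δ₀ k₀)
    (hu : ∀ i, u i ∈ weightSpace V V (Θ i : ℂ) (e i : ℂ))
    (hspan : Submodule.span ℂ {v | StrongMonomial (Set.range u) v} = ⊤) {d : ℕ} (hd : d ≠ 0)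
    (c : ℤ) : gradedPiece V F d c ≤ ⨆ (i) (j : Fin d),
      (gradedPiece V F (d - 1 - j) (c - e i)).map (shiftMode M (j + 1) (u i)) := by
  refine h.gradedPiece_le_of_iSup (Y := fun c => ⨆ (i) (j : Fin d),
    (gradedPiece V F (d - 1 - j) (c - e i)).map (shiftMode M (j + 1) (u i)))
    (fun c => iSup₂_le fun i j => ?_) ?_ c
  · have := h.map_shiftMode_gradedPiece_le (hu i).2 (j + 1) (d - 1 - j) (c - e i)
    rwa [sub_add_cancel] at this
  · refine (h.energySpace_le (fun i => (hu i).1) hspan hd).trans (iSup₂_le fun i j => ?_)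
    rw [h.energySpace_eq, Submodule.map_iSup]
    refine iSup_le fun k => ?_
    refine le_iSup_of_le (k + e i) (le_iSup₂_of_le i j ?_)
    rw [add_sub_cancel_right]

theorem gradedPiece_zero_le_iSup (h : IsPeakGenerated V F ε Δ₀ k₀)
    (hu : ∀ i, u i ∈ weightSpace V V (Θ i : ℂ) (e i : ℂ))
    (hspan : Submodule.span ℂ {v | StrongMonomial (Set.range u) v} = ⊤) (c : ℤ) :
    gradedPiece V F 0 c ≤ (⨆ _ : c = 0, LinearMap.range F) ⊔ ⨆ i : {i // e i < 0},
      (gradedPiece V F 0 (c - e i)).map (shiftMode M 0 (u i)) := by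
  refine h.gradedPiece_le_of_iSup (Y := fun c => (⨆ _ : c = 0, LinearMap.range F) ⊔
    ⨆ i : {i // e i < 0}, (gradedPiece V F 0 (c - e i)).map (shiftMode M 0 (u i)))
    (fun c => sup_le (iSup_le fun hc => ?_) (iSup_le fun i => ?_)) ?_ c
  · rintro _ ⟨p, rfl⟩
    simpa [hc] using (h.mem p).2
  · have := h.map_shiftMode_gradedPiece_le (hu i).2 0 0 (c - e i)
    rwa [sub_add_cancel] at this
  · have e0 := h.energySpace_eq 0
    have e1 := h.energySpace_zero_le hu hspan
    rw [Int.cast_zero, add_zero] at e0 ⊢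
    refine e1.trans (sup_le ?_ (iSup_le fun i => ?_))
    · exact le_iSup_of_le 0 (le_sup_of_le_left (le_iSup_of_le rfl le_rfl))
    · rw [e0, Submodule.map_iSup]
      refine iSup_le fun k => ?_
      refine le_iSup_of_le (k + e i) (le_sup_of_le_right (le_iSup_of_le i ?_))
      rw [add_sub_cancel_right, shiftMode_zero]

/-- At lowest energy, the graded pieces are finite dimensional by descending induction on the
charge. -/
theorem finite_gradedPiece_zero (h : IsPeakGenerated V F ε Δ₀ k₀) [FiniteDimensional ℂ P]
    [Finite ι] (hu : ∀ i, u i ∈ weightSpace V V (Θ i : ℂ) (e i : ℂ))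
    (hspan : Submodule.span ℂ {v | StrongMonomial (Set.range u) v} = ⊤) (c : ℤ) :
    FiniteDimensional ℂ (gradedPiece V F 0 c) := by
  have key : ∀ n : ℕ, ∀ c : ℤ, 0 < c + n → FiniteDimensional ℂ (gradedPiece V F 0 c) := by
    intro n
    induction n with
    | zero =>
      intro c hc
      rw [h.gradedPiece_zero_of_pos (by simpa using hc)]
      infer_instance
    | succ n ih =>
      intro c hc
      have : ∀ i : {i // e i < 0}, FiniteDimensional ℂ (gradedPiece V F 0 (c - e i)) := fun i =>
        ih _ (by have := i.2; push_cast at hc; lia)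
      exact Submodule.finiteDimensional_of_le (h.gradedPiece_zero_le_iSup hu hspan c)
  exact key (1 - c).toNat c (by lia)

theorem finite_gradedPiece (h : IsPeakGenerated V F ε Δ₀ k₀) [FiniteDimensional ℂ P] [Finite ι]
    (hu : ∀ i, u i ∈ weightSpace V V (Θ i : ℂ) (e i : ℂ))
    (hspan : Submodule.span ℂ {v | StrongMonomial (Set.range u) v} = ⊤) (d c : ℤ) :
    FiniteDimensional ℂ (gradedPiece V F d c) := by
  have key : ∀ d : ℕ, ∀ c : ℤ, FiniteDimensional ℂ (gradedPiece V F d c) := by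
    intro d
    induction d using Nat.strong_induction_on with
    | _ d ih =>
      intro c
      rcases eq_or_ne d 0 with rfl | hd
      · exact h.finite_gradedPiece_zero hu hspan c
      have : ∀ (i : ι) (j : Fin d), FiniteDimensional ℂ
          (gradedPiece V F (d - 1 - j) (c - e i)) := by
        intro i j
        have := ih (d - 1 - j) (by lia) (c - e i)
        rwa [show ((d - 1 - j : ℕ) : ℤ) = d - 1 - j by lia] at this
      exact Submodule.finiteDimensional_of_le (h.gradedPiece_le_iSup hu hspan hd c)
  rcases lt_or_ge d 0 with hd | hd
  · rw [h.gradedPiece_of_neg hd]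
    infer_instance
  · have := key d.toNat c
    rwa [show (d.toNat : ℤ) = d by lia] at this

/-- A generator that raises the energy may raise the charge too, but at most by the largest charge
of a generator. -/
theorem exists_charge_bound (h : IsPeakGenerated V F ε Δ₀ k₀) [Finite ι]
    (hu : ∀ i, u i ∈ weightSpace V V (Θ i : ℂ) (e i : ℂ))
    (hspan : Submodule.span ℂ {v | StrongMonomial (Set.range u) v} = ⊤) (d : ℤ) :
    ∃ K : ℤ, ∀ c, K < c → gradedPiece V F d c = ⊥ := by
  obtain ⟨E, hE⟩ := (Set.finite_range e).bddAbove
  have hE : ∀ i, e i ≤ E := fun i => hE ⟨i, rfl⟩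
  have key : ∀ n : ℕ, ∃ K : ℤ, ∀ d : ℕ, d < n → ∀ c, K < c → gradedPiece V F d c = ⊥ := by
    intro n
    induction n with
    | zero => exact ⟨0, fun d hd => by lia⟩
    | succ n ih =>
      obtain ⟨K, hK⟩ := ih
      refine ⟨max (max K (K + E)) 0, fun d hd c hc => ?_⟩
      rcases eq_or_ne d 0 with rfl | hd0
      · exact h.gradedPiece_zero_of_pos (by lia)
      rcases (Nat.lt_succ_iff_lt_or_eq.1 hd) with hd | rfl
      · exact hK d hd c (by lia)
      rw [eq_bot_iff]
      refine (h.gradedPiece_le_iSup hu hspan hd0 c).trans (iSup₂_le fun i j => ?_)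
      have := hK (d - 1 - j) (by lia) (c - e i) (by have := hE i; lia)
      rw [show ((d - 1 - j : ℕ) : ℤ) = d - 1 - j by lia] at this
      rw [this, Submodule.map_bot]
  rcases lt_or_ge d 0 with hd | hd
  · exact ⟨0, fun c _ => h.gradedPiece_of_neg hd c⟩
  · obtain ⟨K, hK⟩ := key (d.toNat + 1)
    refine ⟨K, fun c hc => ?_⟩
    have := hK d.toNat (by lia) c hc
    rwa [show (d.toNat : ℤ) = d by lia] at this

end

theorem isStable (h : IsPeakGenerated V F ε Δ₀ k₀) [FiniteDimensional ℂ P]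
    (hV : FinitelyStronglyGenerated V) : IsStableVertexModule V M := by
  obtain ⟨ι, _, u, Θ, e, hu, hspan⟩ := hV.exists_homogeneous
  refine ⟨?_, fun Δ k => ?_, ⟨Δ₀.re, fun Δ k hΔ => ?_⟩, fun Δ => ?_⟩
  · rw [eq_top_iff, ← h.iSup_gradedPiece]
    exact iSup₂_le fun d c => (h.gradedPiece_le d c).trans
      (le_iSup (fun p : ℂ × ℂ => weightSpace V M p.1 p.2) (Δ₀ + d, k₀ + c))
  · by_cases hw : ∃ d c : ℤ, Δ₀ + d = Δ ∧ k₀ + c = k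
    · obtain ⟨d, c, rfl, rfl⟩ := hw
      rw [h.weightSpace_eq]
      exact h.finite_gradedPiece hu hspan d c
    · have : weightSpace V M Δ k = ⊥ := (Submodule.eq_bot_iff _).2 fun x hx => by
        by_contra hx0
        exact hw (h.exists_weight hx hx0)
      rw [this]
      infer_instance
  · refine (Submodule.eq_bot_iff _).2 fun x hx => ?_
    by_contra hx0
    obtain ⟨d, rfl⟩ := h.exists_energy hx.1 hx0
    have hd : d < 0 := by
      have : (d : ℝ) < 0 := by simpa using hΔ
      exact_mod_cast this
    exact hx0 (h.eq_zero_of_energy_neg hd hx.1)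
  · by_cases hw : ∃ d : ℤ, Δ₀ + d = Δ
    · obtain ⟨d, rfl⟩ := hw
      obtain ⟨K, hK⟩ := h.exists_charge_bound hu hspan d
      refine ⟨k₀.re + K, fun k hk => (Submodule.eq_bot_iff _).2 fun x hx => ?_⟩
      by_contra hx0
      obtain ⟨d', c, -, rfl⟩ := h.exists_weight hx hx0
      have hc : K < c := by
        have : (K : ℝ) < c := by simpa using hk
        exact_mod_cast this
      rw [h.weightSpace_eq, hK c hc] at hx
      exact hx0 hx
    · refine ⟨0, fun k _ => (Submodule.eq_bot_iff _).2 fun x hx => ?_⟩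
      by_contra hx0
      exact hw (h.exists_energy hx.1 hx0)

end IsPeakGenerated

/-! ### The module generated by the functionals on the stable Zhu algebra -/

section Associativity

variable {V : Type*} {M : Type*} [AddCommGroup V] [Module ℂ V] [VertexAlgebra V]
    [AddCommGroup M] [Module ℂ M] [VertexModule V M]

/-- A product of two modes applied to `x` is a combination of vectors `c_(n) x`, by induction on the
number of nonzero vectors `b_(q + i) x` with `i ≥ 0`. -/
theorem mode_mode_mem {S : Submodule ℂ M} {x : M} (hS : ∀ (c : V) (n : ℤ), mode M c n x ∈ S)
    (a b : V) (p q : ℤ) : mode M a p (mode M b q x) ∈ S := by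
  obtain ⟨Na, hNa⟩ := mode_truncated a x
  obtain ⟨Nb, hNb⟩ := mode_truncated b x
  have key : ∀ i : ℕ, ∀ p q : ℤ, Nb ≤ q + i → mode M a p (mode M b q x) ∈ S := by
    intro i
    induction i with
    | zero =>
      intro p q hq
      rw [hNb q (by simpa using hq), map_zero]
      exact zero_mem _
    | succ i ih =>
      intro p q hq
      have B := mode_borcherds a b x q Na (p - Na)
      rw [finsum_eq_zero_of_forall_eq_zero (f := fun j : ℕ => ((-1 : ℂ) ^ ((j : ℤ) + (p - Na)) *
        intBinom (p - Na) j) • _) fun j => by rw [hNa _ (by lia), map_zero, smul_zero],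
        sub_zero] at B
      have h1 : (∑ᶠ j : ℕ, intBinom Na j •
          mode M (mode V a (p - Na + j) b) (Na + q - j) x) ∈ S :=
        finsum_mem_of_forall _ _ fun j => by
          rw [← Int.cast_smul_eq_zsmul ℂ]
          exact Submodule.smul_mem _ _ (hS _ _)
      have h2 := finsum_mem_of_succ S (fun j : ℕ => ((-1 : ℂ) ^ j * intBinom (p - Na) j) •
        mode M a (Na + (p - Na) - j) (mode M b (q + j) x)) (Nb - q).toNat
        (fun j hj => by rw [hNb _ (by lia), map_zero, smul_zero])
        (fun j => Submodule.smul_mem _ _ (ih _ _ (by push_cast at hq ⊢; lia)))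
      rw [B] at h1
      simpa using sub_mem h1 h2
  exact key (Nb - q).toNat p q (by lia)

end Associativity

section Main

variable (V : Type u) [AddCommGroup V] [Module ℂ V] [ChargedConformalVertexAlgebra V]
    (P : Type v) [AddCommGroup P] [Module ℂ P] [Module (StableZhuAlgebra V) P]
    [IsScalarTower ℂ (StableZhuAlgebra V) P]

/-- The submodule of the regular dual that is generated by the functionals `b ↦ [b] p`. -/
def peakSpan : Submodule ℂ (regularDual V P) :=
  Submodule.span ℂ {x | ∃ (a : V) (n : ℤ) (p : P),
    mode (regularDual V P) a n (peakFunctional V P p) = x}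

/-- The module generated by the functionals `b ↦ [b] p`, as a space of functionals on `V`. -/
def peakModule : Submodule ℂ (V →ₗ[ℂ] P) := (peakSpan V P).map (regularDual V P).subtype

variable {V P}

theorem mode_mem_peakSpan {x : regularDual V P} (hx : x ∈ peakSpan V P) (a : V) (n : ℤ) :
    mode (regularDual V P) a n x ∈ peakSpan V P := by
  have : peakSpan V P ≤ (peakSpan V P).comap (mode (regularDual V P) a n) :=
    Submodule.span_le.2 <| by
      rintro _ ⟨b, q, p, rfl⟩
      exact mode_mode_mem (S := peakSpan V P) (x := peakFunctional V P p)
        (fun c n => Submodule.subset_span ⟨c, n, p, rfl⟩) a b n q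
  exact this hx

theorem peakModule_le : peakModule V P ≤ regularDual V P := Submodule.map_subtype_le _ _

theorem regMode_mem_peakModule (φ : V →ₗ[ℂ] P) (hφ : φ ∈ peakModule V P) (a : V) (n : ℤ) :
    regMode φ a n ∈ peakModule V P := by
  obtain ⟨x, hx, rfl⟩ := hφ
  exact ⟨_, mode_mem_peakSpan hx a n, regularDual_mode a n x⟩

instance peakModule.vertexModule : VertexModule V (peakModule V P) :=
  dualModule peakModule_le regMode_mem_peakModule

theorem inclusion_mode (a : V) (n : ℤ) (x : peakModule V P) :
    Submodule.inclusion peakModule_le (mode (peakModule V P) a n x) =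
      mode (regularDual V P) a n (Submodule.inclusion peakModule_le x) :=
  Subtype.ext ((dualModule_mode peakModule_le regMode_mem_peakModule a n x).trans
    (regularDual_mode a n (Submodule.inclusion peakModule_le x)).symm)

theorem inclusion_zeroMode (a : V) (x : peakModule V P) :
    Submodule.inclusion peakModule_le (zeroMode (peakModule V P) a x) =
      zeroMode (regularDual V P) a (Submodule.inclusion peakModule_le x) := by
  refine energy_induction (p := fun a =>
    Submodule.inclusion peakModule_le (zeroMode (peakModule V P) a x) =
      zeroMode (regularDual V P) a (Submodule.inclusion peakModule_le x)) (fun Δ a ha => ?_)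
    (fun a b h h' => ?_) a
  · rw [zeroMode_apply ha, zeroMode_apply ha, inclusion_mode]
  · rw [map_add, map_add, LinearMap.add_apply, LinearMap.add_apply, map_add, h, h']

variable (V P) in
/-- The map `p ↦ (b ↦ [b] p)`, with values in the module generated by its image. -/
def peakInclusion : P →ₗ[ℂ] peakModule V P :=
  ((regularDual V P).subtype ∘ₗ peakFunctional V P).codRestrict (peakModule V P) fun p => by
    refine ⟨_, Submodule.subset_span ⟨vacuum V, -1, p, ?_⟩, rfl⟩
    rw [mode_vacuum, if_pos rfl]

variable (V P) in
/-- Evaluation at the vacuum. -/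
def evalVacuum : peakModule V P →ₗ[ℂ] P :=
  LinearMap.applyₗ (vacuum V) ∘ₗ (peakModule V P).subtype

theorem evalVacuum_apply (x : peakModule V P) :
    evalVacuum V P x = (Submodule.inclusion peakModule_le x).1 (vacuum V) := rfl

theorem inclusion_peakInclusion (p : P) :
    Submodule.inclusion peakModule_le (peakInclusion V P p) = peakFunctional V P p := rfl

theorem isPeakGenerated_peakModule {Δ k : ℂ}
    (hw : ∀ p : P, peakFunctional V P p ∈ weightSpace V (regularDual V P) Δ k) :
    IsPeakGenerated V (peakInclusion V P) (evalVacuum V P) Δ k where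
  eq_top W hW := by
    have h : peakSpan V P ≤ W.map (Submodule.inclusion peakModule_le) :=
      Submodule.span_le.2 <| by
        rintro _ ⟨a, n, p, rfl⟩
        exact ⟨_, hW a n p, by rw [inclusion_mode, inclusion_peakInclusion]⟩
    refine eq_top_iff.2 fun x _ => ?_
    obtain ⟨y, hy, hyx⟩ := x.2
    obtain ⟨z, hz, hzy⟩ := h hy
    have : z = x := Subtype.ext ((congrArg Subtype.val hzy).trans hyx)
    rwa [← this]
  top p Θ a ha n hn := by
    refine Submodule.inclusion_injective peakModule_le ?_
    rw [inclusion_mode, map_zero]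
    exact isTopVector_peakFunctional p Θ a ha n hn
  mem p := by
    refine ⟨mem_energySpace.2 ?_, mem_chargeSpace.2 ?_⟩ <;>
      refine Submodule.inclusion_injective peakModule_le ?_ <;>
      rw [inclusion_mode, map_smul, inclusion_peakInclusion]
    · exact mem_energySpace.1 (hw p).1
    · exact mem_chargeSpace.1 (hw p).2
  zeroMode a ha p := by
    refine Submodule.inclusion_injective peakModule_le ?_
    rw [inclusion_zeroMode, inclusion_peakInclusion, zeroMode_peakFunctional ha,
      inclusion_peakInclusion]
  zeroMode_of_pos c hc a ha p := by
    refine Submodule.inclusion_injective peakModule_le ?_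
    rw [inclusion_zeroMode, inclusion_peakInclusion, zeroMode_peakFunctional_of_pos hc ha, map_zero]
  exists_ne_zero x hx := by
    obtain ⟨a, n, h⟩ := exists_mode_vacuum_ne_zero
      (φ := Submodule.inclusion peakModule_le x) fun e => hx
        (Submodule.inclusion_injective peakModule_le (e.trans (map_zero _).symm))
    exact ⟨a, n, by rwa [evalVacuum_apply, inclusion_mode]⟩
  ε_zeroMode a p := by
    rw [evalVacuum_apply, inclusion_zeroMode, inclusion_peakInclusion,
      (isTopVector_peakFunctional p).zeroMode_vacuum, peakFunctional_apply]
  ε_mode Δ a ha n hn x := by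
    rw [evalVacuum_apply, inclusion_mode, mode_vacuum_eq_zero _ ha hn]

end Main

end

theorem mainTheorem9 {V : Type u} [AddCommGroup V] [Module ℂ V]
    [ChargedConformalVertexAlgebra V] (hV : FinitelyStronglyGenerated V)
    {P : Type v} [AddCommGroup P] [Module ℂ P] [Module (StableZhuAlgebra V) P]
    [IsScalarTower ℂ (StableZhuAlgebra V) P] [IsSimpleModule (StableZhuAlgebra V) P]
    [FiniteDimensional ℂ P] :
    ∃ (M : Type (max u v)) (_ : AddCommGroup M) (_ : Module ℂ M) (_ : VertexModule V M),
      IsIrreducibleVertexModule V M ∧ IsStableVertexModule V M ∧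
        ∃ (Δ k : ℂ) (hp : IsPeakWeight V M Δ k),
          Nonempty (P ≃ₗ[StableZhuAlgebra V] PeakSpace hp) := by
  have : Nontrivial P := IsSimpleModule.nontrivial (StableZhuAlgebra V) P
  obtain ⟨Δ, k, hw⟩ := exists_weight_peakFunctional V P
  have h := isPeakGenerated_peakModule hw
  exact ⟨peakModule V P, inferInstance, inferInstance, inferInstance, h.isIrreducible,
    h.isStable hV, Δ, k, h.isPeakWeight,
    ⟨LinearEquiv.ofBijective (h.peakMap h.isPeakWeight) (h.peakMap_bijective _)⟩⟩
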